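/- **Setting.** Let $E$ be a finite set, $F$ the free group on $E$, $Z$ a finite subset of $F$, and $G=\langle Z\rangle$. Automorphisms act on the right, as exponents; $\overline{\phi}=\phi^{-1}$ and $\overline g=g^{-1}$. A *basis* of $F$ is a free-generating set. Write $E^{\pm1}=E\cup E^{-1}$. *Cuts.* $\mathrm{cuts}(E)$ is the set of triples $\mathbf C=({}_0D,{}_1D,e_\star)$ with ${}_0D\cup{}_1D=E^{\pm1}$, ${}_0D\cap{}_1D=\{e_\star\}$ and ${}_1D\neq\{e_\star\}$. Let $\chi:E^{\pm1}\to\{0,1\}$ be the characteristic map of ${}_1D$, $\eta=\chi(\overline e_\star)$ and $d_\star=e_\star^{2\eta-1}$. Let $\phi_{\mathbf C}$ be the automorphism of $F$ that fixes $d_\star$ and maps each $e\in E\setminus\{d_\star,\overline d_\star\}$ to $d_\star^{\chi(e)}\,e\,\overline d_\star^{\,\chi(\overline e)}$. *Cores.* For a subgroup $H\le F$, the Schreier graph of $H$ with respect to a basis $S$ of $F$ has vertex set $H\backslash F$, basepoint $H1$, and an edge labelled $s$ from $Hg$ to $Hgs$ for each coset $Hg$ and each $s\in S$. The graph $\mathrm{core}(H)$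 consists of the vertices and edges of the Schreier graph of $H$ with respect to $E$ that are involved in reduced closed paths at $H1$; it is a basepointed $E$-labelled graph. *The operation $\partial_{\mathbf C}$.* For each $e\in E$ let $(\alpha,\beta)\in\{0,1\}^2$ be the unique pair such that $e\in{}_\alpha D$, $\overline e\in{}_\beta D$ and $e^{\phi_{\mathbf C}}=d_\star^{\alpha}\,e\,\overline d_\star^{\,\beta}$. Let $X$ be the subgraph of the Schreier graph of $H$ with respect to the basis $E^{\phi_{\mathbf C}}$ that has all the cosets as vertices and has, for each edge from $Hg$ to $Hge$ labelled $e$ of $\mathrm{core}(H)$, the edge from $Hg\overline d_\star^{\,\alpha}$ to $Hge\overline d_\star^{\,\beta}$ labelled $e^{\phi_{\mathbf C}}$. Let $K\le H$ be the fundamental group of $X$ at $H1$, read through the labels, and set $\partial_{\mathbf C}H=K^{\overline\phi_{\mathbf C}}$. *The graph $(G\blacktriangleleft)$.* Its vertex set is the smallest set of subgroups of $F$ that contains $G$ and is closed under all the operations $\partial_{\mathbf C}$, $\mathbf C\in\mathrm{cuts}(E)$. It has one edge $(H,\mathbf C)$, from $H$ to $\partial_{\mathbf C}H$, for each vertex $H$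 and each $\mathbf C\in\mathrm{cuts}(E)$. A sequence $(\mathbf C_i)_{i=1}^n$ of cuts, $n\ge 0$, is regarded as the path in $(G\blacktriangleleft)$ from $G$ to $\partial_{\mathbf C_n}\cdots\partial_{\mathbf C_1}G$. **Theorem.** (i) $(G\blacktriangleleft)$ is a finite graph. Its vertices are finitely generated subgroups $H$ whose graphs $\mathrm{core}(H)$ are finite, and a vertex $H$ is determined by the isomorphism class of $\mathrm{core}(H)$ as basepointed $E$-labelled graph. The graph $(G\blacktriangleleft)$, with its vertices viewed as such graphs, can be constructed algorithmically. (ii) For each vertex $H$ of $(G\blacktriangleleft)$ there is an algorithmically constructible path $(\mathbf C_i)_{i=1}^n$ from $G$ to $H$ such that $$H=\partial_{\mathbf C_n}\cdots\partial_{\mathbf C_1}G\le G^{\overline\phi_{\mathbf C_1}\cdots\overline\phi_{\mathbf C_n}},\qquad (E\cap H)^{\phi_{\mathbf C_n}\cdots\phi_{\mathbf C_1}}\subseteq E''\cap G,$$ where $E''=E^{\phi_{\mathbf C_n}\cdots\phi_{\mathbf C_1}}$ is a basis of $F$. (iii) For each basis $E''$ of $F$ there is a vertex $H$ of $(G\blacktriangleleft)$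 such that $|E\cap H|\ge|E''\cap G|$. Consequently, if $H$ is a vertex of $(G\blacktriangleleft)$ with $|E\cap H|$ maximal and $(\mathbf C_i)_{i=1}^n$ is any path from $G$ to $H$, then $E''=E^{\phi_{\mathbf C_n}\cdots\phi_{\mathbf C_1}}$ is a basis of $F$ that maximizes $|E''\cap\langle Z\rangle|$ among all bases of $F$. There is an algorithm that finds such an $H$ and returns the basis $E''$ given by the constructed path from $G$ to $H$. Here "algorithmically" means: by computable functions, uniform in $|E|$ and $Z$, whose input is $|E|$ (with $E$ enumerated) together with a finite list of words in $E^{\pm1}$ that represent the elements of $Z$. -/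

import Mathlib

universe u v w

/-! ### Bases of free groups -/

/-- `B` is a basis (a free-generating set) of the free group on `E`. -/
def IsBasisSet {E : Type u} (B : Set (FreeGroup E)) : Prop :=
  ∃ b : FreeGroupBasis B (FreeGroup E), ∀ x : B, b x = (x : FreeGroup E)

/-- The set `E`, viewed inside the free group on `E`. -/
def gens (E : Type u) : Set (FreeGroup E) := Set.range FreeGroup.of

/-- `B` is a basis for which the number of elements lying in `G` is as large as possible. -/
def IsMaximizingBasis {E : Type u} (G : Subgroup (FreeGroup E)) (B : Set (FreeGroup E)) : Prop :=
  IsBasisSet B ∧ ∀ B' : Set (FreeGroup E), IsBasisSet B' →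
    (B' ∩ (G : Set (FreeGroup E))).encard ≤ (B ∩ (G : Set (FreeGroup E))).encard

/-! ### Cuts and their automorphisms

An element of `E^{±1}` is a letter `(e, ε) : E × Bool`, as in `FreeGroup`: `(e, true)` is `e`
and `(e, false)` is `e⁻¹`. -/

/-- The inverse letter. -/
def letterInv {E : Type u} (a : E × Bool) : E × Bool := (a.1, !a.2)

/-- The set `cuts(E)` of triples `(₀D, ₁D, e⋆)`. -/
structure Cut (E : Type u) [Fintype E] [DecidableEq E] where
  D0 : Finset (E × Bool)
  D1 : Finset (E × Bool)
  star : E × Bool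
  union_eq : D0 ∪ D1 = Finset.univ
  inter_eq : D0 ∩ D1 = {star}
  D1_ne : D1 ≠ {star}

namespace Cut

variable {E : Type u} [Fintype E] [DecidableEq E] (C : Cut E)

/-- The characteristic map of `₁D`. -/
def chi (a : E × Bool) : ℕ := if a ∈ C.D1 then 1 else 0

/-- `η = χ(e⋆⁻¹)`. -/
def eta : ℕ := C.chi (letterInv C.star)

/-- `d⋆ = e⋆ ^ (2 η - 1)`. -/
def dStar : FreeGroup E := FreeGroup.mk [C.star] ^ (2 * (C.eta : ℤ) - 1)

/-- The endomorphism that fixes the generator underlying `e⋆` (equivalently, that underlying `d⋆`)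
and sends each other `e ∈ E` to `g ^ χ(e) * e * g ^ (-χ(e⁻¹))`. -/
def twist (g : FreeGroup E) : FreeGroup E →* FreeGroup E :=
  FreeGroup.lift fun e =>
    if e = C.star.1 then FreeGroup.of e
    else g ^ C.chi (e, true) * FreeGroup.of e * g⁻¹ ^ C.chi (e, false)

theorem twist_dStar (g : FreeGroup E) : C.twist g C.dStar = C.dStar := by
  have h : C.twist g (FreeGroup.mk [C.star]) = FreeGroup.mk [C.star] := by
    rcases hs : C.star with ⟨e, b⟩
    cases b <;> simp [twist, hs, FreeGroup.of, FreeGroup.inv_mk, FreeGroup.invRev]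
  rw [dStar, map_zpow, h]

theorem twist_twist (g : FreeGroup E) (hg : C.twist g⁻¹ g = g) :
    (C.twist g⁻¹).comp (C.twist g) = MonoidHom.id _ := by
  ext e
  by_cases he : e = C.star.1
  · subst he; simp [twist]
  · have h1 : C.twist g (FreeGroup.of e)
        = g ^ C.chi (e, true) * FreeGroup.of e * g⁻¹ ^ C.chi (e, false) := by
      simp [twist, he]
    have h2 : C.twist g⁻¹ (FreeGroup.of e)
        = g⁻¹ ^ C.chi (e, true) * FreeGroup.of e * g ^ C.chi (e, false) := by
      simp [twist, he]
    simp only [MonoidHom.comp_apply, MonoidHom.id_apply, h1, map_mul, map_pow, map_inv, hg, h2]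
    group

/-- The automorphism `φ_C`, which fixes `d⋆` and sends each `e ∈ E - d⋆^{±1}` to
`d⋆ ^ χ(e) * e * d⋆ ^ (-χ(e⁻¹))`. -/
def phi : MulAut (FreeGroup E) :=
  MonoidHom.toMulEquiv (C.twist C.dStar) (C.twist C.dStar⁻¹)
    (C.twist_twist _ (C.twist_dStar _))
    (by
      have h := C.twist_twist C.dStar⁻¹ (by rw [inv_inv, map_inv, C.twist_dStar])
      rwa [inv_inv] at h)

/-- For `e ∈ E`, the unique pair `(α, β)` of elements of `{0,1}` such that `e ∈ ₐD`, `e⁻¹ ∈ ᵦD` and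
`φ_C e = d⋆ ^ α * e * d⋆ ^ (-β)` is `(shift (e, true), shift (e, false))`. -/
def shift (a : E × Bool) : ℕ := if a.1 = C.star.1 then C.eta else C.chi a

end Cut

/-! ### Basepointed labelled graphs -/

/-- A basepointed `L`-labelled graph, with vertices in `V`, whose edges are determined by their
initial vertex, label and terminal vertex: `(u, e, v)` is the edge from `u` to `v` labelled `e`. -/
structure LabGraph (L : Type u) (V : Type v) where
  verts : Set V
  base : V
  edges : Set (V × L × V)
  base_mem : base ∈ verts
  source_mem : ∀ t ∈ edges, t.1 ∈ verts
  target_mem : ∀ t ∈ edges, t.2.2 ∈ verts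

namespace LabGraph

variable {L : Type u} {V : Type v} {V' : Type w}

/-- `Γ.IsPath u p v`: there is a path in `Γ` from `u` to `v` that reads the word `p`; a letter
`(e, true)` is read along an edge labelled `e`, a letter `(e, false)` against such an edge. -/
inductive IsPath (Γ : LabGraph L V) : V → List (L × Bool) → V → Prop
  | nil {x : V} (hx : x ∈ Γ.verts) : IsPath Γ x [] x
  | along {x y z : V} {e : L} {p : List (L × Bool)} (h : (x, e, y) ∈ Γ.edges)
      (hp : IsPath Γ y p z) : IsPath Γ x ((e, true) :: p) z
  | against {x y z : V} {e : L} {p : List (L × Bool)} (h : (y, e, x) ∈ Γ.edges)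
      (hp : IsPath Γ y p z) : IsPath Γ x ((e, false) :: p) z

theorem IsPath.append {Γ : LabGraph L V} {x y z : V} {p q : List (L × Bool)}
    (hp : Γ.IsPath x p y) (hq : Γ.IsPath y q z) : Γ.IsPath x (p ++ q) z := by
  induction hp with
  | nil _ => exact hq
  | along h _ ih => exact .along h (ih hq)
  | against h _ ih => exact .against h (ih hq)

theorem IsPath.symm {Γ : LabGraph L V} {x y : V} {p : List (L × Bool)}
    (hp : Γ.IsPath x p y) : Γ.IsPath y (FreeGroup.invRev p) x := by
  induction hp with
  | nil hx => exact .nil hx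
  | along h _ ih =>
    simpa [FreeGroup.invRev] using ih.append (.against h (.nil (Γ.source_mem _ h)))
  | against h _ ih =>
    simpa [FreeGroup.invRev] using ih.append (.along h (.nil (Γ.target_mem _ h)))

/-- The fundamental group at the basepoint, read off through the labels: the subgroup of the free
group on the labels that consists of the elements spelled by the closed paths at the basepoint. -/
def pi (Γ : LabGraph L V) : Subgroup (FreeGroup L) where
  carrier := {g | ∃ p, Γ.IsPath Γ.base p Γ.base ∧ FreeGroup.mk p = g}
  one_mem' := ⟨[], .nil Γ.base_mem, rfl⟩
  mul_mem' := by
    rintro _ _ ⟨p, hp, rfl⟩ ⟨q, hq, rfl⟩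
    exact ⟨p ++ q, hp.append hq, by rw [FreeGroup.mul_mk]⟩
  inv_mem' := by
    rintro _ ⟨p, hp, rfl⟩
    exact ⟨_, hp.symm, by rw [FreeGroup.inv_mk]⟩

/-- Finitely many vertices and edges. -/
def IsFinite (Γ : LabGraph L V) : Prop := Γ.verts.Finite ∧ Γ.edges.Finite

/-- Isomorphism of basepointed `L`-labelled graphs. -/
def Iso (Γ : LabGraph L V) (Γ' : LabGraph L V') : Prop :=
  ∃ f : V → V', Set.BijOn f Γ.verts Γ'.verts ∧ f Γ.base = Γ'.base ∧
    ∀ x ∈ Γ.verts, ∀ y ∈ Γ.verts, ∀ e : L, (x, e, y) ∈ Γ.edges ↔ (f x, e, f y) ∈ Γ'.edges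

end LabGraph

/-! ### Schreier graphs, cores and the operations `∂_C` -/

section Core

variable {E : Type u} (H : Subgroup (FreeGroup E))

/-- The set `H \ F` of cosets `H g`. -/
abbrev Cosets : Type u := Quotient (QuotientGroup.rightRel H)

variable {H} in
/-- `(H x) g = H (x g)`. -/
def Cosets.mulRight (c : Cosets H) (g : FreeGroup E) : Cosets H :=
  Quotient.map (fun x => x * g) (fun x y hxy => by
    rw [← Quotient.eq_iff_equiv, Quotient.eq, QuotientGroup.rightRel_apply] at hxy ⊢
    simpa [mul_assoc] using hxy) c

/-- The basepoint `H 1`. -/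
def Cosets.one : Cosets H := Quotient.mk _ 1

/-- The Schreier graph `H \ T`, for `T` the Cayley graph of the free group on `E`. -/
def schreier : LabGraph E (Cosets H) where
  verts := Set.univ
  base := Cosets.one H
  edges := {t | t.2.2 = t.1.mulRight (FreeGroup.of t.2.1)}
  base_mem := trivial
  source_mem _ _ := trivial
  target_mem _ _ := trivial

/-- `core(H rel E)`: the vertices and edges of the Schreier graph that are involved in reduced
closed paths at the basepoint. In a Schreier graph a path is reduced exactly when the word that it
reads is. The inverse of a reduced closed path is one too, so that it suffices to consider edges
that are traversed in their own direction. -/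
def core : LabGraph E (Cosets H) where
  verts := {x | ∃ p q, (schreier H).IsPath (Cosets.one H) p x ∧
    (schreier H).IsPath x q (Cosets.one H) ∧ FreeGroup.IsReduced (p ++ q)}
  base := Cosets.one H
  edges := {t | t ∈ (schreier H).edges ∧ ∃ p q, (schreier H).IsPath (Cosets.one H) p t.1 ∧
    (schreier H).IsPath t.2.2 q (Cosets.one H) ∧ FreeGroup.IsReduced (p ++ (t.2.1, true) :: q)}
  base_mem := ⟨[], [], .nil trivial, .nil trivial, by simp⟩
  source_mem := by
    rintro t ⟨ht, p, q, hp, hq, hr⟩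
    exact ⟨p, _, hp, .along ht hq, hr⟩
  target_mem := by
    rintro t ⟨ht, p, q, hp, hq, hr⟩
    exact ⟨p ++ [(t.2.1, true)], q, hp.append (.along ht (.nil trivial)), hq, by simpa using hr⟩

variable [Fintype E] [DecidableEq E] (C : Cut E)

/-- The subgraph `X` of `H \ T'`, for `T'` the Cayley graph with respect to the basis `φ_C(E)`: its
vertices are all the cosets, and its edges are the images, under the map induced by `ψ_C`, of the
edges of `core(H rel E)`. The edge of `X` that is labelled `φ_C(e)` is recorded with label `e`. -/
def shiftedGraph : LabGraph E (Cosets H) where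
  verts := Set.univ
  base := Cosets.one H
  edges := (fun t : Cosets H × E × Cosets H =>
    (t.1.mulRight (C.dStar⁻¹ ^ C.shift (t.2.1, true)), t.2.1,
      t.2.2.mulRight (C.dStar⁻¹ ^ C.shift (t.2.1, false)))) '' (core H).edges
  base_mem := trivial
  source_mem _ _ := trivial
  target_mem _ _ := trivial

/-- `K = π(X, H1)` as a subgroup of the free group on `E`: the label `e` is read as `φ_C(e)`. -/
def shiftedGroup : Subgroup (FreeGroup E) :=
  (shiftedGraph H C).pi.map (C.phi : FreeGroup E ≃* FreeGroup E).toMonoidHom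

/-- `∂_C H = φ_C⁻¹(K)`. -/
def partialCut : Subgroup (FreeGroup E) :=
  (shiftedGroup H C).map (C.phi⁻¹ : MulAut (FreeGroup E)).toMonoidHom

end Core

/-! ### The graph `(G◀)` and its paths -/

section Radiation

variable {E : Type u} [Fintype E] [DecidableEq E] (G : Subgroup (FreeGroup E))

/-- The vertices of `(G◀)`: the least set of subgroups that contains `G` and is closed under all
the operations `∂_C`. -/
inductive IsVertex : Subgroup (FreeGroup E) → Prop
  | root : IsVertex G
  | step {H : Subgroup (FreeGroup E)} (hH : IsVertex H) (C : Cut E) : IsVertex (partialCut H C)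

/-- The edges of `(G◀)`: the pairs `(H, C)`, an edge from `H` to `∂_C H`, for `H` a vertex. -/
def radiationEdges : Set (Subgroup (FreeGroup E) × Cut E) := {x | IsVertex G x.1}

/-- The terminal vertex `∂_{C_n} ⋯ ∂_{C_1} G` of the path `(C_1, …, C_n)` that starts at `G`. -/
def pathEnd (Cs : List (Cut E)) : Subgroup (FreeGroup E) := Cs.foldl (fun H C => partialCut H C) G

/-- The automorphism `φ_{C_n} ⋯ φ_{C_1}` in exponential (right-action) notation, that is, the map
`x ↦ φ_{C_1} (φ_{C_2} (⋯ (φ_{C_n} x)))`. -/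
def pathAut (Cs : List (Cut E)) : MulAut (FreeGroup E) := (Cs.map Cut.phi).prod

/-- The set `E'' = E ^ (φ_{C_n} ⋯ φ_{C_1})`. -/
def pathBasis (Cs : List (Cut E)) : Set (FreeGroup E) := pathAut Cs '' gens E

/-- `Cs = (C_1, …, C_n)` is a path from `G` to `H`; `H ≤ G ^ (φ_{C_1}⁻¹ ⋯ φ_{C_n}⁻¹)`; the set `E''`
is a basis; and `φ_{C_n} ⋯ φ_{C_1}` maps `E ∩ H` into `E'' ∩ G`. -/
structure IsGoodPath (H : Subgroup (FreeGroup E)) (Cs : List (Cut E)) : Prop where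
  end_eq : pathEnd G Cs = H
  le_map : H ≤ G.map ((pathAut Cs)⁻¹ : MulAut (FreeGroup E)).toMonoidHom
  isBasis : IsBasisSet (pathBasis Cs)
  image_subset : pathAut Cs '' (gens E ∩ (H : Set (FreeGroup E))) ⊆
    pathBasis Cs ∩ (G : Set (FreeGroup E))

/-- `H` is a vertex of `(G◀)` with `|E ∩ H|` maximal. -/
def IsMaxVertex (H : Subgroup (FreeGroup E)) : Prop :=
  IsVertex G H ∧ ∀ H' : Subgroup (FreeGroup E), IsVertex G H' →
    (gens E ∩ (H' : Set (FreeGroup E))).encard ≤ (gens E ∩ (H : Set (FreeGroup E))).encard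

end Radiation

/-! ### Finite data on which algorithms operate -/

/-- A letter `(i, ε)`, with `i` the index of a generator. -/
abbrev LetterCode : Type := ℕ × Bool

abbrev WordCode : Type := List LetterCode

/-- The input `(n, [w_1, …, w_k])`: the rank of the free group on `Fin n`, and words for the
elements of `Z`. -/
abbrev InputCode : Type := ℕ × List WordCode

/-- `(₀D, ₁D, e⋆)`. -/
abbrev CutCode : Type := WordCode × WordCode × LetterCode

/-- `(k, l)`: the vertices are `0, …, k - 1`, the basepoint is `0`, and the edges are the entries
`(initial vertex, label, terminal vertex)` of `l`. -/
abbrev GraphCode : Type := ℕ × List (ℕ × ℕ × ℕ)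

/-- `(l, m)`: the list `l` of the vertices, viewed as graphs, and the list `m` of the edges
`(position of the initial vertex, cut, position of the terminal vertex)`. -/
abbrev RadiationCode : Type := List GraphCode × List (ℕ × CutCode × ℕ)

def letterCode {n : ℕ} (a : Fin n × Bool) : LetterCode := (a.1.val, a.2)

def wordCode {n : ℕ} (p : List (Fin n × Bool)) : WordCode := p.map letterCode

/-- A set of letters, as the list of its elements in a fixed order. -/
def lettersCode {n : ℕ} (D : Finset (Fin n × Bool)) : WordCode :=
  wordCode (((List.finRange n).flatMap fun i => [(i, true), (i, false)]).filter (· ∈ D))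

def cutCode {n : ℕ} (C : Cut (Fin n)) : CutCode :=
  (lettersCode C.D0, lettersCode C.D1, letterCode C.star)

/-- `c` describes, without repetitions, a finite graph that is isomorphic to `Γ` as basepointed
labelled graph. -/
def IsGraphCode {n : ℕ} {V : Type v} (c : GraphCode) (Γ : LabGraph (Fin n) V) : Prop :=
  c.2.Nodup ∧ ∃ Δ : LabGraph (Fin n) ℕ, Δ.verts = {i | i < c.1} ∧ Δ.base = 0 ∧
    (∀ i l j : ℕ, (i, l, j) ∈ c.2 ↔ ∃ e : Fin n, e.val = l ∧ (i, e, j) ∈ Δ.edges) ∧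
    Δ.Iso Γ

/-- `r` describes the graph `(G◀)`, without repetitions: `ν i` is the vertex of `(G◀)` that is
listed in position `i`, as the graph `core(ν i rel E)`; the initial vertex `G` comes first. -/
structure IsRadiationCode {n : ℕ} (G : Subgroup (FreeGroup (Fin n))) (r : RadiationCode)
    (ν : Fin r.1.length → Subgroup (FreeGroup (Fin n))) : Prop where
  root : ∃ h : 0 < r.1.length, ν ⟨0, h⟩ = G
  injective : Function.Injective ν
  range_eq : Set.range ν = {H | IsVertex G H}
  graphs : ∀ i, IsGraphCode (r.1.get i) (core (ν i))
  edges_nodup : r.2.Nodup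
  edges : ∀ (i : ℕ) (c : CutCode) (j : ℕ), (i, c, j) ∈ r.2 ↔
    ∃ (i' j' : Fin r.1.length) (C : Cut (Fin n)),
      i'.val = i ∧ j'.val = j ∧ cutCode C = c ∧ ν j' = partialCut (ν i') C

/-! The argument runs on Stallings graphs. In a deterministic labelled graph a reduced word lies in
the fundamental group exactly when it is read along a closed path at the basepoint
(`Deterministic.isPath_of_mem_pi`). Hence `core H` has fundamental group `H` and determines it, and
the core of the fundamental group of a deterministic graph has no more edges than that graph
(`core_pi_edges_encard_le`).

Finiteness and good paths: the graph `X` that defines `∂_C H` lies in a Schreier graph with respect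
to another basis, so it is deterministic, and it has at most as many edges as `core H`. The number
of edges of the core therefore never grows along `(G◀)`, and only finitely many subgroups respect a
given bound. Reading labels in `X` gives `φ_C(∂_C H) ≤ H`, so that every path from `G` is good.

Domination of a basis `B` by a vertex goes by induction on the total length of `B`. If some element
of `B` has length at least two, the wedge of circles that spell `B` has at least two vertices. Its
fundamental group is `F`, so it can be folded as long as it has two vertices, and folding is stopped
when exactly two are left. The Euler characteristic then allows at most `|E| + 1` edges, whereas
each label occurs: just one label occurs twice. Sorting the letters by the vertex that they leave
gives a cut `C`, whose `e⋆` is the letter that leaves both vertices. Collapsing the edge that joins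
the two vertices turns the graph into a rose, and this is `φ_C⁻¹`: it deletes from each word of `B`
the letters read along that edge. So no word grows and some word shrinks (`Fork.norm_inv_le`,
`Fork.exists_norm_inv_lt`). The same deletion turns closed paths in `core H` into closed paths in
`X`, so `φ_C⁻¹` maps `B ∩ H` into `∂_C H` (`Fork.inv_mem_partialCut`). At the end all elements of
`B` are generators or their inverses. Maximality at a vertex `H` then transfers to `E''`, because `E
∩ H` is mapped injectively into `E'' ∩ G`.

The algorithms are obtained by unbounded search. Correctness of an output is written as a
recursively enumerable relation, in which each equality or difference of subgroups has a finite
certificate, and a total relation of this kind contains the graph of a computable function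
(`SigmaOne.exists_computable`). It remains to see that each input has a correct output and that
correct outputs mean what they should (`exists_outputCond`, `OutputCond.spec`). -/

set_option linter.unusedSectionVars false

/-! ### Paths, deterministic graphs and isomorphisms. -/

namespace LabGraph

variable {L : Type u} {V : Type v} {V' : Type w}

/-- No two edges with the same label share their initial, or their terminal, vertex. -/
structure Deterministic (Γ : LabGraph L V) : Prop where
  out : ∀ {x e y z}, (x, e, y) ∈ Γ.edges → (x, e, z) ∈ Γ.edges → y = z
  into : ∀ {x e y z}, (y, e, x) ∈ Γ.edges → (z, e, x) ∈ Γ.edges → y = z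

/-- The directed edge from `x` to `y` that reads the letter `a`. -/
def Dir (Γ : LabGraph L V) (x : V) (a : L × Bool) (y : V) : Prop :=
  if a.2 then (x, a.1, y) ∈ Γ.edges else (y, a.1, x) ∈ Γ.edges

variable {Γ : LabGraph L V} {Γ' : LabGraph L V'}

@[simp] theorem dir_true {x y : V} {e : L} : Γ.Dir x (e, true) y ↔ (x, e, y) ∈ Γ.edges := by
  simp [Dir]

@[simp] theorem dir_false {x y : V} {e : L} : Γ.Dir x (e, false) y ↔ (y, e, x) ∈ Γ.edges := by
  simp [Dir]

theorem Dir.source_mem {x y : V} {a : L × Bool} (h : Γ.Dir x a y) : x ∈ Γ.verts := by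
  rcases a with ⟨e, _ | _⟩
  · exact Γ.target_mem _ (dir_false.1 h)
  · exact Γ.source_mem _ (dir_true.1 h)

theorem Dir.target_mem {x y : V} {a : L × Bool} (h : Γ.Dir x a y) : y ∈ Γ.verts := by
  rcases a with ⟨e, _ | _⟩
  · exact Γ.source_mem _ (dir_false.1 h)
  · exact Γ.target_mem _ (dir_true.1 h)

theorem dir_letterInv {x y : V} {a : L × Bool} : Γ.Dir x (letterInv a) y ↔ Γ.Dir y a x := by
  rcases a with ⟨e, _ | _⟩ <;> simp [letterInv]

theorem isPath_nil {x y : V} : Γ.IsPath x [] y ↔ x ∈ Γ.verts ∧ x = y := by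
  constructor
  · rintro ⟨h⟩; exact ⟨h, rfl⟩
  · rintro ⟨h, rfl⟩; exact .nil h

theorem isPath_cons {x y : V} {a : L × Bool} {p : List (L × Bool)} :
    Γ.IsPath x (a :: p) y ↔ ∃ z, Γ.Dir x a z ∧ Γ.IsPath z p y := by
  constructor
  · intro h
    cases h with
    | along h hp => exact ⟨_, dir_true.2 h, hp⟩
    | against h hp => exact ⟨_, dir_false.2 h, hp⟩
  · rcases a with ⟨e, _ | _⟩
    · rintro ⟨z, h, hp⟩; exact .against (dir_false.1 h) hp
    · rintro ⟨z, h, hp⟩; exact .along (dir_true.1 h) hp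

theorem isPath_append {x y : V} {p q : List (L × Bool)} :
    Γ.IsPath x (p ++ q) y ↔ ∃ z, Γ.IsPath x p z ∧ Γ.IsPath z q y := by
  refine ⟨?_, fun ⟨z, h1, h2⟩ => h1.append h2⟩
  induction p generalizing x with
  | nil =>
    intro h
    refine ⟨x, .nil ?_, h⟩
    rw [List.nil_append] at h
    cases h with
    | nil h => exact h
    | along h _ => exact Γ.source_mem _ h
    | against h _ => exact Γ.target_mem _ h
  | cons a p ih =>
    rw [List.cons_append, isPath_cons]
    rintro ⟨w, hw, h⟩
    obtain ⟨z, h1, h2⟩ := ih h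
    exact ⟨z, isPath_cons.2 ⟨w, hw, h1⟩, h2⟩

theorem IsPath.target_mem {x y : V} {p : List (L × Bool)} (h : Γ.IsPath x p y) : y ∈ Γ.verts := by
  induction h with
  | nil h => exact h
  | along _ _ ih => exact ih
  | against _ _ ih => exact ih

theorem IsPath.mono {Δ : LabGraph L V} (hv : Γ.verts ⊆ Δ.verts) (he : Γ.edges ⊆ Δ.edges)
    {x y : V} {p : List (L × Bool)} (h : Γ.IsPath x p y) : Δ.IsPath x p y := by
  induction h with
  | nil h => exact .nil (hv h)
  | along h _ ih => exact .along (he h) ih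
  | against h _ ih => exact .against (he h) ih

theorem IsPath.map (f : V → V') (hv : ∀ x ∈ Γ.verts, f x ∈ Γ'.verts)
    (he : ∀ x e y, (x, e, y) ∈ Γ.edges → (f x, e, f y) ∈ Γ'.edges)
    {x y : V} {p : List (L × Bool)} (h : Γ.IsPath x p y) : Γ'.IsPath (f x) p (f y) := by
  induction h with
  | nil h => exact .nil (hv _ h)
  | along h _ ih => exact .along (he _ _ _ h) ih
  | against h _ ih => exact .against (he _ _ _ h) ih

theorem Deterministic.dir_unique (hΓ : Γ.Deterministic) {x y z : V} {a : L × Bool}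
    (h1 : Γ.Dir x a y) (h2 : Γ.Dir x a z) : y = z := by
  rcases a with ⟨e, _ | _⟩
  · exact hΓ.into (dir_false.1 h1) (dir_false.1 h2)
  · exact hΓ.out (dir_true.1 h1) (dir_true.1 h2)

theorem Deterministic.unique (hΓ : Γ.Deterministic) {x y z : V} {p : List (L × Bool)}
    (h1 : Γ.IsPath x p y) (h2 : Γ.IsPath x p z) : y = z := by
  induction p generalizing x with
  | nil => exact (isPath_nil.1 h1).2.symm.trans (isPath_nil.1 h2).2
  | cons a p ih =>
    obtain ⟨y', h1, h1'⟩ := isPath_cons.1 h1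
    obtain ⟨z', h2, h2'⟩ := isPath_cons.1 h2
    obtain rfl := hΓ.dir_unique h1 h2
    exact ih h1' h2'

/-- By determinism, reading a letter and then its inverse returns to the same vertex, so a
cancelling pair can be deleted from a path. -/
theorem Deterministic.red (hΓ : Γ.Deterministic) {x y : V} {p q : List (L × Bool)}
    (h : FreeGroup.Red p q) (hp : Γ.IsPath x p y) : Γ.IsPath x q y := by
  induction h with
  | refl => exact hp
  | tail _ hs ih =>
    rcases hs with @⟨l₁, l₂, e, b⟩
    obtain ⟨z, h1, h2⟩ := isPath_append.1 ih
    obtain ⟨z1, h3, h2⟩ := isPath_cons.1 h2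
    obtain ⟨z2, h4, h2⟩ := isPath_cons.1 h2
    have : z = z2 := by
      have h3' : Γ.Dir z1 (e, !b) z := dir_letterInv (a := (e, b)).2 h3
      exact hΓ.dir_unique h3' h4
    subst this
    exact h1.append h2

/-- The reduced form of any closed path is again read along a closed path, so membership is tested
on the reduced word alone. -/
theorem Deterministic.isPath_of_mem_pi (hΓ : Γ.Deterministic) {p : List (L × Bool)}
    (hp : FreeGroup.IsReduced p) (h : FreeGroup.mk p ∈ Γ.pi) : Γ.IsPath Γ.base p Γ.base := by
  obtain ⟨q, hq, h⟩ := h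
  obtain ⟨r, h1, h2⟩ := FreeGroup.Red.exact.1 h
  rw [hp.red_iff_eq] at h2
  subst h2
  exact hΓ.red h1 hq

theorem mk_mem_pi {p : List (L × Bool)} (h : Γ.IsPath Γ.base p Γ.base) : FreeGroup.mk p ∈ Γ.pi :=
  ⟨p, h, rfl⟩

theorem mk_cons (a : L × Bool) (p : List (L × Bool)) :
    FreeGroup.mk (a :: p) = FreeGroup.mk [a] * FreeGroup.mk p := by
  rw [FreeGroup.mul_mk]; rfl

/-- A potential `T` whose edge values lie in `K` bounds the fundamental group by `K`. -/
theorem pi_le_of_potential (T : V → FreeGroup L) (K : Subgroup (FreeGroup L))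
    (h1 : T Γ.base = 1)
    (he : ∀ x e y, (x, e, y) ∈ Γ.edges → T x * FreeGroup.of e * (T y)⁻¹ ∈ K) : Γ.pi ≤ K := by
  have key : ∀ x p y, Γ.IsPath x p y → T x * FreeGroup.mk p * (T y)⁻¹ ∈ K := by
    intro x p y h
    induction h with
    | nil _ => simp [← FreeGroup.one_eq_mk]
    | @along x y z e p h hp ih =>
      have := K.mul_mem (he _ _ _ h) ih
      rw [mk_cons]
      convert this using 1
      simp only [FreeGroup.of]; group
    | @against x y z e p h hp ih =>
      have := K.mul_mem (K.inv_mem (he _ _ _ h)) ih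
      have h2 : FreeGroup.mk [(e, false)] = (FreeGroup.of e)⁻¹ := rfl
      rw [mk_cons, h2]
      convert this using 1
      group
  rintro _ ⟨p, hp, rfl⟩
  simpa [h1] using key _ _ _ hp

/-- `f` is an isomorphism from `Γ` to `Γ'`. -/
structure IsoBy (Γ : LabGraph L V) (Γ' : LabGraph L V') (f : V → V') : Prop where
  bij : Set.BijOn f Γ.verts Γ'.verts
  base : f Γ.base = Γ'.base
  edges : ∀ x ∈ Γ.verts, ∀ y ∈ Γ.verts, ∀ e : L, (x, e, y) ∈ Γ.edges ↔ (f x, e, f y) ∈ Γ'.edges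

theorem IsoBy.isPath_iff {f : V → V'} (hf : Γ.IsoBy Γ' f) {x y : V} (hx : x ∈ Γ.verts)
    (hy : y ∈ Γ.verts) {p : List (L × Bool)} :
    Γ'.IsPath (f x) p (f y) ↔ Γ.IsPath x p y := by
  refine ⟨fun h => ?_, fun h => h.map f (fun x hx => hf.bij.mapsTo hx) fun x e y hxy =>
      (hf.edges x (Γ.source_mem _ hxy) y (Γ.target_mem _ hxy) e).1 hxy⟩
  generalize hx' : f x = x' at h
  generalize hy' : f y = y' at h
  induction h generalizing x with
  | nil _ =>
    obtain rfl := hf.bij.injOn hy hx (hy'.trans hx'.symm)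
    exact .nil hx
  | @along x' z y e p h _ ih =>
    subst hx'
    obtain ⟨z', hz', rfl⟩ := hf.bij.surjOn (Γ'.target_mem _ h)
    exact .along ((hf.edges _ hx _ hz' _).2 h) (ih hz' rfl hy')
  | @against x' z y e p h _ ih =>
    subst hx'
    obtain ⟨z', hz', rfl⟩ := hf.bij.surjOn (Γ'.source_mem _ h)
    exact .against ((hf.edges _ hz' _ hx _).2 h) (ih hz' rfl hy')

theorem Iso.pi_eq (h : Γ.Iso Γ') : Γ.pi = Γ'.pi := by
  obtain ⟨f, hf, hb, he⟩ := h
  have := fun p => (IsoBy.mk hf hb he).isPath_iff Γ.base_mem Γ.base_mem (p := p)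
  rw [hb] at this
  ext g
  constructor <;> rintro ⟨p, hp, rfl⟩
  · exact mk_mem_pi ((this p).2 hp)
  · exact mk_mem_pi ((this p).1 hp)

end LabGraph

open LabGraph

/-! ### Schreier graphs and their cores. -/

section Schreier

variable {E : Type u} {H : Subgroup (FreeGroup E)}

namespace Cosets

theorem mulRight_mk (g h : FreeGroup E) :
    Cosets.mulRight (Quotient.mk (QuotientGroup.rightRel H) g) h = Quotient.mk _ (g * h) := rfl

@[simp] theorem mulRight_mul (c : Cosets H) (g h : FreeGroup E) :
    c.mulRight (g * h) = (c.mulRight g).mulRight h := by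
  induction c using Quotient.inductionOn with
  | h x => simp only [mulRight_mk, mul_assoc]

@[simp] theorem mulRight_one (c : Cosets H) : c.mulRight 1 = c := by
  induction c using Quotient.inductionOn with
  | h x => simp only [mulRight_mk, mul_one]

@[simp] theorem mulRight_mulRight_inv (c : Cosets H) (g : FreeGroup E) :
    (c.mulRight g).mulRight g⁻¹ = c := by
  rw [← mulRight_mul]; simp

@[simp] theorem mulRight_inv_mulRight (c : Cosets H) (g : FreeGroup E) :
    (c.mulRight g⁻¹).mulRight g = c := by
  rw [← mulRight_mul]; simp

theorem mulRight_injective (g : FreeGroup E) :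
    Function.Injective fun c : Cosets H => c.mulRight g := fun c d h => by
  have := congrArg (fun c : Cosets H => c.mulRight g⁻¹) h
  simpa using this

theorem one_mulRight_eq_iff {g h : FreeGroup E} :
    (Cosets.one H).mulRight g = (Cosets.one H).mulRight h ↔ h * g⁻¹ ∈ H := by
  simp only [Cosets.one, mulRight_mk, one_mul]
  rw [Quotient.eq, QuotientGroup.rightRel_apply]

theorem one_mulRight_eq_one_iff {g : FreeGroup E} :
    (Cosets.one H).mulRight g = Cosets.one H ↔ g ∈ H := by
  have := one_mulRight_eq_iff (H := H) (g := g) (h := 1)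
  rw [mulRight_one] at this
  rw [this, one_mul, inv_mem_iff]

theorem exists_rep (c : Cosets H) : ∃ g, c = (Cosets.one H).mulRight g := by
  induction c using Quotient.inductionOn with
  | h x => exact ⟨x, by simp [Cosets.one, mulRight_mk]⟩

end Cosets

theorem schreier_dir {x y : Cosets H} {a : E × Bool} :
    (schreier H).Dir x a y ↔ y = x.mulRight (FreeGroup.mk [a]) := by
  rcases a with ⟨e, _ | _⟩
  · rw [dir_false]
    change x = y.mulRight (FreeGroup.of e) ↔ y = x.mulRight (FreeGroup.of e)⁻¹
    constructor <;> rintro rfl <;> simp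
  · rw [dir_true]; rfl

theorem schreier_isPath {x y : Cosets H} {p : List (E × Bool)} :
    (schreier H).IsPath x p y ↔ y = x.mulRight (FreeGroup.mk p) := by
  induction p generalizing x with
  | nil =>
    rw [isPath_nil, ← FreeGroup.one_eq_mk, Cosets.mulRight_one]
    exact ⟨fun h => h.2.symm, fun h => ⟨trivial, h.symm⟩⟩
  | cons a p ih =>
    rw [isPath_cons, mk_cons, Cosets.mulRight_mul]
    constructor
    · rintro ⟨z, h1, h2⟩
      rw [ih.1 h2, schreier_dir.1 h1]
    · intro h
      exact ⟨_, schreier_dir.2 rfl, ih.2 h⟩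

theorem LabGraph.Deterministic.mono {L : Type u} {V : Type v} {Γ Δ : LabGraph L V}
    (hΔ : Δ.Deterministic) (h : Γ.edges ⊆ Δ.edges) : Γ.Deterministic :=
  ⟨fun h1 h2 => hΔ.out (h h1) (h h2), fun h1 h2 => hΔ.into (h h1) (h h2)⟩

theorem schreier_deterministic : (schreier H).Deterministic where
  out h1 h2 := h1.trans h2.symm
  into h1 h2 := Cosets.mulRight_injective _ (h1.symm.trans h2)

theorem core_edges_subset : (core H).edges ⊆ (schreier H).edges := fun _ h => h.1

theorem core_deterministic : (core H).Deterministic :=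
  schreier_deterministic.mono core_edges_subset

theorem core_isPath_schreier {x y : Cosets H} {p : List (E × Bool)} (h : (core H).IsPath x p y) :
    y = x.mulRight (FreeGroup.mk p) :=
  schreier_isPath.1 (h.mono (Δ := schreier H) (fun _ _ => trivial) core_edges_subset)

theorem isReduced_invRev {L : Type u} {p : List (L × Bool)} (h : FreeGroup.IsReduced p) :
    FreeGroup.IsReduced (FreeGroup.invRev p) := by
  classical
  rw [FreeGroup.isReduced_iff_reduce_eq] at h ⊢
  rw [FreeGroup.reduce_invRev, h]

/-- A reduced word that represents an element of `H` is read in the core. -/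
theorem core_isPath_of_mem {p q : List (E × Bool)} (hr : FreeGroup.IsReduced (p ++ q))
    (hm : FreeGroup.mk (p ++ q) ∈ H) :
    (core H).IsPath ((Cosets.one H).mulRight (FreeGroup.mk p)) q (Cosets.one H) := by
  induction q generalizing p with
  | nil =>
    rw [List.append_nil] at hm
    rw [Cosets.one_mulRight_eq_one_iff.2 hm]
    exact .nil (core H).base_mem
  | cons a q ih =>
    rw [isPath_cons]
    refine ⟨(Cosets.one H).mulRight (FreeGroup.mk (p ++ [a])), ?_, ih (by simpa using hr)
      (by simpa using hm)⟩
    have hsp := (schreier_isPath (H := H)).2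
      (Cosets.one_mulRight_eq_one_iff.2 hm).symm
    obtain ⟨x, h1, h2⟩ := isPath_append.1 hsp
    obtain ⟨y, h2, h3⟩ := isPath_cons.1 h2
    have hx := schreier_isPath.1 h1
    have hy := schreier_dir.1 h2
    rw [← FreeGroup.mul_mk, Cosets.mulRight_mul, ← hx, ← hy]
    rcases a with ⟨e, _ | _⟩
    · rw [dir_false]
      refine ⟨dir_false.1 h2, FreeGroup.invRev q, FreeGroup.invRev p, h3.symm, h1.symm, ?_⟩
      have := isReduced_invRev hr
      simpa [FreeGroup.invRev] using this
    · rw [dir_true]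
      exact ⟨dir_true.1 h2, p, q, h1, h3, hr⟩

/-- The reduced word of an element of `H` is itself a reduced closed path, so passing to the core
loses nothing. -/
theorem core_pi (H : Subgroup (FreeGroup E)) : (core H).pi = H := by
  classical
  apply le_antisymm
  · rintro _ ⟨p, hp, rfl⟩
    exact Cosets.one_mulRight_eq_one_iff.1 (core_isPath_schreier hp).symm
  · intro g hg
    refine ⟨g.toWord, ?_, FreeGroup.mk_toWord⟩
    have := core_isPath_of_mem (H := H) (p := []) (q := g.toWord)
      (by simpa using FreeGroup.isReduced_toWord) (by simpa [FreeGroup.mk_toWord] using hg)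
    rwa [← FreeGroup.one_eq_mk, Cosets.mulRight_one] at this

theorem core_iso_injective {H K : Subgroup (FreeGroup E)} (h : (core H).Iso (core K)) : H = K := by
  rw [← core_pi H, ← core_pi K, h.pi_eq]

/-- The core of `π(Γ)` is no larger than the deterministic graph `Γ`. -/
theorem core_pi_edges_encard_le {V : Type v} {Γ : LabGraph E V} (hΓ : Γ.Deterministic) :
    Set.encard (core Γ.pi).edges ≤ Set.encard Γ.edges := by
  -- An edge of the core lies on a reduced closed path; it is sent to the edge of `Γ` that the same
  -- word crosses at the same place. The coset at its source is recovered from any path in `Γ` to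
  -- the image, which gives injectivity.
  have key : ∀ t ∈ (core Γ.pi).edges, ∃ s ∈ Γ.edges, s.2.1 = t.2.1 ∧
      ∃ p, Γ.IsPath Γ.base p s.1 ∧ t.1 = (Cosets.one _).mulRight (FreeGroup.mk p) := by
    rintro ⟨x, e, y⟩ ⟨ht, p, q, hp, hq, hr⟩
    have hcl := hp.append (.along ht hq)
    have hm : FreeGroup.mk (p ++ (e, true) :: q) ∈ Γ.pi :=
      Cosets.one_mulRight_eq_one_iff.1 (schreier_isPath.1 hcl).symm
    obtain ⟨x', h1, h2⟩ := isPath_append.1 (hΓ.isPath_of_mem_pi hr hm)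
    obtain ⟨y', h2, h3⟩ := isPath_cons.1 h2
    exact ⟨(x', e, y'), dir_true.1 h2, rfl, p, h1, schreier_isPath.1 hp⟩
  rcases (core Γ.pi).edges.eq_empty_or_nonempty with h0 | ⟨t0, ht0⟩
  · simp [h0]
  have : Nonempty (V × E × V) := ⟨(key t0 ht0).choose⟩
  choose! f hf hl p hp ht using key
  refine Set.encard_le_encard_of_injOn (f := f) hf ?_
  intro s hs t ht' hst
  have h1 : s.1 = t.1 := by
    rw [ht s hs, ht t ht', Cosets.one_mulRight_eq_iff]
    refine ⟨_, (hp t ht').append ((hst ▸ hp s hs : Γ.IsPath _ _ (f t).1).symm), ?_⟩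
    rw [← FreeGroup.mul_mk, FreeGroup.inv_mk]
  have h2 : s.2.1 = t.2.1 := by rw [← hl s hs, ← hl t ht', hst]
  have h3 : s.2.2 = t.2.2 := by
    rw [show s.2.2 = _ from hs.1, show t.2.2 = _ from ht'.1, h1, h2]
  exact Prod.ext h1 (Prod.ext h2 h3)

theorem core_verts_subset (H : Subgroup (FreeGroup E)) : (core H).verts ⊆
    {Cosets.one H} ∪ ((fun t => t.1) '' (core H).edges ∪ (fun t => t.2.2) '' (core H).edges) := by
  rintro x ⟨p, q, hp, hq, hr⟩
  have hm : FreeGroup.mk (p ++ q) ∈ H :=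
    Cosets.one_mulRight_eq_one_iff.1 (schreier_isPath.1 (hp.append hq)).symm
  have h := core_isPath_of_mem hr hm
  rw [← schreier_isPath.1 hp] at h
  cases h with
  | nil _ => exact Or.inl rfl
  | along h _ => exact Or.inr (Or.inl ⟨_, h, rfl⟩)
  | against h _ => exact Or.inr (Or.inr ⟨_, h, rfl⟩)

/-- The basepoint, together with the two ends of each of at most `N` edges. -/
theorem core_verts_encard_le {N : ℕ} (h : Set.encard (core H).edges ≤ N) :
    Set.encard (core H).verts ≤ (2 * N + 1 : ℕ) := by
  refine (Set.encard_le_encard (core_verts_subset H)).trans ?_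
  refine (Set.encard_union_le _ _).trans ?_
  have h2 := (Set.encard_union_le ((fun t => t.1) '' (core H).edges)
    ((fun t => t.2.2) '' (core H).edges)).trans
    (add_le_add ((Set.encard_image_le _ _).trans h) ((Set.encard_image_le _ _).trans h))
  rw [Set.encard_singleton]
  refine (add_le_add le_rfl h2).trans ?_
  norm_cast
  omega

theorem core_isFinite {N : ℕ} (h : Set.encard (core H).edges ≤ N) : (core H).IsFinite :=
  ⟨Set.finite_of_encard_le_coe (core_verts_encard_le h), Set.finite_of_encard_le_coe h⟩

/-- Schreier's generators: with a representative `T x` of each coset, trivial at the basepoint, the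
elements `T x * e * (T y)⁻¹` of the core edges generate `H`. -/
theorem fg_of_core_edges_finite (h : (core H).edges.Finite) : H.FG := by
  have key : ∀ c : Cosets H, ∃ g, (c = Cosets.one H → g = 1) ∧
      c = (Cosets.one H).mulRight g := by
    intro c
    by_cases hc : c = Cosets.one H
    · exact ⟨1, fun _ => rfl, by simp [hc]⟩
    · obtain ⟨g, hg⟩ := c.exists_rep
      exact ⟨g, fun h => absurd h hc, hg⟩
  choose T h1 hT using key
  let S := (fun t : Cosets H × E × Cosets H => T t.1 * FreeGroup.of t.2.1 * (T t.2.2)⁻¹) ''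
    (core H).edges
  have hS : H = Subgroup.closure S := by
    apply le_antisymm
    · conv_lhs => rw [← core_pi H]
      refine pi_le_of_potential T _ (h1 _ rfl) ?_
      intro x e y hxy
      exact Subgroup.subset_closure ⟨_, hxy, rfl⟩
    · rw [Subgroup.closure_le]
      rintro _ ⟨⟨x, e, y⟩, hxy, rfl⟩
      have hy : y = x.mulRight (FreeGroup.of e) := hxy.1
      change T x * FreeGroup.of e * (T y)⁻¹ ∈ H
      rw [← Cosets.one_mulRight_eq_iff, ← hT, Cosets.mulRight_mul, ← hT, hy]
  rw [hS]
  exact (Subgroup.fg_iff _).2 ⟨S, rfl, h.image _⟩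

/-- The subgraph of the Schreier graph that consists of the edges in `S`. -/
def LabGraph.restrict (H : Subgroup (FreeGroup E)) (S : Set (Cosets H × E × Cosets H)) :
    LabGraph E (Cosets H) where
  verts := Set.univ
  base := Cosets.one H
  edges := {t | t ∈ S ∧ t ∈ (schreier H).edges}
  base_mem := trivial
  source_mem _ _ := trivial
  target_mem _ _ := trivial

theorem restrict_pi_le (S : Set (Cosets H × E × Cosets H)) :
    (LabGraph.restrict H S).pi ≤ H := by
  rintro _ ⟨p, hp, rfl⟩
  exact Cosets.one_mulRight_eq_one_iff.1 (schreier_isPath.1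
    (IsPath.mono (Γ := LabGraph.restrict H S) (Δ := schreier H) (fun _ _ => trivial)
      (fun _ h => h.2) hp)).symm

theorem exists_finite_restrict (x : Cosets H) (p : List (E × Bool)) :
    ∃ S : Set (Cosets H × E × Cosets H), S.Finite ∧ ∀ S', S ⊆ S' →
      (LabGraph.restrict H S').IsPath x p (x.mulRight (FreeGroup.mk p)) := by
  induction p generalizing x with
  | nil => exact ⟨∅, Set.finite_empty, fun S' _ => by
      rw [← FreeGroup.one_eq_mk, Cosets.mulRight_one]; exact .nil trivial⟩
  | cons a p ih =>
    obtain ⟨S, hS, h⟩ := ih (x.mulRight (FreeGroup.mk [a]))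
    rw [mk_cons]
    rcases a with ⟨e, _ | _⟩
    · refine ⟨insert (x.mulRight (FreeGroup.mk [(e, false)]), e, x) S, hS.insert _,
        fun S' hS' => ?_⟩
      rw [Cosets.mulRight_mul]
      refine .against ⟨hS' (Set.mem_insert _ _), ?_⟩ (h S' ((Set.subset_insert _ _).trans hS'))
      exact dir_false.1 (schreier_dir.2 rfl)
    · refine ⟨insert (x, e, x.mulRight (FreeGroup.mk [(e, true)])) S, hS.insert _,
        fun S' hS' => ?_⟩
      rw [Cosets.mulRight_mul]
      refine .along ⟨hS' (Set.mem_insert _ _), ?_⟩ (h S' ((Set.subset_insert _ _).trans hS'))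
      exact dir_true.1 (schreier_dir.2 rfl)

/-- The finitely many Schreier edges crossed by the words of `Z` form a deterministic graph that
already has fundamental group `⟨Z⟩`. -/
theorem core_closure_edges_finite {Z : Set (FreeGroup E)} (hZ : Z.Finite) :
    (core (Subgroup.closure Z)).edges.Finite := by
  classical
  set H := Subgroup.closure Z
  choose S hS h using fun z : FreeGroup E => exists_finite_restrict (Cosets.one H) z.toWord
  let Γ := LabGraph.restrict H (⋃ z ∈ Z, S z)
  have hpi : Γ.pi = H := by
    refine le_antisymm (restrict_pi_le _) ((Subgroup.closure_le _).2 ?_)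
    intro z hz
    refine ⟨z.toWord, ?_, FreeGroup.mk_toWord⟩
    have := h z _ (Set.subset_biUnion_of_mem hz)
    rwa [FreeGroup.mk_toWord, Cosets.one_mulRight_eq_one_iff.2 (Subgroup.subset_closure hz)] at this
  have hdet : Γ.Deterministic := schreier_deterministic.mono fun _ h => h.2
  have hfin : Γ.edges.Finite := (hZ.biUnion fun z _ => hS z).subset fun _ h => h.1
  have := core_pi_edges_encard_le hdet
  rw [hpi] at this
  exact Set.encard_lt_top_iff.1 (this.trans_lt (Set.encard_lt_top_iff.2 hfin))

end Schreier

/-! ### Graphs that are their own cores. -/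

namespace LabGraph

variable {L : Type u} {V : Type v} {V' : Type w} {Γ : LabGraph L V} {Γ' : LabGraph L V'}

/-- Every vertex and every edge is involved in a reduced closed path at the basepoint. -/
structure CoreLike (Γ : LabGraph L V) : Prop where
  det : Γ.Deterministic
  vert : ∀ x ∈ Γ.verts, ∃ p q, Γ.IsPath Γ.base p x ∧ Γ.IsPath x q Γ.base ∧
    FreeGroup.IsReduced (p ++ q)
  edge : ∀ x e y, (x, e, y) ∈ Γ.edges → ∃ p q, Γ.IsPath Γ.base p x ∧ Γ.IsPath y q Γ.base ∧
    FreeGroup.IsReduced (p ++ (e, true) :: q)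

theorem IsoBy.coreLike {f : V → V'} (hf : Γ.IsoBy Γ' f) (h : Γ'.CoreLike) : Γ.CoreLike where
  det := by
    constructor
    · intro x e y z h1 h2
      have m1 := Γ.target_mem _ h1
      have m2 := Γ.target_mem _ h2
      have m3 := Γ.source_mem _ h1
      exact hf.bij.injOn m1 m2
        (h.det.out ((hf.edges _ m3 _ m1 _).1 h1) ((hf.edges _ m3 _ m2 _).1 h2))
    · intro x e y z h1 h2
      have m1 := Γ.source_mem _ h1
      have m2 := Γ.source_mem _ h2
      have m3 := Γ.target_mem _ h1
      exact hf.bij.injOn m1 m2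
        (h.det.into ((hf.edges _ m1 _ m3 _).1 h1) ((hf.edges _ m2 _ m3 _).1 h2))
  vert x hx := by
    obtain ⟨p, q, hp, hq, hr⟩ := h.vert _ (hf.bij.mapsTo hx)
    rw [← hf.base] at hp hq
    exact ⟨p, q, (hf.isPath_iff Γ.base_mem hx).1 hp, (hf.isPath_iff hx Γ.base_mem).1 hq, hr⟩
  edge x e y hxy := by
    have hx := Γ.source_mem _ hxy
    have hy := Γ.target_mem _ hxy
    obtain ⟨p, q, hp, hq, hr⟩ := h.edge _ _ _ ((hf.edges _ hx _ hy _).1 hxy)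
    rw [← hf.base] at hp hq
    exact ⟨p, q, (hf.isPath_iff Γ.base_mem hx).1 hp, (hf.isPath_iff hy Γ.base_mem).1 hq, hr⟩

theorem Iso.coreLike (hf : Γ.Iso Γ') (h : Γ'.CoreLike) : Γ.CoreLike := by
  obtain ⟨f, h1, h2, h3⟩ := hf
  exact (IsoBy.mk h1 h2 h3).coreLike h

theorem Deterministic.unique_of_mk_eq (hΓ : Γ.Deterministic) {x y z : V} {p q : List (L × Bool)}
    (h1 : Γ.IsPath x p y) (h2 : Γ.IsPath x q z) (h : FreeGroup.mk p = FreeGroup.mk q) : y = z := by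
  obtain ⟨r, h3, h4⟩ := FreeGroup.Red.exact.1 h
  exact hΓ.unique (hΓ.red h3 h1) (hΓ.red h4 h2)

/-- A vertex is sent to the coset of the words that lead to it from the basepoint. Two such words
differ by a closed path, so this is well defined; two vertices with the same coset coincide by
determinism. -/
theorem CoreLike.iso_core (hΓ : Γ.CoreLike) : Γ.Iso (core Γ.pi) := by
  classical
  have hrep : ∀ x, ∃ p, x ∈ Γ.verts → Γ.IsPath Γ.base p x := fun x => by
    by_cases hx : x ∈ Γ.verts
    · obtain ⟨p, _, hp, _⟩ := hΓ.vert x hx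
      exact ⟨p, fun _ => hp⟩
    · exact ⟨[], fun h => absurd h hx⟩
  choose P hP using hrep
  let f : V → Cosets Γ.pi := fun x => (Cosets.one _).mulRight (FreeGroup.mk (P x))
  have hf : ∀ x p, Γ.IsPath Γ.base p x → f x = (Cosets.one _).mulRight (FreeGroup.mk p) := by
    intro x p hp
    refine Cosets.one_mulRight_eq_iff.2 ⟨_, hp.append (hP x hp.target_mem).symm, ?_⟩
    rw [← FreeGroup.mul_mk, FreeGroup.inv_mk]
  have hinj : ∀ x p, Γ.IsPath Γ.base p x → ∀ y q, Γ.IsPath Γ.base q y → f x = f y → x = y := by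
    intro x p hp y q hq h
    rw [hf x p hp, hf y q hq, Cosets.one_mulRight_eq_iff] at h
    obtain ⟨r, hr, h⟩ := h
    exact hΓ.det.unique_of_mk_eq (hr.append hp) hq (by rw [← FreeGroup.mul_mk, h]; group)
  have hbase : f Γ.base = Cosets.one _ := by
    rw [hf _ [] (.nil Γ.base_mem), ← FreeGroup.one_eq_mk, Cosets.mulRight_one]
  have hcl : ∀ p x q, Γ.IsPath Γ.base p x → Γ.IsPath x q Γ.base →
      (schreier Γ.pi).IsPath (Cosets.one _) p (f x) ∧
      (schreier Γ.pi).IsPath (f x) q (Cosets.one _) := by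
    intro p x q hp hq
    refine ⟨schreier_isPath.2 (hf x p hp), schreier_isPath.2 ?_⟩
    refine (hbase.symm.trans (hf _ _ (hp.append hq))).trans ?_
    rw [hf x p hp, ← Cosets.mulRight_mul, FreeGroup.mul_mk]
  refine ⟨f, ⟨?_, ?_, ?_⟩, hbase, ?_⟩
  · intro x hx
    obtain ⟨p, q, hp, hq, hr⟩ := hΓ.vert x hx
    exact ⟨p, q, (hcl p x q hp hq).1, (hcl p x q hp hq).2, hr⟩
  · intro x hx y hy h
    exact hinj x _ (hP x hx) y _ (hP y hy) h
  · rintro c ⟨p, q, hp, hq, hr⟩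
    have hm : FreeGroup.mk (p ++ q) ∈ Γ.pi :=
      Cosets.one_mulRight_eq_one_iff.1 (schreier_isPath.1 (hp.append hq)).symm
    obtain ⟨x, h1, _⟩ := isPath_append.1 (hΓ.det.isPath_of_mem_pi hr hm)
    exact ⟨x, h1.target_mem, (hf x p h1).trans (schreier_isPath.1 hp).symm⟩
  · intro x hx y hy e
    constructor
    · intro hxy
      obtain ⟨p, q, hp, hq, hr⟩ := hΓ.edge _ _ _ hxy
      have h1 := hcl p x _ hp (.along hxy hq)
      have h2 := hcl _ y q (hp.append (.along hxy (.nil hy))) hq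
      refine ⟨?_, p, q, h1.1, h2.2, hr⟩
      refine dir_true.1 (schreier_dir.2 ?_)
      rw [schreier_isPath.1 h2.1, schreier_isPath.1 h1.1, ← FreeGroup.mul_mk,
        Cosets.mulRight_mul]
    · rintro ⟨hxy, p, q, hp, hq, hr⟩
      dsimp only at hp hq hr
      have hm : FreeGroup.mk (p ++ (e, true) :: q) ∈ Γ.pi :=
        Cosets.one_mulRight_eq_one_iff.1 (schreier_isPath.1 (hp.append (.along hxy hq))).symm
      obtain ⟨x', h1, h2⟩ := isPath_append.1 (hΓ.det.isPath_of_mem_pi hr hm)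
      obtain ⟨y', h2, h3⟩ := isPath_cons.1 h2
      have e1 : x = x' := hinj x _ (hP x hx) x' p h1 (by rw [hf x' p h1, schreier_isPath.1 hp])
      have h4 := h1.append (isPath_cons.2 ⟨y', h2, .nil h2.target_mem⟩)
      have e2 : y = y' := by
        refine hinj y _ (hP y hy) y' _ h4 ?_
        rw [hf y' _ h4, ← FreeGroup.mul_mk, Cosets.mulRight_mul, ← schreier_isPath.1 hp]
        exact schreier_dir.1 (dir_true.2 hxy)
      rw [e1, e2]
      exact dir_true.1 h2

theorem core_coreLike (H : Subgroup (FreeGroup L)) : (core H).CoreLike where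
  det := core_deterministic
  vert := by
    rintro x ⟨p, q, hp, hq, hr⟩
    have hm : FreeGroup.mk (p ++ q) ∈ H :=
      Cosets.one_mulRight_eq_one_iff.1 (schreier_isPath.1 (hp.append hq)).symm
    have h := core_isPath_of_mem (p := []) hr hm
    rw [← FreeGroup.one_eq_mk, Cosets.mulRight_one] at h
    obtain ⟨y, h1, h2⟩ := isPath_append.1 h
    obtain rfl : y = x := by rw [schreier_isPath.1 hp, core_isPath_schreier h1]
    exact ⟨p, q, h1, h2, hr⟩
  edge := by
    rintro x e y ⟨hxy, p, q, hp, hq, hr⟩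
    dsimp only at hp hq hr
    have hm : FreeGroup.mk (p ++ (e, true) :: q) ∈ H :=
      Cosets.one_mulRight_eq_one_iff.1 (schreier_isPath.1 (hp.append (.along hxy hq))).symm
    have h := core_isPath_of_mem (p := []) hr hm
    rw [← FreeGroup.one_eq_mk, Cosets.mulRight_one] at h
    obtain ⟨x', h1, h2⟩ := isPath_append.1 h
    obtain ⟨y', h2, h3⟩ := isPath_cons.1 h2
    obtain rfl : x' = x := by rw [schreier_isPath.1 hp, core_isPath_schreier h1]
    obtain rfl : y' = y := by
      have h4 : y' = x'.mulRight (FreeGroup.of e) := core_edges_subset (dir_true.1 h2)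
      have h5 : y = x'.mulRight (FreeGroup.of e) := hxy
      rw [h4, h5]
    exact ⟨p, q, h1, h3, hr⟩

/-- A finite graph is isomorphic to one whose vertices are `0, …, k - 1`, with basepoint `0`. -/
theorem exists_nat_iso (hΓ : Γ.verts.Finite) : ∃ Δ : LabGraph L ℕ,
    Δ.verts = {i | i < Γ.verts.ncard} ∧ Δ.base = 0 ∧ Δ.Iso Γ := by
  classical
  have : Finite Γ.verts := hΓ
  have hk : 0 < Γ.verts.ncard := (Set.ncard_pos hΓ).2 ⟨_, Γ.base_mem⟩
  let e : Γ.verts ≃ Fin Γ.verts.ncard := Finite.equivFinOfCardEq rfl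
  -- The swap moves the basepoint to `0`.
  let e' : Γ.verts ≃ Fin Γ.verts.ncard := e.trans (Equiv.swap (e ⟨_, Γ.base_mem⟩) ⟨0, hk⟩)
  let f : ℕ → V := fun i => if h : i < Γ.verts.ncard then e'.symm ⟨i, h⟩ else Γ.base
  have hf : ∀ i (h : i < Γ.verts.ncard), f i = e'.symm ⟨i, h⟩ := fun i h => dif_pos h
  refine ⟨⟨{i | i < Γ.verts.ncard}, 0, {t | t.1 < Γ.verts.ncard ∧ t.2.2 < Γ.verts.ncard ∧
    (f t.1, t.2.1, f t.2.2) ∈ Γ.edges}, hk, fun t ht => ht.1, fun t ht => ht.2.1⟩, rfl, rfl, f,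
    ⟨?_, ?_, ?_⟩, ?_, ?_⟩
  · intro i hi
    rw [hf i hi]
    exact Subtype.prop _
  · intro i hi j hj h
    rw [hf i hi, hf j hj] at h
    simpa using e'.symm.injective (Subtype.ext h)
  · intro x hx
    refine ⟨e' ⟨x, hx⟩, (e' ⟨x, hx⟩).2, ?_⟩
    rw [hf _ (e' ⟨x, hx⟩).2]
    simp
  · change f 0 = Γ.base
    rw [hf 0 hk]
    have : (⟨0, hk⟩ : Fin Γ.verts.ncard) = e' ⟨_, Γ.base_mem⟩ := by simp [e']
    rw [this, Equiv.symm_apply_apply]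
  · intro x hx y hy l
    exact ⟨fun h => h.2.2, fun h => ⟨hx, hy, h⟩⟩

end LabGraph

/-! ### Finiteness of `(G◀)` and its paths. -/

section

variable {E : Type u}

/-- Such a core has at most `2 * N + 1` vertices, so it is isomorphic to one of finitely many graphs
on initial segments of `ℕ`, and `H` is the fundamental group of that graph. -/
theorem finite_setOf_core_edges_encard_le [Finite E] (N : ℕ) :
    {H : Subgroup (FreeGroup E) | Set.encard (core H).edges ≤ N}.Finite := by
  let S : Set (LabGraph E ℕ) := {Δ | Δ.verts ⊆ Set.Iio (2 * N + 2)}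
  have hS : S.Finite := by
    let g : LabGraph E ℕ → Set ℕ × ℕ × Set (ℕ × E × ℕ) := fun Δ => (Δ.verts, Δ.base, Δ.edges)
    have hg : Function.Injective g := by
      rintro ⟨a, b, c, _, _, _⟩ ⟨a', b', c', _, _, _⟩ h
      simp only [g, Prod.mk.injEq] at h
      obtain ⟨rfl, rfl, rfl⟩ := h
      rfl
    refine Set.Finite.of_finite_image (f := g) ?_ hg.injOn
    have h1 := Set.finite_Iio (2 * N + 2)
    refine ((h1.finite_subsets).prod (h1.prod
      ((h1.prod (Set.finite_univ.prod h1)).finite_subsets))).subset ?_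
    rintro _ ⟨Δ, hΔ, rfl⟩
    exact ⟨hΔ, hΔ Δ.base_mem, fun t ht =>
      ⟨hΔ (Δ.source_mem _ ht), trivial, hΔ (Δ.target_mem _ ht)⟩⟩
  refine (hS.image LabGraph.pi).subset ?_
  intro H hH
  have hfin := core_isFinite hH
  obtain ⟨Δ, h1, _, h3⟩ := exists_nat_iso hfin.1
  refine ⟨Δ, ?_, by rw [h3.pi_eq, core_pi]⟩
  intro i hi
  rw [h1] at hi
  have h4 := core_verts_encard_le hH
  rw [← hfin.1.cast_ncard_eq] at h4
  have : (core H).verts.ncard ≤ 2 * N + 1 := by exact_mod_cast h4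
  have hi' : i < (core H).verts.ncard := hi
  exact Set.mem_Iio.2 (by omega)

/-- The image of a basis under an automorphism is a basis. -/
theorem IsBasisSet.image {B : Set (FreeGroup E)} (hB : IsBasisSet B) (φ : MulAut (FreeGroup E)) :
    IsBasisSet (φ '' B) := by
  obtain ⟨b, hb⟩ := hB
  let e : B ≃ φ '' B := Equiv.Set.image φ B φ.injective
  refine ⟨(b.map φ).reindex e, ?_⟩
  rintro ⟨_, x, hx, rfl⟩
  rw [FreeGroupBasis.reindex_apply, FreeGroupBasis.map_apply]
  have : e.symm ⟨φ x, x, hx, rfl⟩ = ⟨x, hx⟩ := by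
    rw [Equiv.symm_apply_eq]; rfl
  rw [this, hb]

theorem isBasisSet_gens : IsBasisSet (gens E) := by
  let e : E ≃ gens E := Equiv.ofInjective _ FreeGroup.of_injective
  refine ⟨(FreeGroupBasis.ofFreeGroup E).reindex e, ?_⟩
  rintro ⟨_, x, rfl⟩
  rw [FreeGroupBasis.reindex_apply, FreeGroupBasis.ofFreeGroup_apply]
  have : e.symm ⟨FreeGroup.of x, x, rfl⟩ = x := by
    rw [Equiv.symm_apply_eq]; rfl
  rw [this]

variable [Fintype E] [DecidableEq E] (H : Subgroup (FreeGroup E)) (C : Cut E)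

/-- `φ_C⁻¹` undoes the reading of a label `e` as `φ_C(e)`, so `∂_C H` can be studied on `X` without
the automorphism. -/
theorem partialCut_eq : partialCut H C = (shiftedGraph H C).pi := by
  rw [partialCut, shiftedGroup, Subgroup.map_map]
  convert Subgroup.map_id _
  ext e
  change (C.phi⁻¹ : MulAut _) (C.phi _) = _
  simp

/-- One formula for all generators. On the generator of `e⋆` both exponents are `η`; this is
harmless, as `d⋆` commutes with that generator. -/
theorem Cut.phi_of (e : E) : C.phi (FreeGroup.of e) =
    C.dStar ^ C.shift (e, true) * FreeGroup.of e * C.dStar⁻¹ ^ C.shift (e, false) := by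
  change C.twist C.dStar (FreeGroup.of e) = _
  by_cases he : e = C.star.1
  · have hc : Commute C.dStar (FreeGroup.of e) := by
      unfold Cut.dStar
      refine Commute.zpow_left ?_ _
      subst he
      rcases hs : C.star with ⟨e, _ | _⟩
      · exact (Commute.refl (FreeGroup.of e)).inv_left
      · exact Commute.refl (FreeGroup.of e)
    simp only [Cut.twist, FreeGroup.lift_apply_of, if_pos he, Cut.shift]
    rw [(hc.pow_left _).eq, mul_assoc, inv_pow, mul_inv_cancel, mul_one]
  · simp [Cut.twist, he, Cut.shift]

/-- This is what makes `X` a subgraph of the Schreier graph for the basis `φ_C(E)`, hence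
deterministic. -/
theorem shiftedGraph_edge {x y : Cosets H} {e : E} (h : (x, e, y) ∈ (shiftedGraph H C).edges) :
    y = x.mulRight (C.phi (FreeGroup.of e)) := by
  obtain ⟨⟨x', e', y'⟩, ht, h⟩ := h
  simp only [Prod.mk.injEq] at h
  obtain ⟨rfl, rfl, rfl⟩ := h
  have hy : y' = x'.mulRight (FreeGroup.of e') := core_edges_subset ht
  rw [hy, C.phi_of, ← Cosets.mulRight_mul, ← Cosets.mulRight_mul]
  congr 1
  group

theorem shiftedGraph_deterministic : (shiftedGraph H C).Deterministic where
  out h1 h2 := (shiftedGraph_edge H C h1).trans (shiftedGraph_edge H C h2).symm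
  into h1 h2 := Cosets.mulRight_injective _
    ((shiftedGraph_edge H C h1).symm.trans (shiftedGraph_edge H C h2))

theorem shiftedGraph_isPath {x y : Cosets H} {p : List (E × Bool)}
    (h : (shiftedGraph H C).IsPath x p y) : y = x.mulRight (C.phi (FreeGroup.mk p)) := by
  induction h with
  | nil _ => simp [← FreeGroup.one_eq_mk]
  | along h _ ih =>
    rw [ih, mk_cons, map_mul, Cosets.mulRight_mul, shiftedGraph_edge H C h]; rfl
  | @against x y z e p h _ ih =>
    have h2 : FreeGroup.mk [(e, false)] = (FreeGroup.of e)⁻¹ := rfl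
    rw [ih, mk_cons, map_mul, Cosets.mulRight_mul, shiftedGraph_edge H C h, h2, map_inv,
      Cosets.mulRight_mulRight_inv]

-- A closed path in `X` that spells `g` shows `H φ_C(g) = H`. This inclusion of `φ_C(∂_C H)` in `H`
-- is the source of all properties of good paths.
variable {H C} in
theorem phi_mem_of_mem_partialCut {g : FreeGroup E} (hg : g ∈ partialCut H C) : C.phi g ∈ H := by
  rw [partialCut_eq] at hg
  obtain ⟨p, hp, rfl⟩ := hg
  exact Cosets.one_mulRight_eq_one_iff.1 (shiftedGraph_isPath H C hp).symm

/-- Shifting creates no edges, and neither does passing from a deterministic graph to the core of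
its fundamental group. -/
theorem core_partialCut_edges_encard_le :
    Set.encard (core (partialCut H C)).edges ≤ Set.encard (core H).edges := by
  rw [partialCut_eq]
  exact (core_pi_edges_encard_le (shiftedGraph_deterministic H C)).trans (Set.encard_image_le _ _)

variable {G : Subgroup (FreeGroup E)}

theorem IsVertex.core_edges_encard_le {H : Subgroup (FreeGroup E)} (h : IsVertex G H) :
    Set.encard (core H).edges ≤ Set.encard (core G).edges := by
  induction h with
  | root => exact le_rfl
  | step _ C ih => exact (core_partialCut_edges_encard_le _ C).trans ih

theorem finite_isVertex (hG : (core G).edges.Finite) : {H | IsVertex G H}.Finite := by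
  refine (finite_setOf_core_edges_encard_le (core G).edges.ncard).subset ?_
  intro H hH
  change Set.encard (core H).edges ≤ _
  rw [hG.cast_ncard_eq]
  exact hH.core_edges_encard_le

instance : Finite (Cut E) := by
  refine Finite.of_injective (fun C : Cut E => (C.D0, C.D1, C.star)) ?_
  rintro ⟨⟩ ⟨⟩ h
  simp only [Prod.mk.injEq] at h
  simpa using h

theorem finite_radiationEdges (hG : (core G).edges.Finite) : (radiationEdges G).Finite :=
  ((finite_isVertex hG).prod (Set.finite_univ (α := Cut E))).subset fun _ h => ⟨h, trivial⟩

theorem IsVertex.core_isFinite (hG : (core G).edges.Finite) {H : Subgroup (FreeGroup E)}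
    (h : IsVertex G H) : (core H).IsFinite := by
  refine _root_.core_isFinite (N := (core G).edges.ncard) ?_
  rw [hG.cast_ncard_eq]
  exact h.core_edges_encard_le

theorem pathEnd_append (Cs : List (Cut E)) (C : Cut E) :
    pathEnd G (Cs ++ [C]) = partialCut (pathEnd G Cs) C := by
  simp [pathEnd]

theorem isVertex_iff_exists_path {H : Subgroup (FreeGroup E)} :
    IsVertex G H ↔ ∃ Cs, pathEnd G Cs = H := by
  constructor
  · intro h
    induction h with
    | root => exact ⟨[], rfl⟩
    | step _ C ih =>
      obtain ⟨Cs, rfl⟩ := ih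
      exact ⟨Cs ++ [C], pathEnd_append Cs C⟩
  · rintro ⟨Cs, rfl⟩
    induction Cs using List.reverseRecOn with
    | nil => exact .root
    | append_singleton Cs C ih => rw [pathEnd_append]; exact .step ih C

theorem pathAut_mem_of_mem_pathEnd (Cs : List (Cut E)) {g : FreeGroup E}
    (hg : g ∈ pathEnd G Cs) : pathAut Cs g ∈ G := by
  induction Cs generalizing G with
  | nil => simpa [pathAut, pathEnd] using hg
  | cons C Cs ih =>
    have : pathAut (C :: Cs) g = C.phi (pathAut Cs g) := by simp [pathAut]
    rw [this]
    exact phi_mem_of_mem_partialCut (ih hg)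

/-- No choice of path is needed: the inclusion `φ_C(∂_C H) ≤ H` holds at each step. -/
theorem isGoodPath_pathEnd (Cs : List (Cut E)) : IsGoodPath G (pathEnd G Cs) Cs where
  end_eq := rfl
  le_map g hg := ⟨pathAut Cs g, pathAut_mem_of_mem_pathEnd Cs hg, by
    change (pathAut Cs)⁻¹ (pathAut Cs g) = g
    simp⟩
  isBasis := isBasisSet_gens.image _
  image_subset := by
    rintro _ ⟨g, ⟨hg, hH⟩, rfl⟩
    exact ⟨⟨g, hg, rfl⟩, pathAut_mem_of_mem_pathEnd Cs hH⟩

end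

/-! ### Bases and the folding of labelled graphs. -/

section

variable {E : Type u}

theorem IsBasisSet.closure_eq_top {B : Set (FreeGroup E)} (hB : IsBasisSet B) :
    Subgroup.closure B = ⊤ := by
  obtain ⟨b, hb⟩ := hB
  have h1 : B = Set.range b := by
    ext x
    constructor
    · intro hx; exact ⟨⟨x, hx⟩, hb _⟩
    · rintro ⟨y, rfl⟩; rw [hb]; exact y.2
  have h2 : Set.range b = b.repr.symm.toMonoidHom '' Set.range FreeGroup.of := by
    rw [← Set.range_comp]; rfl
  rw [h1, h2, ← MonoidHom.map_closure, FreeGroup.closure_range_of, ← MonoidHom.range_eq_map,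
    MonoidHom.range_eq_top]
  exact b.repr.symm.surjective

theorem IsBasisSet.one_notMem {B : Set (FreeGroup E)} (hB : IsBasisSet B) : 1 ∉ B := by
  obtain ⟨b, hb⟩ := hB
  intro h
  have h1 : b ⟨1, h⟩ = 1 := hb _
  have h2 := b.repr_apply_coe ⟨1, h⟩
  rw [h1, map_one] at h2
  exact FreeGroup.of_ne_one _ h2.symm

theorem IsBasisSet.nonempty_equiv {B : Set (FreeGroup E)} (hB : IsBasisSet B) :
    Nonempty (B ≃ E) := by
  obtain ⟨b, _⟩ := hB
  exact ⟨(Equiv.ofFreeGroupEquiv b.repr).symm⟩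

theorem IsBasisSet.finite [Finite E] {B : Set (FreeGroup E)} (hB : IsBasisSet B) : B.Finite := by
  obtain ⟨e⟩ := hB.nonempty_equiv
  exact Finite.of_equiv E e.symm

theorem IsBasisSet.ncard_eq [Fintype E] {B : Set (FreeGroup E)} (hB : IsBasisSet B) :
    B.ncard = Fintype.card E := by
  obtain ⟨e⟩ := hB.nonempty_equiv
  rw [← Nat.card_coe_set_eq, Nat.card_congr e, Nat.card_eq_fintype_card]

theorem letterInv_ne (a : E × Bool) : letterInv a ≠ a := by
  rcases a with ⟨e, _ | _⟩ <;> simp [letterInv]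

variable [Fintype E] [DecidableEq E]

/-- A finite labelled graph, of Euler characteristic at least `1 - |E|`, in which the words of `B`
are read along closed paths that involve all the edges. -/
structure Folding (B : Set (FreeGroup E)) {V : Type v} (Γ : LabGraph E V) : Prop where
  fin : Γ.IsFinite
  euler : Γ.edges.ncard + 1 ≤ Γ.verts.ncard + Fintype.card E
  closed : ∀ b ∈ B, Γ.IsPath Γ.base b.toWord Γ.base
  cover : ∀ x e y, (x, e, y) ∈ Γ.edges → ∃ b ∈ B, ∃ p q,
    (b.toWord = p ++ (e, true) :: q ∧ Γ.IsPath Γ.base p x ∧ Γ.IsPath y q Γ.base) ∨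
    (b.toWord = p ++ (e, false) :: q ∧ Γ.IsPath Γ.base p y ∧ Γ.IsPath x q Γ.base)
  conn : ∀ x ∈ Γ.verts, ∃ p, Γ.IsPath Γ.base p x

variable {B : Set (FreeGroup E)} {V : Type v} {Γ : LabGraph E V}

namespace Folding

theorem cover_dir (h : Folding B Γ) {x y : V} {a : E × Bool} (ha : Γ.Dir x a y) :
    ∃ b ∈ B, ∃ p q,
    (b.toWord = p ++ a :: q ∧ Γ.IsPath Γ.base p x ∧ Γ.IsPath y q Γ.base) ∨
    (b.toWord = p ++ letterInv a :: q ∧ Γ.IsPath Γ.base p y ∧ Γ.IsPath x q Γ.base) := by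
  rcases a with ⟨e, _ | _⟩
  · obtain ⟨b, hb, p, q, h⟩ := h.cover _ _ _ (dir_false.1 ha)
    exact ⟨b, hb, p, q, h.symm⟩
  · obtain ⟨b, hb, p, q, h⟩ := h.cover _ _ _ (dir_true.1 ha)
    exact ⟨b, hb, p, q, h⟩

theorem pi_eq_top (h : Folding B Γ) (hB : Subgroup.closure B = ⊤) : Γ.pi = ⊤ := by
  rw [eq_top_iff, ← hB, Subgroup.closure_le]
  intro b hb
  exact ⟨_, h.closed b hb, FreeGroup.mk_toWord⟩

/-- If no edge had the label `a.1`, the exponent sum of `a.1` would vanish on the fundamental group,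
which is all of `F`. -/
theorem exists_dir (h : Folding B Γ) (hB : Subgroup.closure B = ⊤) (a : E × Bool) :
    ∃ x y, Γ.Dir x a y := by
  by_contra! hn
  have hn' : ∀ x y, (x, a.1, y) ∉ Γ.edges := by
    rcases a with ⟨e, _ | _⟩
    · intro x y hxy; exact hn y x (dir_false.2 hxy)
    · intro x y hxy; exact hn x y (dir_true.2 hxy)
  let f : FreeGroup E →* Multiplicative ℤ :=
    FreeGroup.lift fun e => if e = a.1 then Multiplicative.ofAdd 1 else 1
  have hle : Γ.pi ≤ f.ker := by
    refine pi_le_of_potential (fun _ => 1) _ rfl ?_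
    intro x e y hxy
    have : e ≠ a.1 := by rintro rfl; exact hn' _ _ hxy
    simp [MonoidHom.mem_ker, f, this]
  rw [h.pi_eq_top hB, top_le_iff] at hle
  have h1 : FreeGroup.of a.1 ∈ f.ker := by rw [hle]; trivial
  simp [MonoidHom.mem_ker, f] at h1

/-- If nothing could be folded the graph would be deterministic. Each letter lies in its fundamental
group and so would label a loop at the basepoint; by connectedness there would be no other vertex.
-/
theorem exists_fold (h : Folding B Γ) (hB : Subgroup.closure B = ⊤) (h2 : 2 ≤ Γ.verts.ncard) :
    ∃ x a y z, Γ.Dir x a y ∧ Γ.Dir x a z ∧ y ≠ z := by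
  by_contra! hn
  have hdet : Γ.Deterministic :=
    ⟨fun h1 h2 => hn _ _ _ _ (dir_true.2 h1) (dir_true.2 h2),
      fun h1 h2 => hn _ _ _ _ (dir_false.2 h1) (dir_false.2 h2)⟩
  have hloop : ∀ a, Γ.Dir Γ.base a Γ.base := by
    intro a
    have := hdet.isPath_of_mem_pi (p := [a]) FreeGroup.IsReduced.singleton
      (by rw [h.pi_eq_top hB]; trivial)
    obtain ⟨z, h1, h2⟩ := isPath_cons.1 this
    rwa [(isPath_nil.1 h2).2] at h1
  have hstay : ∀ p, Γ.IsPath Γ.base p Γ.base := by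
    intro p
    induction p with
    | nil => exact .nil Γ.base_mem
    | cons a p ih => exact isPath_cons.2 ⟨_, hloop a, ih⟩
  have hv : Γ.verts = {Γ.base} := by
    ext x
    constructor
    · intro hx
      obtain ⟨p, hp⟩ := h.conn x hx
      exact hdet.unique hp (hstay p)
    · rintro rfl; exact Γ.base_mem
  rw [hv, Set.ncard_singleton] at h2
  omega

end Folding

/-- The image of a labelled graph under a map of the vertices. -/
def LabGraph.image {W : Type w} (Γ : LabGraph E V) (f : V → W) : LabGraph E W where
  verts := f '' Γ.verts
  base := f Γ.base
  edges := (fun t => (f t.1, t.2.1, f t.2.2)) '' Γ.edges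
  base_mem := ⟨_, Γ.base_mem, rfl⟩
  source_mem := by rintro _ ⟨t, ht, rfl⟩; exact ⟨_, Γ.source_mem _ ht, rfl⟩
  target_mem := by rintro _ ⟨t, ht, rfl⟩; exact ⟨_, Γ.target_mem _ ht, rfl⟩

theorem LabGraph.IsPath.image {W : Type w} (f : V → W) {x y : V} {p : List (E × Bool)}
    (h : Γ.IsPath x p y) : (Γ.image f).IsPath (f x) p (f y) :=
  h.map (Γ' := Γ.image f) f (fun x hx => ⟨x, hx, rfl⟩) fun x e y hxy => ⟨(x, e, y), hxy, rfl⟩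

/-- A single fold. Identifying two distinct ends `y`, `z` of edges that leave `x` by the same letter
removes exactly one vertex and at least one edge, so the bound on the Euler characteristic survives.
-/
theorem Folding.exists_pred (h : Folding B Γ) (hB : Subgroup.closure B = ⊤)
    (h2 : 2 ≤ Γ.verts.ncard) :
    ∃ Δ : LabGraph E V, Folding B Δ ∧ Δ.verts.ncard + 1 = Γ.verts.ncard := by
  classical
  have key : ∃ x a y z, Γ.Dir x a y ∧ Γ.Dir x a z ∧ y ≠ z ∧ z ≠ Γ.base := by
    obtain ⟨x, a, y, z, h1, h2, h3⟩ := h.exists_fold hB h2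
    by_cases hz : z = Γ.base
    · exact ⟨x, a, z, y, h2, h1, h3.symm, fun hy => h3 (hy.trans hz.symm)⟩
    · exact ⟨x, a, y, z, h1, h2, h3, hz⟩
  obtain ⟨x, a, y, z, h1, h2', hyz, hz⟩ := key
  let f : V → V := Function.update id z y
  have hfz : f z = y := Function.update_self ..
  have hf : ∀ v, v ≠ z → f v = v := fun v hv => Function.update_of_ne hv _ _
  have hb : (Γ.image f).base = Γ.base := hf _ hz.symm
  have hverts : (Γ.image f).verts = Γ.verts \ {z} := by
    ext v
    constructor
    · rintro ⟨v, hv, rfl⟩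
      by_cases hvz : v = z
      · subst hvz; rw [hfz]; exact ⟨h1.target_mem, hyz⟩
      · rw [hf v hvz]; exact ⟨hv, hvz⟩
    · rintro ⟨hv, hvz⟩
      exact ⟨v, hv, hf v hvz⟩
  have hcard : (Γ.image f).verts.ncard + 1 = Γ.verts.ncard := by
    rw [hverts]
    exact Set.ncard_sdiff_singleton_add_one h2'.target_mem h.fin.1
  have hedges : (Γ.image f).edges.ncard + 1 ≤ Γ.edges.ncard := by
    -- The two folded edges have the same image, whatever becomes of their common end `x`.
    have : ∃ s ∈ Γ.edges, ∃ t ∈ Γ.edges, s ≠ t ∧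
        (f s.1, s.2.1, f s.2.2) = (f t.1, t.2.1, f t.2.2) := by
      rcases a with ⟨e, _ | _⟩
      · exact ⟨_, dir_false.1 h1, _, dir_false.1 h2', by simpa using hyz,
          by simp [hfz, hf y hyz]⟩
      · exact ⟨_, dir_true.1 h1, _, dir_true.1 h2', by simpa using hyz,
          by simp [hfz, hf y hyz]⟩
    obtain ⟨s, hs, t, ht, hst, hf'⟩ := this
    have hsub : (Γ.image f).edges ⊆ (fun t => (f t.1, t.2.1, f t.2.2)) '' (Γ.edges \ {t}) := by
      rintro _ ⟨r, hr, rfl⟩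
      by_cases hrt : r = t
      · subst hrt; exact ⟨s, ⟨hs, hst⟩, hf'⟩
      · exact ⟨r, ⟨hr, hrt⟩, rfl⟩
    have hfin : (Γ.edges \ {t}).Finite := h.fin.2.subset Set.sdiff_subset
    have := (Set.ncard_le_ncard hsub (hfin.image _)).trans (Set.ncard_image_le hfin)
    have h3 := Set.ncard_sdiff_singleton_add_one ht h.fin.2
    omega
  refine ⟨Γ.image f, ⟨⟨h.fin.1.image _, h.fin.2.image _⟩, ?_, ?_, ?_, ?_⟩, hcard⟩
  · have := h.euler
    omega
  · intro b hb; exact (h.closed b hb).image f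
  · rintro _ _ _ ⟨⟨x, e, y⟩, hxy, h⟩
    simp only [Prod.mk.injEq] at h
    obtain ⟨rfl, rfl, rfl⟩ := h
    obtain ⟨b, hb, p, q, h⟩ := h.cover _ _ _ hxy
    exact ⟨b, hb, p, q, h.imp (fun h => ⟨h.1, h.2.1.image f, h.2.2.image f⟩)
      (fun h => ⟨h.1, h.2.1.image f, h.2.2.image f⟩)⟩
  · rintro _ ⟨x, hx, rfl⟩
    obtain ⟨p, hp⟩ := h.conn x hx
    exact ⟨p, hp.image f⟩

theorem Folding.exists_two (hB : Subgroup.closure B = ⊤) : ∀ (k : ℕ) (Γ : LabGraph E V),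
    Folding B Γ → Γ.verts.ncard = k + 2 → ∃ Δ : LabGraph E V, Folding B Δ ∧ Δ.verts.ncard = 2
  | 0, Γ, h, hk => ⟨Γ, h, hk⟩
  | k + 1, Γ, h, hk => by
    obtain ⟨Δ, h1, h2⟩ := h.exists_pred hB (by omega)
    exact Folding.exists_two hB k Δ h1 (by omega)

/-! ### The wedge of the words of a basis -/

/-- The vertex of the wedge at position `i` of the word of `b`. -/
def wedgePos (b : FreeGroup E) (i : ℕ) : Option (Σ _ : FreeGroup E, ℕ) :=
  if i = 0 ∨ i = b.toWord.length then none else some ⟨b, i⟩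

theorem wedgePos_mem {B : Finset (FreeGroup E)} {b : FreeGroup E} (hb : b ∈ B) {i : ℕ}
    (hi : i ≤ b.toWord.length) :
    wedgePos b i ∈ Finset.insertNone (B.sigma fun b => Finset.Ioo 0 b.toWord.length) := by
  unfold wedgePos
  split_ifs with h
  · simp
  · simp only [Finset.some_mem_insertNone, Finset.mem_sigma, Finset.mem_Ioo]
    exact ⟨hb, by omega, by omega⟩

/-- The edge that underlies the step from `x` to `y` that reads `a`. -/
def orientEdge (x : V) (a : E × Bool) (y : V) : V × E × V :=
  if a.2 then (x, a.1, y) else (y, a.1, x)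

/-- The wedge of circles that are subdivided and labelled according to the words of `B`. -/
def wedge (B : Finset (FreeGroup E)) : LabGraph E (Option (Σ _ : FreeGroup E, ℕ)) where
  verts := Finset.insertNone (B.sigma fun b => Finset.Ioo 0 b.toWord.length)
  base := none
  edges := (fun s : Σ b : FreeGroup E, Fin b.toWord.length =>
    orientEdge (wedgePos s.1 s.2) (s.1.toWord.get s.2) (wedgePos s.1 (s.2 + 1))) ''
      (B.sigma fun _ => Finset.univ : Finset (Σ b : FreeGroup E, Fin b.toWord.length))
  base_mem := by simp
  source_mem := by
    rintro _ ⟨⟨b, i⟩, h, rfl⟩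
    have hb : b ∈ B := by simpa using h
    dsimp only [orientEdge]
    split_ifs
    · exact wedgePos_mem hb (by omega)
    · exact wedgePos_mem hb (by omega)
  target_mem := by
    rintro _ ⟨⟨b, i⟩, h, rfl⟩
    have hb : b ∈ B := by simpa using h
    dsimp only [orientEdge]
    split_ifs
    · exact wedgePos_mem hb (by omega)
    · exact wedgePos_mem hb (by omega)

theorem wedge_verts_ncard (B : Finset (FreeGroup E)) :
    (wedge B).verts.ncard = ∑ b ∈ B, (b.toWord.length - 1) + 1 := by
  change Set.ncard ((Finset.insertNone (B.sigma fun b => Finset.Ioo 0 b.toWord.length) :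
    Finset (Option (Σ _ : FreeGroup E, ℕ))) : Set (Option (Σ _ : FreeGroup E, ℕ))) = _
  rw [Set.ncard_coe_finset, Finset.card_insertNone, Finset.card_sigma]
  simp

theorem wedge_dir {B : Finset (FreeGroup E)} {b : FreeGroup E} (hb : b ∈ B) {i : ℕ}
    (hi : i < b.toWord.length) :
    (wedge B).Dir (wedgePos b i) b.toWord[i] (wedgePos b (i + 1)) := by
  have : orientEdge (wedgePos b i) b.toWord[i] (wedgePos b (i + 1)) ∈ (wedge B).edges :=
    ⟨⟨b, i, hi⟩, by simpa using hb, rfl⟩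
  unfold orientEdge at this
  unfold LabGraph.Dir
  split_ifs at this ⊢ <;> assumption

theorem wedge_isPath_drop {B : Finset (FreeGroup E)} {b : FreeGroup E} (hb : b ∈ B) (i : ℕ)
    (hi : i ≤ b.toWord.length) : (wedge B).IsPath (wedgePos b i) (b.toWord.drop i) none := by
  induction hk : b.toWord.length - i generalizing i with
  | zero =>
    have : i = b.toWord.length := by omega
    subst this
    rw [List.drop_length, wedgePos, if_pos (Or.inr rfl)]
    exact .nil (wedge B).base_mem
  | succ k ih =>
    have hi' : i < b.toWord.length := by omega
    rw [List.drop_eq_getElem_cons hi']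
    exact isPath_cons.2 ⟨_, wedge_dir hb hi', ih (i + 1) hi' (by omega)⟩

theorem wedge_isPath_take {B : Finset (FreeGroup E)} {b : FreeGroup E} (hb : b ∈ B) (i : ℕ)
    (hi : i ≤ b.toWord.length) : (wedge B).IsPath none (b.toWord.take i) (wedgePos b i) := by
  induction i with
  | zero =>
    rw [List.take_zero, wedgePos, if_pos (Or.inl rfl)]
    exact .nil (wedge B).base_mem
  | succ i ih =>
    rw [List.take_succ_eq_append_getElem (by omega)]
    have hd := wedge_dir hb (i := i) (by omega)
    exact (ih (by omega)).append (isPath_cons.2 ⟨_, hd, .nil hd.target_mem⟩)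

/-- A circle that spells a word of length `k > 0` contributes at most `k` edges and `k - 1` vertices
besides the basepoint; `1 ∉ B` excludes `k = 0`, and there are `|E|` circles. -/
theorem folding_wedge {B : Finset (FreeGroup E)} (h1 : 1 ∉ B) (hn : B.card = Fintype.card E) :
    Folding (B : Set (FreeGroup E)) (wedge B) where
  fin := ⟨Finset.finite_toSet _, (Finset.finite_toSet _).image _⟩
  euler := by
    have he : (wedge B).edges.ncard ≤ ∑ b ∈ B, b.toWord.length := by
      refine (Set.ncard_image_le (Finset.finite_toSet _)).trans ?_
      rw [Set.ncard_coe_finset, Finset.card_sigma]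
      simp
    have hv := wedge_verts_ncard B
    have hs : ∑ b ∈ B, b.toWord.length = ∑ b ∈ B, (b.toWord.length - 1) + B.card := by
      rw [Finset.card_eq_sum_ones, ← Finset.sum_add_distrib]
      refine Finset.sum_congr rfl fun b hb => ?_
      have : b.toWord.length ≠ 0 := by
        intro h0
        rw [List.length_eq_zero_iff, FreeGroup.toWord_eq_nil_iff] at h0
        exact h1 (h0 ▸ hb)
      omega
    omega
  closed b hb := by
    have := wedge_isPath_drop hb 0 (by omega)
    rwa [List.drop_zero, wedgePos, if_pos (Or.inl rfl)] at this
  cover := by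
    rintro x e y ⟨⟨b, i⟩, hb, h⟩
    replace hb : b ∈ B := by simpa using hb
    have hi := i.2
    refine ⟨b, hb, b.toWord.take i, b.toWord.drop (i + 1), ?_⟩
    have hw : b.toWord = b.toWord.take i ++ b.toWord[i.1] :: b.toWord.drop (i + 1) := by
      rw [← List.drop_eq_getElem_cons, List.take_append_drop]
    have hp := wedge_isPath_take hb i (by omega)
    have hq := wedge_isPath_drop hb (i + 1) (by omega)
    have hget : b.toWord.get i = b.toWord[i.1] := rfl
    simp only [orientEdge, hget] at h
    generalize b.toWord[i.1] = a at h hw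
    rcases a with ⟨e', _ | _⟩
    · simp only [Bool.false_eq_true, ↓reduceIte, Prod.mk.injEq] at h
      obtain ⟨rfl, rfl, rfl⟩ := h
      exact Or.inr ⟨hw, hp, hq⟩
    · simp only [↓reduceIte, Prod.mk.injEq] at h
      obtain ⟨rfl, rfl, rfl⟩ := h
      exact Or.inl ⟨hw, hp, hq⟩
  conn := by
    rintro (_ | ⟨b, i⟩) hx
    · exact ⟨[], .nil (wedge B).base_mem⟩
    · have hx' : b ∈ B ∧ 0 < i ∧ i < b.toWord.length := by
        simpa [wedge] using hx
      have := wedge_isPath_take hx'.1 i hx'.2.2.le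
      rw [wedgePos, if_neg (by omega)] at this
      exact ⟨_, this⟩

theorem two_le_wedge_verts_ncard {B : Finset (FreeGroup E)} {b : FreeGroup E} (hb : b ∈ B)
    (h : 1 < b.norm) : 2 ≤ (wedge B).verts.ncard := by
  have hv := wedge_verts_ncard B
  have := Finset.single_le_sum (f := fun b : FreeGroup E => b.toWord.length - 1)
    (fun _ _ => Nat.zero_le _) hb
  unfold FreeGroup.norm at h
  omega

end

/-! ### Forks and the cuts that shorten a basis. -/

section

variable {E : Type u} [Fintype E] [DecidableEq E] {B : Set (FreeGroup E)} {V : Type v}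

/-- A graph with vertices `u` (the basepoint) and `v`, in which `e` is the one letter that leaves
both vertices, along edges that end in `w`; every other letter is read along just one edge. -/
structure Fork (B : Set (FreeGroup E)) (Γ : LabGraph E V) (v w : V) (e : E × Bool) : Prop where
  folding : Folding B Γ
  verts : ∀ x ∈ Γ.verts, x = Γ.base ∨ x = v
  ne : Γ.base ≠ v
  dir_base : Γ.Dir Γ.base e w
  dir_v : Γ.Dir v e w
  occurs : ∀ a, ∃ x y, Γ.Dir x a y
  uniq : ∀ {x y x' y' a}, Γ.Dir x a y → Γ.Dir x' a y' → a.1 ≠ e.1 → x = x' ∧ y = y'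
  target : ∀ {x y}, Γ.Dir x e y → y = w

theorem dir_iff_orientEdge {Γ : LabGraph E V} {x y : V} {a : E × Bool} :
    Γ.Dir x a y ↔ orientEdge x a y ∈ Γ.edges := by
  unfold LabGraph.Dir orientEdge
  split_ifs <;> rfl

theorem orientEdge_label (x y : V) (a : E × Bool) : (orientEdge x a y).2.1 = a.1 := by
  unfold orientEdge; split_ifs <;> rfl

theorem orientEdge_injective {x y x' y' : V} {a : E × Bool}
    (h : orientEdge x a y = orientEdge x' a y') : x = x' ∧ y = y' := by
  unfold orientEdge at h
  split_ifs at h <;> simp_all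

/-- With two vertices there are at most `|E| + 1` edges. All labels occur and the two edges that can
be folded share one, so the labels separate the edges once either of these two is removed. -/
theorem Folding.exists_fork {Γ : LabGraph E V} (h : Folding B Γ) (hB : Subgroup.closure B = ⊤)
    (h2 : Γ.verts.ncard = 2) : ∃ v w e, Fork B Γ v w e := by
  obtain ⟨w, a, y, z, h1, h1', hyz⟩ := h.exists_fold hB h2.ge
  obtain ⟨v, hne, hv⟩ : ∃ v, Γ.base ≠ v ∧ Γ.verts = {Γ.base, v} := by
    obtain ⟨x, y, hxy, hs⟩ := Set.ncard_eq_two.1 h2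
    have hb := Γ.base_mem
    rw [hs] at hb
    rcases hb with hb | hb
    · exact ⟨y, by rwa [hb], by rw [hs, hb]⟩
    · rw [Set.mem_singleton_iff] at hb
      exact ⟨x, by rw [hb]; exact hxy.symm, by rw [hs, hb, Set.pair_comm]⟩
  have hverts : ∀ x ∈ Γ.verts, x = Γ.base ∨ x = v := by
    intro x hx; rw [hv] at hx; exact hx
  obtain ⟨h3, h4⟩ : Γ.Dir w a Γ.base ∧ Γ.Dir w a v := by
    rcases hverts y h1.target_mem with rfl | rfl <;> rcases hverts z h1'.target_mem with rfl | rfl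
    · exact absurd rfl hyz
    · exact ⟨h1, h1'⟩
    · exact ⟨h1', h1⟩
    · exact absurd rfl hyz
  have hcard : Γ.edges.ncard ≤ Fintype.card E + 1 := by
    have := h.euler; omega
  have hocc := h.exists_dir hB
  -- the labels separate the edges, up to one coincidence
  have hinj : ∀ s ∈ Γ.edges, ∀ t ∈ Γ.edges, s ≠ t → s.2.1 = t.2.1 →
      Set.InjOn (fun t : V × E × V => t.2.1) (Γ.edges \ {s}) := by
    intro s hs t ht hst hl
    have hfin : (Γ.edges \ {s}).Finite := h.fin.2.subset Set.sdiff_subset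
    have hsurj : (fun t : V × E × V => t.2.1) '' (Γ.edges \ {s}) = Set.univ := by
      rw [Set.eq_univ_iff_forall]
      intro l
      obtain ⟨x, y, hxy⟩ := hocc (l, true)
      by_cases hs' : (x, l, y) = s
      · exact ⟨t, ⟨ht, hst.symm⟩, by simp only [← hl, ← hs']⟩
      · exact ⟨_, ⟨dir_true.1 hxy, hs'⟩, rfl⟩
    refine Set.injOn_of_ncard_image_eq ?_ hfin
    refine le_antisymm (Set.ncard_image_le hfin) ?_
    rw [hsurj, Set.ncard_univ, Nat.card_eq_fintype_card]
    have := Set.ncard_sdiff_singleton_add_one hs h.fin.2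
    omega
  set s := orientEdge w a Γ.base with hs
  set t := orientEdge w a v with ht
  have hs' : s ∈ Γ.edges := dir_iff_orientEdge.1 h3
  have ht' : t ∈ Γ.edges := dir_iff_orientEdge.1 h4
  have hst : s ≠ t := fun h => hne (orientEdge_injective h).2
  have hls : s.2.1 = a.1 := orientEdge_label ..
  have hlt : t.2.1 = a.1 := orientEdge_label ..
  have is := hinj s hs' t ht' hst (hls.trans hlt.symm)
  have it := hinj t ht' s hs' hst.symm (hlt.trans hls.symm)
  have hlab : ∀ r ∈ Γ.edges, r.2.1 = a.1 → r = s ∨ r = t := by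
    intro r hr hl
    by_contra! hn
    exact hn.2 (is ⟨hr, hn.1⟩ ⟨ht', hst.symm⟩ (hl.trans hlt.symm))
  -- The letter `a` leads from `w` to both vertices, so its inverse is the letter that leaves both.
  refine ⟨v, w, letterInv a, h, hverts, hne, dir_letterInv.2 h3, dir_letterInv.2 h4, hocc, ?_, ?_⟩
  · intro x y x' y' b hb hb' hba
    have hba' : b.1 ≠ a.1 := hba
    refine orientEdge_injective (a := b) (is ⟨dir_iff_orientEdge.1 hb, ?_⟩
      ⟨dir_iff_orientEdge.1 hb', ?_⟩ (by simp only [orientEdge_label]))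
    · intro h; exact hba' (by rw [← orientEdge_label x y b, h, hls])
    · intro h; exact hba' (by rw [← orientEdge_label x' y' b, h, hls])
  · intro x y hxy
    have hxy := dir_letterInv.1 hxy
    rcases hlab _ (dir_iff_orientEdge.1 hxy) (orientEdge_label ..) with h | h
    · exact (orientEdge_injective h).1
    · exact (orientEdge_injective h).1

namespace Fork

variable {Γ : LabGraph E V} {v w : V} {e : E × Bool}

theorem dir_inv_iff (h : Fork B Γ v w e) {x y : V} :
    Γ.Dir x (letterInv e) y ↔ x = w ∧ (y = Γ.base ∨ y = v) := by
  rw [dir_letterInv]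
  constructor
  · intro hd; exact ⟨h.target hd, h.verts _ hd.source_mem⟩
  · rintro ⟨rfl, rfl | rfl⟩
    · exact h.dir_base
    · exact h.dir_v

theorem eq_or_of_fst_eq {a : E × Bool} (h : a.1 = e.1) : a = e ∨ a = letterInv e := by
  rcases a with ⟨x, _ | _⟩ <;> rcases e with ⟨y, _ | _⟩ <;> simp_all [letterInv]

theorem eq_of_both (h : Fork B Γ v w e) {a : E × Bool} {y y' : V} (h1 : Γ.Dir Γ.base a y)
    (h2 : Γ.Dir v a y') : a = e := by
  by_cases ha : a.1 = e.1
  · rcases eq_or_of_fst_eq ha with rfl | rfl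
    · rfl
    · exact absurd ((h.dir_inv_iff.1 h1).1.trans (h.dir_inv_iff.1 h2).1.symm) h.ne
  · exact absurd (h.uniq h1 h2 ha).1 h.ne

/-- Some word of `B` runs through the edge that leaves `v` by `e`. Being closed at a basepoint other
than `v`, it also has a letter on the other side of `v`, and being reduced it does not backtrack
there. -/
theorem exists_other (h : Fork B Γ v w e) : ∃ a y, Γ.Dir v a y ∧ a ≠ e := by
  by_contra! hn
  obtain ⟨b, hb, p, q, h1⟩ := h.folding.cover_dir h.dir_v
  have hred := FreeGroup.isReduced_toWord (x := b)
  rcases h1 with ⟨hw, hp, hq⟩ | ⟨hw, hp, hq⟩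
  -- Here `c` enters `v`, so its inverse leaves `v` and would have to be `e`; then `c` and `e`
  -- cancel.
  · rcases List.eq_nil_or_concat p with rfl | ⟨p', c, rfl⟩
    · exact h.ne (isPath_nil.1 hp).2
    · rw [List.concat_eq_append] at hp hw
      obtain ⟨z, _, hp⟩ := isPath_append.1 hp
      obtain ⟨z', hc, hz⟩ := isPath_cons.1 hp
      obtain rfl := (isPath_nil.1 hz).2
      have hc' := hn _ _ (dir_letterInv.2 hc)
      rw [hw] at hred
      have h3 := hred.infix (L₁ := [c, e]) ⟨p', q, by simp⟩
      rw [FreeGroup.isReduced_cons_cons] at h3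
      rw [← hc'] at h3
      simp [letterInv] at h3
  · rcases q with _ | ⟨c, q⟩
    · exact h.ne (isPath_nil.1 hq).2.symm
    · obtain ⟨z', hc, _⟩ := isPath_cons.1 hq
      have hc' := hn _ _ hc
      subst hc'
      rw [hw] at hred
      have h3 := hred.infix (L₁ := [letterInv c, c]) ⟨p, q, by simp⟩
      rw [FreeGroup.isReduced_cons_cons] at h3
      simp [letterInv] at h3

open Classical in
/-- The cut that sorts the letters by the vertices that they leave. -/
noncomputable def cut (h : Fork B Γ v w e) : Cut E where
  D0 := {a | ∃ y, Γ.Dir Γ.base a y}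
  D1 := {a | ∃ y, Γ.Dir v a y}
  star := e
  union_eq := by
    ext a
    obtain ⟨x, y, hxy⟩ := h.occurs a
    simp only [Finset.mem_union, Finset.mem_filter, Finset.mem_univ, true_and, iff_true]
    rcases h.verts x hxy.source_mem with rfl | rfl
    · exact Or.inl ⟨y, hxy⟩
    · exact Or.inr ⟨y, hxy⟩
  inter_eq := by
    ext a
    simp only [Finset.mem_inter, Finset.mem_filter, Finset.mem_univ, true_and,
      Finset.mem_singleton]
    constructor
    · rintro ⟨⟨y, h1⟩, ⟨z, h2⟩⟩; exact h.eq_of_both h1 h2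
    · rintro rfl; exact ⟨⟨_, h.dir_base⟩, ⟨_, h.dir_v⟩⟩
  D1_ne := by
    obtain ⟨a, y, h1, h2⟩ := h.exists_other
    intro h3
    have : a ∈ ({e} : Finset (E × Bool)) := by
      rw [← h3]; simpa using ⟨y, h1⟩
    exact h2 (by simpa using this)

theorem mem_D1 (h : Fork B Γ v w e) {a : E × Bool} : a ∈ h.cut.D1 ↔ ∃ y, Γ.Dir v a y := by
  simp [cut]

theorem chi_eq (h : Fork B Γ v w e) {x y : V} {a : E × Bool} (ha : a.1 ≠ e.1)
    (hd : Γ.Dir x a y) [Decidable (x = v)] : h.cut.chi a = if x = v then 1 else 0 := by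
  unfold Cut.chi
  by_cases hx : x = v
  · subst hx; rw [if_pos (h.mem_D1.2 ⟨y, hd⟩), if_pos rfl]
  · rw [if_neg hx, if_neg]
    rw [h.mem_D1]
    rintro ⟨y', h'⟩
    exact hx (h.uniq hd h' ha).1

theorem eta_eq (h : Fork B Γ v w e) [Decidable (w = v)] :
    h.cut.eta = if w = v then 1 else 0 := by
  have : letterInv e ∈ h.cut.D1 ↔ w = v := by
    rw [h.mem_D1]
    constructor
    · rintro ⟨y, hy⟩; exact (h.dir_inv_iff.1 hy).1.symm
    · intro hw; exact ⟨v, h.dir_inv_iff.2 ⟨hw.symm, Or.inr rfl⟩⟩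
  change (if letterInv e ∈ h.cut.D1 then 1 else 0) = _
  simp only [this]

theorem dStar_eq (h : Fork B Γ v w e) [Decidable (w = v)] :
    h.cut.dStar = if w = v then FreeGroup.mk [e] else (FreeGroup.mk [e])⁻¹ := by
  change FreeGroup.mk [e] ^ (2 * (h.cut.eta : ℤ) - 1) = _
  rw [h.eta_eq]
  split_ifs <;> simp

open Classical in
/-- The translation that corresponds to a vertex. -/
noncomputable def tau (h : Fork B Γ v w e) (x : V) : FreeGroup E :=
  if x = v then h.cut.dStar else 1

theorem tau_base (h : Fork B Γ v w e) : h.tau Γ.base = 1 := if_neg h.ne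

/-- The word `s` is a translate, along the cut of a fork, of the word `p` that is read from `x` to
`y`. -/
def Trans (h : Fork B Γ v w e) (x : V) (p : List (E × Bool)) (y : V) (s : List (E × Bool)) :
    Prop :=
  h.cut.phi (FreeGroup.mk s) = h.tau x * FreeGroup.mk p * (h.tau y)⁻¹ ∧
    ∀ (H : Subgroup (FreeGroup E)) (c c' : Cosets H), (core H).IsPath c p c' →
      (shiftedGraph H h.cut).IsPath (c.mulRight (h.tau x)⁻¹) s (c'.mulRight (h.tau y)⁻¹)

theorem Trans.symm {h : Fork B Γ v w e} {x y : V} {p s : List (E × Bool)}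
    (ht : h.Trans x p y s) : h.Trans y (FreeGroup.invRev p) x (FreeGroup.invRev s) := by
  constructor
  · rw [← FreeGroup.inv_mk, map_inv, ht.1, ← FreeGroup.inv_mk]; group
  · intro H c c' hc
    have := hc.symm
    rw [FreeGroup.invRev_invRev] at this
    exact (ht.2 H _ _ this).symm

theorem Trans.append {h : Fork B Γ v w e} {x y z : V} {p s q t : List (E × Bool)}
    (h1 : h.Trans x p y s) (h2 : h.Trans y q z t) : h.Trans x (p ++ q) z (s ++ t) := by
  constructor
  · rw [← FreeGroup.mul_mk, map_mul, h1.1, h2.1, ← FreeGroup.mul_mk]; group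
  · intro H c c' hc
    obtain ⟨c'', h3, h4⟩ := isPath_append.1 hc
    exact (h1.2 H _ _ h3).append (h2.2 H _ _ h4)

/-- A translate of an edge that is not collapsed. -/
theorem trans_keep (h : Fork B Γ v w e) {x y : V} {l : E}
    (hx : h.tau x = h.cut.dStar ^ h.cut.shift (l, true))
    (hy : h.tau y = h.cut.dStar ^ h.cut.shift (l, false)) :
    h.Trans x [(l, true)] y [(l, true)] := by
  constructor
  · rw [hx, hy, ← inv_pow]
    exact h.cut.phi_of l
  · intro H c c' hc
    obtain ⟨z, h1, h2⟩ := isPath_cons.1 hc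
    obtain rfl := (isPath_nil.1 h2).2
    refine .along ⟨_, dir_true.1 h1, ?_⟩ (.nil trivial)
    simp only [hx, hy, inv_pow]

/-- Under this hypothesis the two ends of a core edge labelled `l` are translated to the same coset,
so the empty word is a translate. -/
theorem trans_collapse (h : Fork B Γ v w e) {x y : V} {l : E}
    (hxy : h.tau x * FreeGroup.of l = h.tau y) : h.Trans x [(l, true)] y [] := by
  have hxy' : h.tau x * FreeGroup.mk [(l, true)] = h.tau y := hxy
  constructor
  · rw [← FreeGroup.one_eq_mk, map_one, hxy']; group
  · intro H c c' hc
    rw [isPath_nil]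
    refine ⟨trivial, ?_⟩
    rw [core_isPath_schreier hc, ← Cosets.mulRight_mul, ← hxy']
    congr 1
    group

/-- Of the two edges with the label of `e`, one is a loop at `w` and the other joins the two
vertices. On the latter `d⋆` is read from the basepoint to `v`: it is `e` if `w = v` and `e⁻¹`
otherwise. So `tau` is the label of the path in this tree, and the tree edge collapses. -/
theorem trans_star (h : Fork B Γ v w e) {x y : V} {l : E} (hl : (x, l, y) ∈ Γ.edges)
    (he : l = e.1) (hxw : ¬(x = w ∧ y = w)) : h.Trans x [(l, true)] y [] := by
  classical
  have hd : Γ.Dir x (l, true) y := dir_true.2 hl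
  have hd' : Γ.Dir y (l, false) x := dir_false.2 hl
  refine h.trans_collapse ?_
  have hx := h.verts x hd.source_mem
  have hy := h.verts y hd.target_mem
  have hne := h.ne
  unfold tau
  rw [h.dStar_eq]
  rcases e with ⟨e, _ | _⟩
  · have he : l = e := he
    subst he
    have hx' : x = w := h.target hd'
    subst hx'
    have h2 : FreeGroup.mk [(l, false)] = (FreeGroup.of l)⁻¹ := rfl
    rw [h2]
    by_cases hxv : x = v
    · have : y ≠ v := fun hyv => hxw ⟨rfl, hyv.trans hxv.symm⟩
      simp [hxv, this]
    · have : y = v := by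
        rcases hy with rfl | hy
        · exact absurd ⟨rfl, (hx.resolve_right hxv).symm⟩ hxw
        · exact hy
      simp [hxv, this]
  · have he : l = e := he
    subst he
    have hy' : y = w := h.target hd
    subst hy'
    have h2 : FreeGroup.mk [(l, true)] = FreeGroup.of l := rfl
    rw [h2]
    by_cases hyv : y = v
    · have : x ≠ v := fun hxv => hxw ⟨hxv.trans hyv.symm, rfl⟩
      simp [hyv, this]
    · have : x = v := by
        rcases hx with rfl | hx
        · exact absurd ⟨(hy.resolve_right hyv).symm, rfl⟩ hxw
        · exact hx
      simp [hyv, this]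

/-- Only the tree edge collapses. Elsewhere `tau` of an end is `d⋆` to the power `shift`: for the
loop at `w` both powers are `η`, which is `1` exactly if `w = v`; for the other labels `χ` tells
whether the letter leaves `v`. -/
theorem trans_edge (h : Fork B Γ v w e) {x y : V} {l : E} (hl : (x, l, y) ∈ Γ.edges) :
    (h.Trans x [(l, true)] y [(l, true)]) ∨ (h.Trans x [(l, true)] y []) := by
  classical
  have hstar : h.cut.star.1 = e.1 := rfl
  by_cases he : l = e.1
  · by_cases hxw : x = w ∧ y = w
    · left
      obtain ⟨rfl, rfl⟩ := hxw
      refine h.trans_keep ?_ ?_ <;>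
      · unfold tau Cut.shift
        rw [if_pos (he.trans hstar.symm), h.eta_eq]
        split_ifs <;> simp
    · exact Or.inr (h.trans_star hl he hxw)
  · left
    have h1 : h.cut.shift (l, true) = if x = v then 1 else 0 := by
      rw [← h.chi_eq he (dir_true.2 hl)]; exact if_neg he
    have h2 : h.cut.shift (l, false) = if y = v then 1 else 0 := by
      rw [← h.chi_eq he (dir_false.2 hl)]; exact if_neg he
    refine h.trans_keep ?_ ?_
    · rw [h1]; unfold tau; split_ifs <;> simp
    · rw [h2]; unfold tau; split_ifs <;> simp

theorem exists_trans_dir (h : Fork B Γ v w e) {x y : V} {a : E × Bool} (hd : Γ.Dir x a y) :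
    ∃ s, s.length ≤ 1 ∧ h.Trans x [a] y s := by
  rcases a with ⟨l, _ | _⟩
  · rcases h.trans_edge (dir_false.1 hd) with h1 | h1
    · exact ⟨_, by simp, h1.symm⟩
    · exact ⟨_, by simp, h1.symm⟩
  · rcases h.trans_edge (dir_true.1 hd) with h1 | h1
    · exact ⟨_, by simp, h1⟩
    · exact ⟨_, by simp, h1⟩

theorem exists_trans (h : Fork B Γ v w e) {x y : V} {p : List (E × Bool)}
    (hp : Γ.IsPath x p y) : ∃ s, s.length ≤ p.length ∧ h.Trans x p y s := by
  induction p generalizing x with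
  | nil =>
    obtain rfl := (isPath_nil.1 hp).2
    refine ⟨[], le_rfl, by simp [← FreeGroup.one_eq_mk], fun H c c' hc => ?_⟩
    obtain rfl := (isPath_nil.1 hc).2
    exact .nil trivial
  | cons a p ih =>
    obtain ⟨z, h1, h2⟩ := isPath_cons.1 hp
    obtain ⟨s, hs, hs'⟩ := h.exists_trans_dir h1
    obtain ⟨t, ht, ht'⟩ := ih h2
    exact ⟨s ++ t, by simp; omega, hs'.append ht'⟩

/-- One of the two edges of the fork is collapsed. -/
theorem exists_collapse (h : Fork B Γ v w e) : ∃ x, Γ.Dir x e w ∧ h.Trans x [e] w [] := by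
  obtain ⟨x, hx, hxw⟩ : ∃ x, Γ.Dir x e w ∧ x ≠ w := by
    by_cases hw : Γ.base = w
    · exact ⟨v, h.dir_v, fun hv => h.ne (hw.trans hv.symm)⟩
    · exact ⟨_, h.dir_base, hw⟩
  refine ⟨x, hx, ?_⟩
  rcases e with ⟨l, _ | _⟩
  · exact (h.trans_star (dir_false.1 hx) rfl fun h => hxw h.2).symm
  · exact h.trans_star (dir_true.1 hx) rfl fun h => hxw h.1

theorem Trans.norm_le {h : Fork B Γ v w e} {b : FreeGroup E} {s : List (E × Bool)}
    (ht : h.Trans Γ.base b.toWord Γ.base s) : h.cut.phi⁻¹ b = FreeGroup.mk s := by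
  have h1 := ht.1
  rw [h.tau_base, one_mul, inv_one, mul_one, FreeGroup.mk_toWord] at h1
  rw [← h1]
  simp

theorem norm_inv_le (h : Fork B Γ v w e) {b : FreeGroup E} (hb : b ∈ B) :
    (h.cut.phi⁻¹ b).norm ≤ b.norm := by
  obtain ⟨s, hs, ht⟩ := h.exists_trans (h.folding.closed b hb)
  rw [ht.norm_le]
  exact FreeGroup.norm_mk_le.trans hs

/-- Some word of `B` crosses the collapsed edge and loses at least that letter. -/
theorem exists_norm_inv_lt (h : Fork B Γ v w e) : ∃ b ∈ B, (h.cut.phi⁻¹ b).norm < b.norm := by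
  obtain ⟨x, hx, hc⟩ := h.exists_collapse
  obtain ⟨b, hb, p, q, h1⟩ := h.folding.cover_dir hx
  refine ⟨b, hb, ?_⟩
  have key : ∀ p q a z z', b.toWord = p ++ a :: q → Γ.IsPath Γ.base p z → Γ.IsPath z' q Γ.base →
      h.Trans z [a] z' [] → (h.cut.phi⁻¹ b).norm < b.norm := by
    intro p q a z z' hw hp hq ha
    obtain ⟨s, hs, hs'⟩ := h.exists_trans hp
    obtain ⟨t, ht, ht'⟩ := h.exists_trans hq
    have := hs'.append (ha.append ht')
    rw [List.singleton_append, ← hw] at this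
    rw [this.norm_le]
    refine FreeGroup.norm_mk_le.trans_lt ?_
    change _ < b.toWord.length
    rw [hw]
    simp only [List.nil_append, List.length_append, List.length_cons]
    omega
  rcases h1 with ⟨hw, hp, hq⟩ | ⟨hw, hp, hq⟩
  · exact key _ _ _ _ _ hw hp hq hc
  · exact key _ _ _ _ _ hw hp hq hc.symm

/-- The reduced word of `b` is a closed path in the fork and in `core H` at once, so its translate
is a closed path in `X`. -/
theorem inv_mem_partialCut (h : Fork B Γ v w e) (H : Subgroup (FreeGroup E)) {b : FreeGroup E}
    (hb : b ∈ B) (hH : b ∈ H) : h.cut.phi⁻¹ b ∈ partialCut H h.cut := by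
  obtain ⟨s, hs, ht⟩ := h.exists_trans (h.folding.closed b hb)
  rw [ht.norm_le, partialCut_eq]
  refine ⟨s, ?_, rfl⟩
  have hcore : (core H).IsPath (Cosets.one H) b.toWord (Cosets.one H) :=
    core_deterministic.isPath_of_mem_pi FreeGroup.isReduced_toWord
      (by rw [FreeGroup.mk_toWord, core_pi]; exact hH)
  have := ht.2 H _ _ hcore
  rwa [h.tau_base, inv_one, Cosets.mulRight_one] at this

end Fork

/-- A basis that has an element of length at least two is shortened by some cut, in such a way
that the elements of a subgroup `H` are carried into `∂_C H`. -/
theorem IsBasisSet.exists_cut {B : Set (FreeGroup E)} (hB : IsBasisSet B)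
    (hl : ∃ b ∈ B, 1 < b.norm) : ∃ C : Cut E, (∀ b ∈ B, (C.phi⁻¹ b).norm ≤ b.norm) ∧
      (∃ b ∈ B, (C.phi⁻¹ b).norm < b.norm) ∧
      ∀ H : Subgroup (FreeGroup E), ∀ b ∈ B, b ∈ H → C.phi⁻¹ b ∈ partialCut H C := by
  obtain ⟨B', rfl⟩ := hB.finite.exists_finset_coe
  obtain ⟨b, hb, hbn⟩ := hl
  have hF := folding_wedge (B := B') hB.one_notMem (by
    rw [← hB.ncard_eq, Set.ncard_coe_finset])
  have h2 := two_le_wedge_verts_ncard hb hbn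
  obtain ⟨Δ, hΔ, h3⟩ := Folding.exists_two hB.closure_eq_top ((wedge B').verts.ncard - 2) _ hF
    (by omega)
  obtain ⟨v, w, e, h⟩ := hΔ.exists_fork hB.closure_eq_top h3
  exact ⟨h.cut, fun b hb => h.norm_inv_le hb, h.exists_norm_inv_lt,
    fun H b hb hH => h.inv_mem_partialCut H hb hH⟩

theorem IsVertex.trans {G H K : Subgroup (FreeGroup E)} (h1 : IsVertex G H) (h2 : IsVertex H K) :
    IsVertex G K := by
  induction h2 with
  | root => exact h1
  | step _ C ih => exact .step ih C

/-- Such a basis consists of generators and inverses of generators, never of both for one generator,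
so replacing inverses by generators is injective and stays in `G`. -/
theorem encard_le_of_norm_le_one {B : Set (FreeGroup E)} (hB : IsBasisSet B)
    (hl : ∀ b ∈ B, b.norm ≤ 1) (G : Subgroup (FreeGroup E)) :
    (B ∩ (G : Set (FreeGroup E))).encard ≤ (gens E ∩ (G : Set (FreeGroup E))).encard := by
  have key : ∀ b ∈ B, ∃ l : E, b = FreeGroup.of l ∨ b = (FreeGroup.of l)⁻¹ := by
    intro b hb
    have h1 := hl b hb
    have h0 : b.norm ≠ 0 := by
      rw [Ne, FreeGroup.norm_eq_zero]; rintro rfl; exact hB.one_notMem hb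
    obtain ⟨⟨l, c⟩, hl⟩ := List.length_eq_one_iff.1
      (show b.toWord.length = 1 by unfold FreeGroup.norm at *; omega)
    refine ⟨l, ?_⟩
    rw [← FreeGroup.mk_toWord (x := b), hl]
    cases c
    · exact Or.inr rfl
    · exact Or.inl rfl
  obtain ⟨b, hb⟩ := hB
  have hinv : ∀ x ∈ B, x⁻¹ ∈ B → False := by
    intro x hx hx'
    have h1 := b.repr_apply_coe ⟨x, hx⟩
    have h2 := b.repr_apply_coe ⟨_, hx'⟩
    rw [hb] at h1 h2
    simp only [map_inv] at h2
    rw [h1] at h2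
    have h3 := congrArg FreeGroup.toWord h2
    rw [FreeGroup.toWord_inv] at h3
    simp [FreeGroup.invRev] at h3
  classical
  let f : FreeGroup E → FreeGroup E := fun x => if x ∈ gens E then x else x⁻¹
  refine Set.encard_le_encard_of_injOn (f := f) ?_ ?_
  · rintro x ⟨hx, hG⟩
    by_cases hg : x ∈ gens E
    · simp only [f, if_pos hg]; exact ⟨hg, hG⟩
    · simp only [f, if_neg hg]
      refine ⟨?_, G.inv_mem hG⟩
      obtain ⟨l, rfl | rfl⟩ := key x hx
      · exact absurd ⟨l, rfl⟩ hg
      · exact ⟨l, by simp⟩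
  · rintro x ⟨hx, _⟩ y ⟨hy, _⟩ hxy
    simp only [f] at hxy
    split_ifs at hxy with h1 h2 h2
    · exact hxy
    · subst hxy; exact absurd (hinv y hy hx) id
    · subst hxy; exact absurd (hinv x hx hy) id
    · exact inv_injective hxy

/-- Each basis is dominated by a vertex. -/
theorem exists_isVertex_encard_le (G : Subgroup (FreeGroup E)) {B : Set (FreeGroup E)}
    (hB : IsBasisSet B) : ∃ H, IsVertex G H ∧
      (B ∩ (G : Set (FreeGroup E))).encard ≤ (gens E ∩ (H : Set (FreeGroup E))).encard := by
  -- Induction on the total length of the basis. A shortening cut replaces the pair `G`, `B` by `∂_C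
  -- G`, `φ_C⁻¹(B)`, which is why `G` is generalized.
  induction hk : ∑ᶠ b ∈ B, b.norm using Nat.strong_induction_on generalizing G B with
  | _ k ih =>
    by_cases hl : ∃ b ∈ B, 1 < b.norm
    · obtain ⟨C, h1, ⟨b, hb, h2⟩, h3⟩ := hB.exists_cut hl
      have hsum : ∑ᶠ b ∈ ((C.phi⁻¹ : MulAut (FreeGroup E)) '' B), b.norm < k := by
        rw [finsum_mem_image (C.phi⁻¹ : MulAut (FreeGroup E)).injective.injOn, ← hk]
        obtain ⟨B', rfl⟩ := hB.finite.exists_finset_coe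
        rw [finsum_mem_coe_finset, finsum_mem_coe_finset]
        exact Finset.sum_lt_sum h1 ⟨b, hb, h2⟩
      obtain ⟨H, hH, hle⟩ := ih _ hsum (partialCut G C) (hB.image C.phi⁻¹) rfl
      refine ⟨H, (IsVertex.step .root C).trans hH, le_trans ?_ hle⟩
      refine Set.encard_le_encard_of_injOn (f := (C.phi⁻¹ : MulAut (FreeGroup E))) ?_
        (C.phi⁻¹ : MulAut (FreeGroup E)).injective.injOn
      rintro x ⟨hx, hG⟩
      exact ⟨⟨x, hx, rfl⟩, h3 G x hx hG⟩
    · push Not at hl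
      exact ⟨G, .root, encard_le_of_norm_le_one hB hl G⟩

/-- For a vertex `K` that dominates `B`: `|B ∩ G| ≤ |E ∩ K| ≤ |E ∩ H| ≤ |E'' ∩ G|`. -/
theorem IsMaxVertex.isMaximizingBasis {G H : Subgroup (FreeGroup E)} (h : IsMaxVertex G H)
    {Cs : List (Cut E)} (hCs : pathEnd G Cs = H) : IsMaximizingBasis G (pathBasis Cs) := by
  subst hCs
  have hg := isGoodPath_pathEnd (G := G) Cs
  refine ⟨hg.isBasis, fun B hB => ?_⟩
  obtain ⟨K, hK, hle⟩ := exists_isVertex_encard_le G hB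
  refine (hle.trans (h.2 K hK)).trans ?_
  rw [← (pathAut Cs).injective.encard_image]
  exact Set.encard_le_encard hg.image_subset

end

/-! ### Primitive recursive and recursively enumerable predicates -/

section Computability

variable {α β γ : Type*} [Primcodable α] [Primcodable β] [Primcodable γ]

/-- Every element of the list satisfies `P`. -/
def AllIn {β : Type*} (l : List β) (P : β → Prop) : Prop := ∀ b ∈ l, P b

/-- Some element of the list satisfies `P`. -/
def ExIn {β : Type*} (l : List β) (P : β → Prop) : Prop := ∃ b ∈ l, P b

/-- A recursively enumerable predicate: the projection of a primitive recursive relation. -/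
def SigmaOne (P : α → Prop) : Prop :=
  ∃ R : α → ℕ → Prop, PrimrecRel R ∧ ∀ a, P a ↔ ∃ n, R a n

attribute [fun_prop] Primrec PrimrecPred SigmaOne
attribute [fun_prop] Primrec.const Primrec.id

namespace Primrec

/-- The closure properties are put in applied form so that `fun_prop` can derive computability from
the shape of a definition. For the same reason bounded quantifiers are wrapped as `AllIn` and
`ExIn`, and implications with a decidable premise appear below as `¬P ∨ Q`. -/
theorem fcomp {f : β → γ} {g : α → β} (hf : Primrec f) (hg : Primrec g) :
    Primrec fun a => f (g a) := hf.comp hg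

theorem ffst {g : α → β × γ} (hg : Primrec g) : Primrec fun a => (g a).1 := Primrec.fst.comp hg

theorem fsnd {g : α → β × γ} (hg : Primrec g) : Primrec fun a => (g a).2 := Primrec.snd.comp hg

theorem fpair {f : α → β} {g : α → γ} (hf : Primrec f) (hg : Primrec g) :
    Primrec fun a => (f a, g a) := hf.pair hg

theorem fadd {f g : α → ℕ} (hf : Primrec f) (hg : Primrec g) : Primrec fun a => f a + g a :=
  Primrec.nat_add.comp hf hg

theorem fnot {f : α → Bool} (hf : Primrec f) : Primrec fun a => !(f a) :=
  Primrec.not.comp hf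

theorem fcons {f : α → β} {g : α → List β} (hf : Primrec f) (hg : Primrec g) :
    Primrec fun a => f a :: g a := Primrec.list_cons.comp hf hg

theorem fappend {f g : α → List β} (hf : Primrec f) (hg : Primrec g) :
    Primrec fun a => f a ++ g a := Primrec.list_append.comp hf hg

theorem fsome {f : α → β} (hf : Primrec f) : Primrec fun a => some (f a) :=
  Primrec.option_some.comp hf

theorem fgetD {f : α → List β} {g : α → ℕ} {h : α → β} (hf : Primrec f) (hg : Primrec g)
    (hh : Primrec h) : Primrec fun a => (f a).getD (g a) (h a) :=
  (Primrec.option_getD.comp (Primrec.list_getElem?.comp hf hg) hh).of_eq fun _ => by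
    rw [List.getD_eq_getElem?_getD]

theorem fgetElem {f : α → List β} {g : α → ℕ} (hf : Primrec f) (hg : Primrec g) :
    Primrec fun a => (f a)[g a]? := Primrec.list_getElem?.comp hf hg

theorem fheadD {f : α → List β} {g : α → β} (hf : Primrec f) (hg : Primrec g) :
    Primrec fun a => (f a).headD (g a) :=
  (Primrec.option_getD.comp (Primrec.list_head?.comp hf) hg).of_eq fun a => by
    cases f a <;> rfl

theorem flength {f : α → List β} (hf : Primrec f) : Primrec fun a => (f a).length :=
  Primrec.list_length.comp hf

theorem freverse {f : α → List β} (hf : Primrec f) : Primrec fun a => (f a).reverse :=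
  Primrec.list_reverse.comp hf

theorem fflatten {f : α → List (List β)} (hf : Primrec f) : Primrec fun a => (f a).flatten :=
  Primrec.list_flatten.comp hf

theorem frange {f : α → ℕ} (hf : Primrec f) : Primrec fun a => List.range (f a) :=
  Primrec.list_range.comp hf

theorem fmap {f : α → List β} {g : α → β → γ} (hf : Primrec f)
    (hg : Primrec fun x : α × β => g x.1 x.2) : Primrec fun a => (f a).map (g a) :=
  Primrec.list_map hf hg

theorem fflatMap {f : α → List β} {g : α → β → List γ} (hf : Primrec f)
    (hg : Primrec fun x : α × β => g x.1 x.2) : Primrec fun a => (f a).flatMap (g a) :=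
  Primrec.list_flatMap hf hg

theorem ffilterMap {f : α → List β} {g : α → β → Option γ} (hf : Primrec f)
    (hg : Primrec fun x : α × β => g x.1 x.2) : Primrec fun a => (f a).filterMap (g a) :=
  Primrec.listFilterMap hf hg

theorem ffoldl {f : α → List β} {i : α → γ} {g : α → γ → β → γ} (hf : Primrec f) (hi : Primrec i)
    (hg : Primrec fun x : α × γ × β => g x.1 x.2.1 x.2.2) :
    Primrec fun a => (f a).foldl (g a) (i a) :=
  Primrec.list_foldl (h := fun a p => g a p.1 p.2) hf hi hg

theorem ffoldr {f : α → List β} {i : α → γ} {g : α → β → γ → γ} (hf : Primrec f) (hi : Primrec i)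
    (hg : Primrec fun x : α × β × γ => g x.1 x.2.1 x.2.2) :
    Primrec fun a => (f a).foldr (g a) (i a) :=
  Primrec.list_foldr (h := fun a p => g a p.1 p.2) hf hi hg

theorem fite {c : α → Prop} [∀ a, Decidable (c a)] {f g : α → β} (hc : PrimrecPred c)
    (hf : Primrec f) (hg : Primrec g) : Primrec fun a => if c a then f a else g a :=
  Primrec.ite hc hf hg

end Primrec

attribute [fun_prop] Primrec.fcomp Primrec.ffst Primrec.fsnd Primrec.fpair Primrec.fadd
  Primrec.fnot Primrec.fcons Primrec.fappend Primrec.fsome Primrec.fgetD Primrec.fgetElem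
  Primrec.fheadD Primrec.flength Primrec.freverse Primrec.fflatten Primrec.frange Primrec.fmap
  Primrec.fflatMap Primrec.ffilterMap Primrec.ffoldl Primrec.ffoldr Primrec.fite

namespace PrimrecPred

theorem feq {f g : α → β} (hf : Primrec f) (hg : Primrec g) : PrimrecPred fun a => f a = g a :=
  Primrec.eq.comp hf hg

theorem flt {f g : α → ℕ} (hf : Primrec f) (hg : Primrec g) : PrimrecPred fun a => f a < g a :=
  Primrec.nat_lt.comp hf hg

theorem fle {f g : α → ℕ} (hf : Primrec f) (hg : Primrec g) : PrimrecPred fun a => f a ≤ g a :=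
  Primrec.nat_le.comp hf hg

theorem fand {P Q : α → Prop} (hP : PrimrecPred P) (hQ : PrimrecPred Q) :
    PrimrecPred fun a => P a ∧ Q a := hP.and hQ

theorem for' {P Q : α → Prop} (hP : PrimrecPred P) (hQ : PrimrecPred Q) :
    PrimrecPred fun a => P a ∨ Q a := hP.or hQ

theorem fnot {P : α → Prop} (hP : PrimrecPred P) : PrimrecPred fun a => ¬P a := hP.not

theorem fiff {P Q : α → Prop} (hP : PrimrecPred P) (hQ : PrimrecPred Q) :
    PrimrecPred fun a => P a ↔ Q a :=
  ((hP.and hQ).or (hP.not.and hQ.not)).of_eq fun a => by tauto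

theorem allIn {f : α → List β} {P : α → β → Prop} (hf : Primrec f)
    (hP : PrimrecPred fun x : α × β => P x.1 x.2) : PrimrecPred fun a => AllIn (f a) (P a) := by
  have h1 : PrimrecRel fun (b : β) (a : α) => P a b :=
    hP.comp (Primrec.snd.pair Primrec.fst)
  exact h1.forall_mem_list.comp hf Primrec.id

theorem exIn {f : α → List β} {P : α → β → Prop} (hf : Primrec f)
    (hP : PrimrecPred fun x : α × β => P x.1 x.2) : PrimrecPred fun a => ExIn (f a) (P a) := by
  have h1 : PrimrecRel fun (b : β) (a : α) => P a b :=
    hP.comp (Primrec.snd.pair Primrec.fst)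
  exact h1.exists_mem_list.comp hf Primrec.id

theorem fmem {f : α → List β} {g : α → β} (hf : Primrec f) (hg : Primrec g) :
    PrimrecPred fun a => g a ∈ f a := by
  have : PrimrecPred fun a => ExIn (f a) fun b => b = g a :=
    exIn hf (feq Primrec.snd (hg.comp Primrec.fst))
  exact this.of_eq fun a => by simp [ExIn]

end PrimrecPred

attribute [fun_prop] PrimrecPred.feq PrimrecPred.flt PrimrecPred.fle
  PrimrecPred.fand PrimrecPred.for' PrimrecPred.fnot PrimrecPred.fiff PrimrecPred.allIn
  PrimrecPred.exIn PrimrecPred.fmem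

theorem PrimrecPred.sigmaOne {P : α → Prop} (hP : PrimrecPred P) : SigmaOne P :=
  ⟨fun a _ => P a, hP.comp Primrec.fst, fun a => by simp⟩

namespace SigmaOne

theorem and {P Q : α → Prop} (hP : SigmaOne P) (hQ : SigmaOne Q) :
    SigmaOne fun a => P a ∧ Q a := by
  obtain ⟨R, hR, h⟩ := hP
  obtain ⟨S, hS, h'⟩ := hQ
  refine ⟨fun a n => R a n.unpair.1 ∧ S a n.unpair.2,
    PrimrecPred.and (hR.comp Primrec.fst (Primrec.fst.comp (Primrec.unpair.comp Primrec.snd)))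
      (hS.comp Primrec.fst (Primrec.snd.comp (Primrec.unpair.comp Primrec.snd))), fun a => ?_⟩
  dsimp only
  rw [h, h']
  constructor
  · rintro ⟨⟨n, hn⟩, ⟨m, hm⟩⟩
    exact ⟨Nat.pair n m, by simpa using ⟨hn, hm⟩⟩
  · rintro ⟨n, h1, h2⟩
    exact ⟨⟨_, h1⟩, ⟨_, h2⟩⟩

theorem or {P Q : α → Prop} (hP : SigmaOne P) (hQ : SigmaOne Q) :
    SigmaOne fun a => P a ∨ Q a := by
  obtain ⟨R, hR, h⟩ := hP
  obtain ⟨S, hS, h'⟩ := hQ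
  refine ⟨fun a n => R a n ∨ S a n, PrimrecPred.or hR hS, fun a => ?_⟩
  dsimp only
  rw [h, h', exists_or]

theorem exists' {P : α → β → Prop} (hP : SigmaOne fun x : α × β => P x.1 x.2) :
    SigmaOne fun a => ∃ b, P a b := by
  obtain ⟨R, hR, h⟩ := hP
  -- The number `n` codes a candidate `b` together with a witness for it.
  refine ⟨fun a n => ExIn (Encodable.decode (α := β) n.unpair.1).toList
    fun b => R (a, b) n.unpair.2, ?_, fun a => ?_⟩
  · have h1 : Primrec fun x : α × ℕ => (Encodable.decode (α := β) x.2.unpair.1).toList :=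
      Primrec.optionToList.comp
        (Primrec.decode.comp (Primrec.fst.comp (Primrec.unpair.comp Primrec.snd)))
    refine PrimrecPred.exIn (P := fun (x : α × ℕ) b => R (x.1, b) x.2.unpair.2) h1 ?_
    exact hR.comp ((Primrec.fst.comp Primrec.fst).pair Primrec.snd)
      (Primrec.snd.comp (Primrec.unpair.comp (Primrec.snd.comp Primrec.fst)))
  · constructor
    · rintro ⟨b, hb⟩
      obtain ⟨n, hn⟩ := (h (a, b)).1 hb
      exact ⟨Nat.pair (Encodable.encode b) n, b, by simp, by simpa using hn⟩
    · rintro ⟨n, b, _, hb⟩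
      exact ⟨b, (h (a, b)).2 ⟨_, hb⟩⟩

theorem allIn {f : α → List β} {P : α → β → Prop} (hf : Primrec f)
    (hP : SigmaOne fun x : α × β => P x.1 x.2) : SigmaOne fun a => AllIn (f a) (P a) := by
  obtain ⟨R, hR, h⟩ := hP
  refine ⟨fun a N => AllIn (f a) fun b => ExIn (List.range N) fun n => R (a, b) n, ?_, fun a => ?_⟩
  · refine PrimrecPred.allIn
      (P := fun (x : α × ℕ) b => ExIn (List.range x.2) fun n => R (x.1, b) n)
      (hf.comp Primrec.fst) ?_
    refine PrimrecPred.exIn (P := fun (x : (α × ℕ) × β) n => R (x.1.1, x.2) n)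
      (Primrec.list_range.comp (Primrec.snd.comp Primrec.fst)) ?_
    exact hR.comp ((Primrec.fst.comp (Primrec.fst.comp Primrec.fst)).pair
      (Primrec.snd.comp Primrec.fst)) Primrec.snd
  · constructor
    · intro hall
      have h1 : ∀ b ∈ f a, ∃ n, R (a, b) n := fun b hb => (h (a, b)).1 (hall b hb)
      choose! g hg using h1
      -- The sum bounds all the witnesses at once.
      refine ⟨((f a).map g).sum + 1, fun b hb => ⟨g b, ?_, hg b hb⟩⟩
      rw [List.mem_range, Nat.lt_succ_iff]
      exact List.single_le_sum (fun _ _ => Nat.zero_le _) _ (List.mem_map_of_mem hb)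
    · rintro ⟨N, hN⟩ b hb
      obtain ⟨n, _, hn⟩ := hN b hb
      exact (h (a, b)).2 ⟨n, hn⟩

theorem exIn {f : α → List β} {P : α → β → Prop} (hf : Primrec f)
    (hP : SigmaOne fun x : α × β => P x.1 x.2) : SigmaOne fun a => ExIn (f a) (P a) :=
  SigmaOne.exists' (P := fun a b => b ∈ f a ∧ P a b) (SigmaOne.and
    (PrimrecPred.fmem (hf.comp Primrec.fst) Primrec.snd).sigmaOne hP)

/-- A recursively enumerable total relation contains the graph of a computable function. -/
theorem exists_computable {P : α → β → Prop} (hP : SigmaOne fun x : α × β => P x.1 x.2)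
    (h : ∀ a, ∃ b, P a b) : ∃ f : α → β, Computable f ∧ ∀ a, P a (f a) := by
  obtain ⟨R, hR, hPR⟩ := hP
  classical
  -- Trial `n` decodes a candidate value and a witness, and returns the value if the primitive
  -- recursive check succeeds.
  let g : α → ℕ → Option β := fun a n => (Encodable.decode (α := β) n.unpair.1).bind fun b =>
    if R (a, b) n.unpair.2 then some b else none
  have hg : Primrec₂ g := by
    refine Primrec.option_bind (f := fun x : α × ℕ => Encodable.decode (α := β) x.2.unpair.1)
      (g := fun x b => if R (x.1, b) x.2.unpair.2 then some b else none)
      (Primrec.decode.comp (Primrec.fst.comp (Primrec.unpair.comp Primrec.snd))) ?_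
    refine Primrec.ite (c := fun y : (α × ℕ) × β => R (y.1.1, y.2) y.1.2.unpair.2) ?_
      (Primrec.option_some.comp Primrec.snd) (Primrec.const none)
    exact hR.comp ((Primrec.fst.comp Primrec.fst).pair Primrec.snd)
      (Primrec.snd.comp (Primrec.unpair.comp (Primrec.snd.comp Primrec.fst)))
  have hdom : ∀ a, (Nat.rfindOpt (g a)).Dom := by
    intro a
    rw [Nat.rfindOpt_dom]
    obtain ⟨b, hb⟩ := h a
    obtain ⟨n, hn⟩ := (hPR (a, b)).1 hb
    refine ⟨Nat.pair (Encodable.encode b) n, b, ?_⟩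
    simp [g, hn]
  have hpart : Partrec fun a => Nat.rfindOpt (g a) := Partrec.rfindOpt hg.to_comp
  refine ⟨fun a => (Nat.rfindOpt (g a)).get (hdom a), ?_, fun a => ?_⟩
  · exact hpart.of_eq fun a => (Part.some_get (hdom a)).symm
  · obtain ⟨n, hn⟩ := Nat.rfindOpt_spec (Part.get_mem (hdom a))
    simp only [g, Option.mem_def, Option.bind_eq_some_iff, Option.ite_none_right_eq_some,
      Option.some.injEq] at hn
    obtain ⟨b, _, hb, hb'⟩ := hn
    have h1 : P a b := (hPR (a, b)).2 ⟨_, hb⟩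
    rwa [hb'] at h1

end SigmaOne

namespace SigmaOne

theorem feq {f g : α → β} (hf : Primrec f) (hg : Primrec g) : SigmaOne fun a => f a = g a :=
  (PrimrecPred.feq hf hg).sigmaOne

theorem flt {f g : α → ℕ} (hf : Primrec f) (hg : Primrec g) : SigmaOne fun a => f a < g a :=
  (PrimrecPred.flt hf hg).sigmaOne

theorem fle {f g : α → ℕ} (hf : Primrec f) (hg : Primrec g) : SigmaOne fun a => f a ≤ g a :=
  (PrimrecPred.fle hf hg).sigmaOne

theorem fmem {f : α → List β} {g : α → β} (hf : Primrec f) (hg : Primrec g) :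
    SigmaOne fun a => g a ∈ f a := (PrimrecPred.fmem hf hg).sigmaOne

theorem fnot {P : α → Prop} (hP : PrimrecPred P) : SigmaOne fun a => ¬P a := hP.not.sigmaOne

theorem fiff {P Q : α → Prop} (hP : PrimrecPred P) (hQ : PrimrecPred Q) :
    SigmaOne fun a => P a ↔ Q a := (PrimrecPred.fiff hP hQ).sigmaOne

end SigmaOne

attribute [fun_prop] SigmaOne.feq SigmaOne.flt SigmaOne.fle SigmaOne.fmem SigmaOne.fnot
  SigmaOne.fiff SigmaOne.and SigmaOne.or SigmaOne.exists' SigmaOne.allIn SigmaOne.exIn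

end Computability

/-! ### Codes of words, graphs and cuts -/

section Codes

variable {α β γ : Type*} [Primcodable α] [Primcodable β] [Primcodable γ]

/-- One step of the reduction of a word in the free group. -/
def reduceStep (a : LetterCode) (w : WordCode) : WordCode :=
  -- The default is `a` itself, which is not its own inverse, so an empty `w` takes the second
  -- branch.
  if w.headD (a.1, a.2) = (a.1, !a.2) then w.tail else a :: w

theorem reduce_eq_foldr (w : WordCode) : FreeGroup.reduce w = w.foldr reduceStep [] := by
  induction w with
  | nil => rfl
  | cons a w ih =>
    rw [FreeGroup.reduce.cons, List.foldr_cons, ← ih]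
    rcases FreeGroup.reduce w with _ | ⟨b, l⟩
    · have : a ≠ (a.1, !a.2) := (letterInv_ne a).symm
      simp [reduceStep, this]
    · rcases a with ⟨i, x⟩
      rcases b with ⟨j, y⟩
      simp only [reduceStep, List.headD_cons, List.tail_cons, Prod.mk.injEq]
      congr 1
      cases x <;> cases y <;> simp [eq_comm]

theorem Primrec.ftail {f : α → List β} (hf : Primrec f) : Primrec fun a => (f a).tail :=
  Primrec.list_tail.comp hf

attribute [fun_prop] Primrec.ftail

theorem Primrec.freduce {f : α → WordCode} (hf : Primrec f) :
    Primrec fun a => FreeGroup.reduce (f a) := by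
  have : Primrec fun a => (f a).foldr reduceStep [] := by
    unfold reduceStep
    fun_prop
  exact this.of_eq fun a => (reduce_eq_foldr _).symm

theorem Primrec.finvRev {f : α → WordCode} (hf : Primrec f) :
    Primrec fun a => FreeGroup.invRev (f a) := by
  unfold FreeGroup.invRev
  fun_prop

attribute [fun_prop] Primrec.freduce Primrec.finvRev

/-- The two directions of the edges in a list. -/
def dirs (l : List (ℕ × ℕ × ℕ)) : List (ℕ × LetterCode × ℕ) :=
  l.flatMap fun t => [(t.1, (t.2.1, true), t.2.2), (t.2.2, (t.2.1, false), t.1)]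

/-- The ends of the paths that start in `S` and read the list `p`. -/
def reach {A : Type*} [DecidableEq A] (d : List (ℕ × A × ℕ)) (S : List ℕ) (p : List A) : List ℕ :=
  p.foldl (fun S a => d.filterMap fun t => if t.2.1 = a ∧ t.1 ∈ S then some t.2.2 else none) S

theorem mem_reach_nil {A : Type*} [DecidableEq A] {d : List (ℕ × A × ℕ)} {i j : ℕ} :
    j ∈ reach d [i] [] ↔ j = i := by simp [reach]

theorem mem_reach_cons_aux {A : Type*} [DecidableEq A] {d : List (ℕ × A × ℕ)} {S : List ℕ} {j : ℕ}
    {a : A} {p : List A} :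
    j ∈ reach d S (a :: p) ↔ ∃ i ∈ S, ∃ k, (i, a, k) ∈ d ∧ j ∈ reach d [k] p := by
  have key : ∀ (p : List A) (S : List ℕ), j ∈ reach d S p ↔ ∃ k ∈ S, j ∈ reach d [k] p := by
    intro p
    induction p with
    | nil => intro S; simp [reach]
    | cons b p ih =>
      intro S
      simp only [reach, List.foldl_cons] at ih ⊢
      rw [ih]
      constructor
      · rintro ⟨k, hk, h⟩
        simp only [List.mem_filterMap, Option.ite_none_right_eq_some, Option.some.injEq] at hk
        obtain ⟨t, ht, ⟨h1, h2⟩, rfl⟩ := hk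
        refine ⟨t.1, h2, (ih _).2 ⟨t.2.2, ?_, h⟩⟩
        simp only [List.mem_filterMap, Option.ite_none_right_eq_some, Option.some.injEq]
        exact ⟨t, ht, ⟨h1, by simp⟩, rfl⟩
      · rintro ⟨i, hi, h⟩
        obtain ⟨k, hk, h⟩ := (ih _).1 h
        refine ⟨k, ?_, h⟩
        simp only [List.mem_filterMap, Option.ite_none_right_eq_some, Option.some.injEq,
          List.mem_singleton] at hk ⊢
        obtain ⟨t, ht, ⟨h1, rfl⟩, rfl⟩ := hk
        exact ⟨t, ht, ⟨h1, hi⟩, rfl⟩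
  change j ∈ reach d _ p ↔ _
  rw [key]
  simp only [List.mem_filterMap, Option.ite_none_right_eq_some, Option.some.injEq]
  constructor
  · rintro ⟨k, ⟨⟨i, b, k'⟩, ht, ⟨rfl, h2⟩, rfl⟩, h⟩
    exact ⟨i, h2, k', ht, h⟩
  · rintro ⟨i, hi, k, h1, h2⟩
    exact ⟨k, ⟨_, h1, ⟨rfl, hi⟩, rfl⟩, h2⟩

theorem mem_reach_cons {A : Type*} [DecidableEq A] {d : List (ℕ × A × ℕ)} {i j : ℕ} {a : A}
    {p : List A} : j ∈ reach d [i] (a :: p) ↔ ∃ k, (i, a, k) ∈ d ∧ j ∈ reach d [k] p := by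
  rw [mem_reach_cons_aux]; simp

theorem Primrec.fdirs {f : α → List (ℕ × ℕ × ℕ)} (hf : Primrec f) :
    Primrec fun a => dirs (f a) := by
  unfold dirs
  fun_prop

theorem Primrec.freach [DecidableEq β] {d : α → List (ℕ × β × ℕ)} {S : α → List ℕ}
    {p : α → List β} (hd : Primrec d) (hS : Primrec S) (hp : Primrec p) :
    Primrec fun a => reach (d a) (S a) (p a) := by
  unfold reach
  fun_prop

attribute [fun_prop] Primrec.fdirs Primrec.freach

/-- `w` represents an element of the subgroup generated by the words in `W`. -/
def MemW (W : List WordCode) (w : WordCode) : Prop :=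
  ∃ ws : List WordCode, AllIn ws (fun v => v ∈ W ∨ FreeGroup.invRev v ∈ W) ∧
    FreeGroup.reduce ws.flatten = FreeGroup.reduce w

theorem SigmaOne.memW {W : α → List WordCode} {w : α → WordCode} (hW : Primrec W)
    (hw : Primrec w) : SigmaOne fun a => MemW (W a) (w a) := by
  unfold MemW
  fun_prop

attribute [fun_prop] SigmaOne.memW

/-- The words in `W` generate the fundamental group of the graph with edges `l` at `0`. -/
def Generates (l : List (ℕ × ℕ × ℕ)) (W : List WordCode) : Prop :=
  (AllIn W fun w => ∃ p : WordCode, 0 ∈ reach (dirs l) [0] p ∧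
    FreeGroup.reduce p = FreeGroup.reduce w) ∧
  -- `T` certifies that the fundamental group lies in the group generated by `W`. It is a potential
  -- on the reachable vertices, possibly with several values at a vertex, that changes along edges
  -- only modulo that group and has its values at `0` in it.
  ∃ T : List (ℕ × WordCode), (0, []) ∈ T ∧ (AllIn T fun t => ¬t.1 = 0 ∨ MemW W t.2) ∧
    AllIn T fun t => AllIn (dirs l) fun d => ¬t.1 = d.1 ∨
      ExIn T fun t' => t'.1 = d.2.2 ∧ MemW W (t.2 ++ [d.2.1] ++ FreeGroup.invRev t'.2)

theorem SigmaOne.generates {l : α → List (ℕ × ℕ × ℕ)} {W : α → List WordCode} (hl : Primrec l)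
    (hW : Primrec W) : SigmaOne fun a => Generates (l a) (W a) := by
  unfold Generates
  fun_prop

attribute [fun_prop] SigmaOne.generates

/-- The two graphs have the same fundamental group at `0`. -/
def SamePi (l l' : List (ℕ × ℕ × ℕ)) : Prop :=
  ∃ W : List WordCode, Generates l W ∧ Generates l' W

theorem SigmaOne.samePi {l l' : α → List (ℕ × ℕ × ℕ)} (hl : Primrec l) (hl' : Primrec l') :
    SigmaOne fun a => SamePi (l a) (l' a) := by
  unfold SamePi
  fun_prop

attribute [fun_prop] SigmaOne.samePi

/-- The list has no repetitions. -/
def NodupIdx {A : Type*} (l : List A) : Prop :=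
  AllIn (List.range l.length) fun i => AllIn (List.range l.length) fun j =>
    ¬l[i]? = l[j]? ∨ i = j

theorem nodupIdx_iff {A : Type*} (l : List A) : NodupIdx l ↔ l.Nodup := by
  unfold NodupIdx AllIn
  simp only [List.mem_range]
  rw [List.nodup_iff_injective_getElem]
  constructor
  · intro h i j hij
    have := (h i i.2 j j.2).resolve_left
    exact Fin.ext (this (by simp [hij]))
  · intro h i hi j hj
    by_cases hij : l[i]? = l[j]?
    · right
      rw [List.getElem?_eq_getElem hi, List.getElem?_eq_getElem hj, Option.some.injEq] at hij
      have := @h ⟨i, hi⟩ ⟨j, hj⟩ (by simpa using hij)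
      simpa using this
    · exact Or.inl hij

theorem PrimrecPred.nodupIdx {f : α → List β} (hf : Primrec f) :
    PrimrecPred fun a => NodupIdx (f a) := by
  unfold NodupIdx
  fun_prop

theorem SigmaOne.nodupIdx {f : α → List β} (hf : Primrec f) :
    SigmaOne fun a => NodupIdx (f a) := (PrimrecPred.nodupIdx hf).sigmaOne

attribute [fun_prop] PrimrecPred.nodupIdx SigmaOne.nodupIdx

/-- The code describes a finite graph, with labels less than `n`, that is its own core. -/
def ValidGraph (n : ℕ) (c : GraphCode) : Prop :=
  0 < c.1 ∧ NodupIdx c.2 ∧ (AllIn c.2 fun t => t.1 < c.1 ∧ t.2.1 < n ∧ t.2.2 < c.1) ∧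
  -- The two directions of the equivalence are determinism at initial and at terminal vertices.
  (AllIn c.2 fun s => AllIn c.2 fun t => ¬s.2.1 = t.2.1 ∨ (s.1 = t.1 ↔ s.2.2 = t.2.2)) ∧
  (AllIn c.2 fun t => ∃ p q : WordCode, t.1 ∈ reach (dirs c.2) [0] p ∧
    0 ∈ reach (dirs c.2) [t.2.2] q ∧
    FreeGroup.reduce (p ++ (t.2.1, true) :: q) = p ++ (t.2.1, true) :: q) ∧
  AllIn (List.range c.1) fun i => ∃ p q : WordCode, i ∈ reach (dirs c.2) [0] p ∧
    0 ∈ reach (dirs c.2) [i] q ∧ FreeGroup.reduce (p ++ q) = p ++ q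

theorem SigmaOne.validGraph {n : α → ℕ} {c : α → GraphCode} (hn : Primrec n) (hc : Primrec c) :
    SigmaOne fun a => ValidGraph (n a) (c a) := by
  unfold ValidGraph
  fun_prop

attribute [fun_prop] SigmaOne.validGraph

/-- The code of the inverse letter. -/
def invCode (a : LetterCode) : LetterCode := (a.1, !a.2)

/-- The letter `d⋆`. -/
def dCode (C : CutCode) : LetterCode :=
  if invCode C.2.2 ∈ C.2.1 then C.2.2 else invCode C.2.2

/-- The letter is shifted by the cut. -/
def Shifted (C : CutCode) (a : LetterCode) : Prop :=
  if a.1 = C.2.2.1 then invCode C.2.2 ∈ C.2.1 else a ∈ C.2.1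

instance (C : CutCode) (a : LetterCode) : Decidable (Shifted C a) := by
  unfold Shifted; infer_instance

theorem Primrec.finvCode {f : α → LetterCode} (hf : Primrec f) :
    Primrec fun a => invCode (f a) := by
  unfold invCode
  fun_prop

attribute [fun_prop] Primrec.finvCode

theorem Primrec.fdCode {f : α → CutCode} (hf : Primrec f) : Primrec fun a => dCode (f a) := by
  unfold dCode
  fun_prop

theorem PrimrecPred.shifted {f : α → CutCode} {g : α → LetterCode} (hf : Primrec f)
    (hg : Primrec g) : PrimrecPred fun a => Shifted (f a) (g a) := by
  have : PrimrecPred fun a => ((g a).1 = (f a).2.2.1 ∧ invCode (f a).2.2 ∈ (f a).2.1) ∨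
      (¬(g a).1 = (f a).2.2.1 ∧ g a ∈ (f a).2.1) := by fun_prop
  exact this.of_eq fun a => by unfold Shifted; split_ifs with h <;> simp [h]

attribute [fun_prop] Primrec.fdCode PrimrecPred.shifted

/-- The vertex to which `i` is moved by `d⋆⁻¹`; a new one, if there is no such edge at `i`. -/
def shiftVertex (c : GraphCode) (C : CutCode) (i : ℕ) : ℕ :=
  -- The number `c.1 + i` is not a vertex of `c`, and distinct `i` give distinct new vertices.
  (reach (dirs c.2) [i] [invCode (dCode C)]).headD (c.1 + i)

/-- The edges of the shifted graph. -/
def shiftEdges (c : GraphCode) (C : CutCode) : List (ℕ × ℕ × ℕ) :=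
  c.2.map fun t => (if Shifted C (t.2.1, true) then shiftVertex c C t.1 else t.1, t.2.1,
    if Shifted C (t.2.1, false) then shiftVertex c C t.2.2 else t.2.2)

theorem Primrec.fshiftEdges {c : α → GraphCode} {C : α → CutCode} (hc : Primrec c)
    (hC : Primrec C) : Primrec fun a => shiftEdges (c a) (C a) := by
  unfold shiftEdges shiftVertex
  fun_prop

attribute [fun_prop] Primrec.fshiftEdges

/-- The codes of the letters. -/
def letters (n : ℕ) : List LetterCode := (List.range n).flatMap fun i => [(i, true), (i, false)]

/-- The sublists of a list. -/
def subs (L : List LetterCode) : List WordCode :=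
  L.foldr (fun a acc => acc ++ acc.map fun l => a :: l) [[]]

/-- The conditions on `(₀D, ₁D, e⋆)`. -/
def CutCond (n : ℕ) (C : CutCode) : Prop :=
  (AllIn (letters n) fun a => (a ∈ C.1 ∨ a ∈ C.2.1) ∧ (a ∈ C.1 ∧ a ∈ C.2.1 ↔ a = C.2.2)) ∧
    ExIn C.2.1 fun a => ¬a = C.2.2

theorem Primrec.fletters {f : α → ℕ} (hf : Primrec f) : Primrec fun a => letters (f a) := by
  unfold letters
  fun_prop

theorem Primrec.fsubs {f : α → List LetterCode} (hf : Primrec f) :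
    Primrec fun a => subs (f a) := by
  unfold subs
  fun_prop

attribute [fun_prop] Primrec.fletters Primrec.fsubs

/-- The codes of the triples whose first two entries are sets of letters and whose third entry is
a letter. -/
def triples (n : ℕ) : List CutCode :=
  (subs (letters n)).flatMap fun D0 => (subs (letters n)).flatMap fun D1 =>
    (letters n).map fun e => (D0, D1, e)

theorem Primrec.ftriples {f : α → ℕ} (hf : Primrec f) : Primrec fun a => triples (f a) := by
  unfold triples
  fun_prop

theorem PrimrecPred.cutCond {f : α → ℕ} {C : α → CutCode} (hf : Primrec f) (hC : Primrec C) :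
    PrimrecPred fun a => CutCond (f a) (C a) := by
  unfold CutCond
  fun_prop

theorem SigmaOne.cutCond {f : α → ℕ} {C : α → CutCode} (hf : Primrec f) (hC : Primrec C) :
    SigmaOne fun a => CutCond (f a) (C a) := (PrimrecPred.cutCond hf hC).sigmaOne

attribute [fun_prop] Primrec.ftriples PrimrecPred.cutCond SigmaOne.cutCond

/-- The image of a letter under `φ_C`. -/
def phiLetter (C : CutCode) (a : LetterCode) : WordCode :=
  if a.1 = C.2.2.1 then [a] else
    (if a ∈ C.2.1 then [dCode C] else []) ++ [a] ++
      if invCode a ∈ C.2.1 then [invCode (dCode C)] else []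

/-- The images of the generators under a product of automorphisms `φ_C`. -/
def basisCode (n : ℕ) (Cs : List CutCode) : List WordCode :=
  (List.range n).map fun i => FreeGroup.reduce
    -- `pathAut` applies the last automorphism of the list first, as does a right fold.
    (Cs.foldr (fun C w => w.flatMap (phiLetter C)) [(i, true)])

theorem Primrec.fphiLetter {f : α → CutCode} {g : α → LetterCode} (hf : Primrec f)
    (hg : Primrec g) : Primrec fun a => phiLetter (f a) (g a) := by
  unfold phiLetter
  fun_prop

attribute [fun_prop] Primrec.fphiLetter

theorem Primrec.fbasisCode {f : α → ℕ} {g : α → List CutCode} (hf : Primrec f)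
    (hg : Primrec g) : Primrec fun a => basisCode (f a) (g a) := by
  unfold basisCode
  fun_prop

attribute [fun_prop] Primrec.fbasisCode

/-- The number of edges from the basepoint to itself. -/
def loops (c : GraphCode) : ℕ :=
  (c.2.filterMap fun t => if t.1 = 0 ∧ t.2.2 = 0 then some t else none).length

theorem Primrec.floops {f : α → GraphCode} (hf : Primrec f) : Primrec fun a => loops (f a) := by
  unfold loops
  fun_prop

attribute [fun_prop] Primrec.floops

/-- A radiation graph, a list of paths, the position of a vertex, and a list of words. -/
abbrev OutputCode : Type := RadiationCode × List (List CutCode) × ℕ × List WordCode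

/-- The graph at position `i`. -/
def graphAt (r : RadiationCode) (i : ℕ) : GraphCode := r.1.getD i (0, [])

theorem Primrec.fgraphAt {f : α → RadiationCode} {g : α → ℕ} (hf : Primrec f)
    (hg : Primrec g) : Primrec fun a => graphAt (f a) (g a) := by
  unfold graphAt
  fun_prop

attribute [fun_prop] Primrec.fgraphAt

/-- Some word is read along a closed path in just the first of the two graphs. -/
def Separated (c c' : GraphCode) : Prop :=
  ∃ p : WordCode, FreeGroup.reduce p = p ∧ 0 ∈ reach (dirs c.2) [0] p ∧
    ¬0 ∈ reach (dirs c'.2) [0] p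

/-- The radiation code is correct for the subgroup generated by the words in `Z`. -/
def RadiationCond (n : ℕ) (Z : List WordCode) (r : RadiationCode) : Prop :=
  (AllIn r.1 fun c => ValidGraph n c) ∧
  0 < r.1.length ∧ Generates (graphAt r 0).2 Z ∧
  -- Different positions must carry different subgroups. This has to be certified positively, by a
  -- word that belongs to just one of them.
  (AllIn (List.range r.1.length) fun i => AllIn (List.range r.1.length) fun j => i = j ∨
    Separated (graphAt r i) (graphAt r j) ∨ Separated (graphAt r j) (graphAt r i)) ∧
  NodupIdx r.2 ∧
  (AllIn r.2 fun t => t.1 < r.1.length ∧ t.2.2 < r.1.length ∧ t.2.1 ∈ triples n ∧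
    CutCond n t.2.1 ∧ SamePi (shiftEdges (graphAt r t.1) t.2.1) (graphAt r t.2.2).2) ∧
  AllIn (List.range r.1.length) fun i => AllIn (triples n) fun C => ¬CutCond n C ∨
    ExIn r.2 fun t => t.1 = i ∧ t.2.1 = C

theorem SigmaOne.separated {f g : α → GraphCode} (hf : Primrec f) (hg : Primrec g) :
    SigmaOne fun a => Separated (f a) (g a) := by
  unfold Separated
  fun_prop

attribute [fun_prop] SigmaOne.separated

theorem SigmaOne.radiationCond {f : α → ℕ} {Z : α → List WordCode} {r : α → RadiationCode}
    (hf : Primrec f) (hZ : Primrec Z) (hr : Primrec r) :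
    SigmaOne fun a => RadiationCond (f a) (Z a) (r a) := by
  unfold RadiationCond
  fun_prop

attribute [fun_prop] SigmaOne.radiationCond

/-- The output is correct for the given input. -/
def OutputCond (input : InputCode) (o : OutputCode) : Prop :=
  RadiationCond input.1 input.2 o.1 ∧
  -- Here `reach` reads a list of cuts along the edges of `(G◀)`.
  (AllIn (List.range o.1.1.length) fun i => i ∈ reach o.1.2 [0] (o.2.1.getD i [])) ∧
  o.2.2.1 < o.1.1.length ∧
  (AllIn (List.range o.1.1.length) fun j =>
    loops (graphAt o.1 j) ≤ loops (graphAt o.1 o.2.2.1)) ∧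
  o.2.2.2 = basisCode input.1 (o.2.1.getD o.2.2.1 [])

/-- Some letter of the input is not a letter. -/
def InvalidInput (input : InputCode) : Prop :=
  ExIn input.2 fun w => ExIn w fun a => input.1 ≤ a.1

theorem sigmaOne_outputCond :
    SigmaOne fun x : InputCode × OutputCode => InvalidInput x.1 ∨ OutputCond x.1 x.2 := by
  unfold InvalidInput OutputCond
  fun_prop

end Codes

/-! ### The meaning of the codes -/

section Meaning

variable {n : ℕ}

theorem letterCode_injective : Function.Injective (letterCode (n := n)) := by
  rintro ⟨i, b⟩ ⟨j, c⟩ h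
  simpa [letterCode, Fin.ext_iff] using h

theorem wordCode_injective : Function.Injective (wordCode (n := n)) :=
  List.map_injective_iff.2 letterCode_injective

/-- The embedding of free groups that corresponds to the numbering of the generators. -/
def numbering (n : ℕ) : FreeGroup (Fin n) →* FreeGroup ℕ := FreeGroup.map Fin.val

theorem numbering_injective : Function.Injective (numbering n) :=
  FreeGroup.map_injective Fin.val_injective

theorem numbering_mk (p : List (Fin n × Bool)) :
    numbering n (FreeGroup.mk p) = FreeGroup.mk (wordCode p) := rfl

theorem wordCode_append (p q : List (Fin n × Bool)) :
    wordCode (p ++ q) = wordCode p ++ wordCode q := List.map_append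

theorem wordCode_invRev (p : List (Fin n × Bool)) :
    wordCode (FreeGroup.invRev p) = FreeGroup.invRev (wordCode p) := by
  simp [wordCode, FreeGroup.invRev, letterCode]

theorem isReduced_wordCode {p : List (Fin n × Bool)} :
    FreeGroup.IsReduced (wordCode p) ↔ FreeGroup.IsReduced p := by
  unfold FreeGroup.IsReduced wordCode
  rw [List.isChain_map]
  simp only [letterCode, Fin.val_inj]

theorem reduce_wordCode (p : List (Fin n × Bool)) :
    FreeGroup.reduce (wordCode p) = wordCode (FreeGroup.reduce p) := by
  have h1 : FreeGroup.mk (wordCode p) = FreeGroup.mk (wordCode (FreeGroup.reduce p)) := by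
    rw [← numbering_mk, ← numbering_mk, FreeGroup.reduce.self]
  rw [FreeGroup.reduce.sound h1]
  refine FreeGroup.IsReduced.reduce_eq (isReduced_wordCode.2 ?_)
  rw [FreeGroup.isReduced_iff_reduce_eq, FreeGroup.reduce.idem]

theorem reduce_eq_reduce_iff {p q : WordCode} :
    FreeGroup.reduce p = FreeGroup.reduce q ↔ FreeGroup.mk p = FreeGroup.mk q :=
  ⟨FreeGroup.reduce.exact, FreeGroup.reduce.sound⟩

/-- The labelled graph on the natural numbers, with basepoint `0`, whose edges are listed. -/
def listGraph (n : ℕ) (l : List (ℕ × ℕ × ℕ)) : LabGraph (Fin n) ℕ where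
  verts := Set.univ
  base := 0
  edges := {t | (t.1, t.2.1.val, t.2.2) ∈ l}
  base_mem := trivial
  source_mem _ _ := trivial
  target_mem _ _ := trivial

theorem mem_dirs {l : List (ℕ × ℕ × ℕ)} {i j : ℕ} {a : LetterCode} :
    (i, a, j) ∈ dirs l ↔ if a.2 then (i, a.1, j) ∈ l else (j, a.1, i) ∈ l := by
  rcases a with ⟨k, _ | _⟩ <;> simp [dirs]

theorem mem_dirs_letterCode {l : List (ℕ × ℕ × ℕ)} {i j : ℕ} {a : Fin n × Bool} :
    (i, letterCode a, j) ∈ dirs l ↔ (listGraph n l).Dir i a j := by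
  rw [mem_dirs]; rfl

/-- The search ranges over words on `ℕ`, uniformly in `n`; the bound on the labels forces each word
that can be read to come from `Fin n`. -/
theorem mem_reach_iff {l : List (ℕ × ℕ × ℕ)} (hl : ∀ t ∈ l, t.2.1 < n) {i j : ℕ} {p : WordCode} :
    j ∈ reach (dirs l) [i] p ↔ ∃ p', p = wordCode p' ∧ (listGraph n l).IsPath i p' j := by
  induction p generalizing i with
  | nil =>
    rw [mem_reach_nil]
    constructor
    · rintro rfl; exact ⟨[], rfl, .nil trivial⟩
    · rintro ⟨p', h, hp⟩
      obtain rfl : p' = [] := by simpa [wordCode] using h.symm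
      exact (isPath_nil.1 hp).2.symm
  | cons a p ih =>
    rw [mem_reach_cons]
    constructor
    · rintro ⟨k, h1, h2⟩
      obtain ⟨p', rfl, hp⟩ := ih.1 h2
      have ha : a.1 < n := by
        rw [mem_dirs] at h1
        split_ifs at h1
        · exact hl _ h1
        · exact hl _ h1
      refine ⟨(⟨a.1, ha⟩, a.2) :: p', rfl, isPath_cons.2 ⟨k, ?_, hp⟩⟩
      exact mem_dirs_letterCode.1 h1
    · rintro ⟨p', h, hp⟩
      rcases p' with _ | ⟨b, p'⟩
      · simp [wordCode] at h
      · obtain ⟨rfl, rfl⟩ : a = letterCode b ∧ p = wordCode p' := by simpa [wordCode] using h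
        obtain ⟨k, h1, h2⟩ := isPath_cons.1 hp
        exact ⟨k, mem_dirs_letterCode.2 h1, ih.2 ⟨p', rfl, h2⟩⟩

theorem mem_reach_wordCode {l : List (ℕ × ℕ × ℕ)} (hl : ∀ t ∈ l, t.2.1 < n) {i j : ℕ}
    {p : List (Fin n × Bool)} :
    j ∈ reach (dirs l) [i] (wordCode p) ↔ (listGraph n l).IsPath i p j := by
  rw [mem_reach_iff hl]
  constructor
  · rintro ⟨p', h, hp⟩
    rwa [wordCode_injective h]
  · intro h; exact ⟨p, rfl, h⟩

/-- The subgroup generated by a list of words. -/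
def wordClosure (W : List WordCode) : Subgroup (FreeGroup ℕ) :=
  Subgroup.closure {g | ∃ w ∈ W, g = FreeGroup.mk w}

theorem memW_iff {W : List WordCode} {w : WordCode} :
    MemW W w ↔ FreeGroup.mk w ∈ wordClosure W := by
  unfold MemW AllIn
  constructor
  · rintro ⟨ws, hws, h⟩
    rw [reduce_eq_reduce_iff] at h
    rw [← h]
    clear h
    induction ws with
    | nil => exact one_mem _
    | cons v ws ih =>
      rw [List.flatten_cons, ← FreeGroup.mul_mk]
      refine mul_mem ?_ (ih fun v hv => hws v (List.mem_cons_of_mem _ hv))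
      rcases hws v List.mem_cons_self with h | h
      · exact Subgroup.subset_closure ⟨v, h, rfl⟩
      · rw [← inv_mem_iff, FreeGroup.inv_mk]
        exact Subgroup.subset_closure ⟨_, h, rfl⟩
  · intro h
    rw [wordClosure, ← Subgroup.mem_toSubmonoid, Subgroup.closure_toSubmonoid] at h
    obtain ⟨L, hL, hw⟩ := Submonoid.exists_list_of_mem_closure h
    simp only [reduce_eq_reduce_iff]
    rw [← hw]
    clear hw h
    induction L with
    | nil => exact ⟨[], by simp, rfl⟩
    | cons g L ih =>
      obtain ⟨ws, hws, h⟩ := ih fun x hx => hL x (List.mem_cons_of_mem _ hx)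
      obtain ⟨v, hv, hg⟩ : ∃ v, (v ∈ W ∨ FreeGroup.invRev v ∈ W) ∧ g = FreeGroup.mk v := by
        rcases hL g List.mem_cons_self with ⟨v, hv, h⟩ | ⟨v, hv, h⟩
        · exact ⟨v, Or.inl hv, h⟩
        · refine ⟨FreeGroup.invRev v, Or.inr ?_, ?_⟩
          · rwa [FreeGroup.invRev_invRev]
          · rw [← FreeGroup.inv_mk, ← h, inv_inv]
      refine ⟨v :: ws, ?_, ?_⟩
      · rintro x (_ | ⟨_, hx⟩)
        · exact hv
        · exact hws x hx
      · rw [List.flatten_cons, ← FreeGroup.mul_mk, h, List.prod_cons, hg]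

/-- The first clause of `Generates` gives one inclusion. For the other, following a closed path
through `T` shows that its word lies in the group generated by `W`. -/
theorem generates_iff {l : List (ℕ × ℕ × ℕ)} (hl : ∀ t ∈ l, t.2.1 < n) {W : List WordCode} :
    Generates l W ↔ (listGraph n l).pi.map (numbering n) = wordClosure W := by
  classical
  constructor
  · rintro ⟨h1, T, h2, h3, h4⟩
    apply le_antisymm
    · rintro _ ⟨_, ⟨p, hp, rfl⟩, rfl⟩
      have key : ∀ (p : List (Fin n × Bool)) (i j : ℕ) (u : WordCode), (i, u) ∈ T →
          (listGraph n l).IsPath i p j → ∃ v, (j, v) ∈ T ∧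
            FreeGroup.mk u * FreeGroup.mk (wordCode p) * (FreeGroup.mk v)⁻¹ ∈ wordClosure W := by
        intro p
        induction p with
        | nil =>
          intro i j u hu hp
          obtain rfl := (isPath_nil.1 hp).2
          refine ⟨u, hu, ?_⟩
          have : FreeGroup.mk (wordCode ([] : List (Fin n × Bool))) = 1 := rfl
          rw [this, mul_one, mul_inv_cancel]
          exact one_mem _
        | cons a p ih =>
          intro i j u hu hp
          obtain ⟨k, h5, h6⟩ := isPath_cons.1 hp
          obtain ⟨⟨k', v⟩, hv, hk, hm⟩ :=
            (h4 _ hu _ (mem_dirs_letterCode.2 h5)).resolve_left (by simp)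
          obtain rfl : k' = k := hk
          obtain ⟨v', hv', hm'⟩ := ih k' j v hv h6
          refine ⟨v', hv', ?_⟩
          rw [memW_iff] at hm
          have := mul_mem hm hm'
          rw [← FreeGroup.mul_mk, ← FreeGroup.mul_mk, ← FreeGroup.inv_mk] at this
          have hc : wordCode (a :: p) = [letterCode a] ++ wordCode p := rfl
          rw [hc, ← FreeGroup.mul_mk]
          convert this using 1
          group
      obtain ⟨v, hv, hm⟩ := key p 0 0 [] h2 hp
      have hv' := (h3 _ hv).resolve_left (by simp)
      rw [memW_iff] at hv'
      rw [numbering_mk]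
      have := mul_mem hm hv'
      rwa [← FreeGroup.one_eq_mk, one_mul, inv_mul_cancel_right] at this
    · rw [wordClosure, Subgroup.closure_le]
      rintro _ ⟨w, hw, rfl⟩
      obtain ⟨p, hp, h⟩ := h1 w hw
      rw [reduce_eq_reduce_iff] at h
      obtain ⟨p', rfl, hp'⟩ := (mem_reach_iff hl).1 hp
      exact ⟨FreeGroup.mk p', ⟨p', hp', rfl⟩, h⟩
  · intro h
    constructor
    · intro w hw
      have hm : FreeGroup.mk w ∈ (listGraph n l).pi.map (numbering n) := by
        rw [h]; exact Subgroup.subset_closure ⟨w, hw, rfl⟩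
      obtain ⟨_, ⟨p, hp, rfl⟩, h'⟩ := hm
      exact ⟨wordCode p, (mem_reach_wordCode hl).2 hp, reduce_eq_reduce_iff.2 h'⟩
    -- As `T` serve chosen paths to the reachable vertices among the basepoint and the ends of
    -- edges, with the empty path at `0`.
    · have hrep : ∀ i, ∃ p : List (Fin n × Bool), (i = 0 → p = []) ∧
          ((∃ q, (listGraph n l).IsPath 0 q i) → (listGraph n l).IsPath 0 p i) := by
        intro i
        by_cases hi : i = 0
        · subst hi; exact ⟨[], fun _ => rfl, fun _ => .nil trivial⟩
        · by_cases hq : ∃ q, (listGraph n l).IsPath 0 q i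
          · obtain ⟨q, hq⟩ := hq
            exact ⟨q, fun h => absurd h hi, fun _ => hq⟩
          · exact ⟨[], fun _ => rfl, fun h => absurd h hq⟩
      choose P hP0 hP using hrep
      let V : List ℕ := (0 :: (l.map fun t => t.1) ++ l.map fun t => t.2.2).filter
        fun i => ∃ q, (listGraph n l).IsPath 0 q i
      have hV : ∀ i ∈ V, (listGraph n l).IsPath 0 (P i) i := by
        intro i hi
        exact hP i (by simpa [V] using (List.mem_filter.1 hi).2)
      have hend : ∀ i a j, (i, a, j) ∈ dirs l → j ∈ l.map (fun t => t.1) ++ l.map fun t => t.2.2 := by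
        intro i a j h
        rw [mem_dirs] at h
        split_ifs at h
        · exact List.mem_append_right _ (List.mem_map.2 ⟨_, h, rfl⟩)
        · exact List.mem_append_left _ (List.mem_map.2 ⟨_, h, rfl⟩)
      have hcl : ∀ q, (listGraph n l).IsPath 0 q 0 →
          FreeGroup.mk (wordCode q) ∈ wordClosure W := by
        intro q hq
        rw [← h]
        exact ⟨_, ⟨q, hq, rfl⟩, rfl⟩
      refine ⟨V.map fun i => (i, wordCode (P i)), ?_, ?_, ?_⟩
      · refine List.mem_map.2 ⟨0, ?_, ?_⟩
        · refine List.mem_filter.2 ⟨by simp, ?_⟩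
          simpa using ⟨[], LabGraph.IsPath.nil trivial⟩
        · rw [hP0 0 rfl]; rfl
      · intro t ht
        obtain ⟨i, hi, rfl⟩ := List.mem_map.1 ht
        by_cases hi0 : i = 0
        · subst hi0
          exact Or.inr (memW_iff.2 (hcl _ (hV 0 hi)))
        · exact Or.inl hi0
      · intro t ht d hd
        obtain ⟨i, hi, rfl⟩ := List.mem_map.1 ht
        rcases d with ⟨i', a, j⟩
        by_cases hii : i = i'
        · subst hii
          right
          have hr : j ∈ reach (dirs l) [i] [a] := mem_reach_cons.2 ⟨j, hd, mem_reach_nil.2 rfl⟩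
          obtain ⟨p, hpa, hp⟩ := (mem_reach_iff hl).1 hr
          have hj := (hV i hi).append hp
          have hjV : j ∈ V := by
            refine List.mem_filter.2 ⟨?_, by simpa using ⟨_, hj⟩⟩
            exact List.mem_cons_of_mem _ (hend _ _ _ hd)
          refine ⟨(j, wordCode (P j)), List.mem_map.2 ⟨j, hjV, rfl⟩, rfl, ?_⟩
          rw [memW_iff]
          dsimp only
          rw [hpa, ← wordCode_invRev, ← wordCode_append, ← wordCode_append]
          exact hcl _ (hj.append (hV j hjV).symm)
        · exact Or.inl hii

/-- Finite generation supplies the common finite list of words that certifies equality. -/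
theorem samePi_of_fg {l l' : List (ℕ × ℕ × ℕ)} (hl : ∀ t ∈ l, t.2.1 < n)
    (hl' : ∀ t ∈ l', t.2.1 < n) (h : (listGraph n l).pi = (listGraph n l').pi)
    (hfg : (listGraph n l).pi.FG) : SamePi l l' := by
  obtain ⟨S, hS⟩ := hfg
  have key : (listGraph n l).pi.map (numbering n) =
      wordClosure (S.toList.map fun g => wordCode g.toWord) := by
    rw [← hS, MonoidHom.map_closure, wordClosure]
    congr 1
    ext g
    constructor
    · rintro ⟨x, hx, rfl⟩
      refine ⟨_, List.mem_map.2 ⟨x, by simpa using hx, rfl⟩, ?_⟩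
      rw [← numbering_mk, FreeGroup.mk_toWord]
    · rintro ⟨w, hw, rfl⟩
      obtain ⟨x, hx, rfl⟩ := List.mem_map.1 hw
      refine ⟨x, by simpa using hx, ?_⟩
      rw [← numbering_mk, FreeGroup.mk_toWord]
  exact ⟨_, (generates_iff hl).2 key, (generates_iff hl').2 (h ▸ key)⟩

theorem SamePi.pi_eq {l l' : List (ℕ × ℕ × ℕ)} (h : SamePi l l') (hl : ∀ t ∈ l, t.2.1 < n)
    (hl' : ∀ t ∈ l', t.2.1 < n) : (listGraph n l).pi = (listGraph n l').pi := by
  obtain ⟨W, h1, h2⟩ := h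
  refine Subgroup.map_injective numbering_injective ?_
  rw [(generates_iff hl).1 h1, (generates_iff hl').1 h2]

/-! ### Valid graph codes -/

theorem LabGraph.IsPath.of_edges_subset {L : Type u} {V : Type v} {Γ Δ : LabGraph L V}
    (he : Γ.edges ⊆ Δ.edges) {x y : V} {p : List (L × Bool)} (h : Γ.IsPath x p y)
    (hx : x ∈ Δ.verts) : Δ.IsPath x p y := by
  induction h with
  | nil _ => exact .nil hx
  | along h _ ih => exact .along (he h) (ih (Δ.target_mem _ (he h)))
  | against h _ ih => exact .against (he h) (ih (Δ.source_mem _ (he h)))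

/-- `listGraph` has all natural numbers as vertices; isolated vertices do not matter for the
fundamental group. -/
theorem LabGraph.pi_eq_of_edges_eq {L : Type u} {V : Type v} {Γ Δ : LabGraph L V}
    (hb : Γ.base = Δ.base) (he : Γ.edges = Δ.edges) : Γ.pi = Δ.pi := by
  apply le_antisymm
  · rintro _ ⟨p, hp, rfl⟩
    have := hp.of_edges_subset he.le (hb ▸ Δ.base_mem)
    rw [hb] at this
    exact ⟨p, this, rfl⟩
  · rintro _ ⟨p, hp, rfl⟩
    have := hp.of_edges_subset he.ge (hb ▸ Γ.base_mem)
    rw [← hb] at this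
    exact ⟨p, this, rfl⟩

/-- Validity says that the graph is its own core, so by `CoreLike.iso_core` it is the core of its
fundamental group. -/
theorem isGraphCode_of_validGraph {c : GraphCode} (h : ValidGraph n c) :
    IsGraphCode c (core (listGraph n c.2).pi) := by
  obtain ⟨h0, h1, h2, h3, h4, h5⟩ := h
  have hl : ∀ t ∈ c.2, t.2.1 < n := fun t ht => (h2 t ht).2.1
  let Δ : LabGraph (Fin n) ℕ := ⟨{i | i < c.1}, 0, (listGraph n c.2).edges, h0,
    fun t ht => (h2 _ ht).1, fun t ht => (h2 _ ht).2.2⟩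
  have hpi : Δ.pi = (listGraph n c.2).pi := pi_eq_of_edges_eq rfl rfl
  have hpath : ∀ {i p j}, i < c.1 → (listGraph n c.2).IsPath i p j → Δ.IsPath i p j :=
    fun hi hp => LabGraph.IsPath.of_edges_subset (Γ := listGraph n c.2) (Δ := Δ)
      (fun _ h => h) hp hi
  have hcore : Δ.CoreLike := by
    refine ⟨⟨?_, ?_⟩, ?_, ?_⟩
    · intro x e y z hxy hxz
      exact ((h3 _ hxy _ hxz).resolve_left (by simp)).1 rfl
    · intro x e y z hxy hxz
      exact ((h3 _ hxy _ hxz).resolve_left (by simp)).2 rfl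
    · intro x hx
      obtain ⟨p, q, hp, hq, hr⟩ := h5 x (List.mem_range.2 hx)
      obtain ⟨p, rfl, hp'⟩ := (mem_reach_iff hl).1 hp
      obtain ⟨q, rfl, hq'⟩ := (mem_reach_iff hl).1 hq
      refine ⟨p, q, hpath h0 hp', hpath hx hq', ?_⟩
      rw [← FreeGroup.isReduced_iff_reduce_eq, ← wordCode_append, isReduced_wordCode] at hr
      exact hr
    · intro x e y hxy
      obtain ⟨p, q, hp, hq, hr⟩ := h4 _ hxy
      obtain ⟨p, rfl, hp'⟩ := (mem_reach_iff hl).1 hp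
      obtain ⟨q, rfl, hq'⟩ := (mem_reach_iff hl).1 hq
      refine ⟨p, q, hpath h0 hp', hpath (h2 _ hxy).2.2 hq', ?_⟩
      have : wordCode p ++ ((x, e.val, y).2.1, true) :: wordCode q =
        wordCode (p ++ (e, true) :: q) := by rw [wordCode_append]; rfl
      rw [← FreeGroup.isReduced_iff_reduce_eq, this, isReduced_wordCode] at hr
      exact hr
  refine ⟨(nodupIdx_iff _).1 h1, Δ, rfl, rfl, ?_, ?_⟩
  · intro i l j
    constructor
    · intro h; exact ⟨⟨l, hl _ h⟩, rfl, h⟩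
    · rintro ⟨e, rfl, h⟩; exact h
  · rw [← hpi]
    exact hcore.iso_core

theorem IsGraphCode.label_lt {c : GraphCode} {V : Type v} {Γ : LabGraph (Fin n) V}
    (h : IsGraphCode c Γ) : ∀ t ∈ c.2, t.2.1 < n := by
  obtain ⟨_, Δ, _, _, h1, _⟩ := h
  rintro ⟨i, l, j⟩ ht
  obtain ⟨e, rfl, _⟩ := (h1 i l j).1 ht
  exact e.2

theorem IsGraphCode.exists_graph {c : GraphCode} {V : Type v} {Γ : LabGraph (Fin n) V}
    (h : IsGraphCode c Γ) : ∃ Δ : LabGraph (Fin n) ℕ, Δ.verts = {i | i < c.1} ∧ Δ.base = 0 ∧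
      Δ.edges = (listGraph n c.2).edges ∧ Δ.Iso Γ := by
  obtain ⟨_, Δ, hv, hb, h1, h2⟩ := h
  refine ⟨Δ, hv, hb, ?_, h2⟩
  ext ⟨i, e, j⟩
  constructor
  · intro h; exact (h1 i e j).2 ⟨e, rfl, h⟩
  · intro h
    obtain ⟨e', he, h'⟩ := (h1 i e j).1 h
    rwa [Fin.ext he] at h'

theorem IsGraphCode.pi_eq {c : GraphCode} {H : Subgroup (FreeGroup (Fin n))}
    (h : IsGraphCode c (core H)) : (listGraph n c.2).pi = H := by
  obtain ⟨Δ, _, hb, he, h2⟩ := h.exists_graph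
  rw [pi_eq_of_edges_eq (Γ := listGraph n c.2) (Δ := Δ) hb.symm he.symm, h2.pi_eq, core_pi]

theorem IsGraphCode.validGraph {c : GraphCode} {H : Subgroup (FreeGroup (Fin n))}
    (h : IsGraphCode c (core H)) : ValidGraph n c := by
  have hl := h.label_lt
  obtain ⟨Δ, hv, hb, he, h2⟩ := h.exists_graph
  have hc : Δ.CoreLike := h2.coreLike (core_coreLike H)
  have hmem : ∀ t ∈ c.2, ∃ e : Fin n, e.val = t.2.1 ∧ (t.1, e, t.2.2) ∈ Δ.edges := by
    intro t ht
    refine ⟨⟨t.2.1, hl t ht⟩, rfl, ?_⟩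
    rw [he]; exact ht
  have hpath : ∀ {i p j}, Δ.IsPath i p j → j ∈ reach (dirs c.2) [i] (wordCode p) :=
    fun hp => (mem_reach_wordCode hl).2 (hp.of_edges_subset he.le trivial)
  refine ⟨?_, (nodupIdx_iff _).2 h.1, ?_, ?_, ?_, ?_⟩
  · have := Δ.base_mem
    rwa [hv, hb] at this
  · intro t ht
    obtain ⟨e, _, h'⟩ := hmem t ht
    have h3 := Δ.source_mem _ h'
    have h4 := Δ.target_mem _ h'
    rw [hv] at h3 h4
    exact ⟨h3, hl t ht, h4⟩
  · intro s hs t ht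
    by_cases hst : s.2.1 = t.2.1
    · right
      obtain ⟨e, he1, h3⟩ := hmem s hs
      obtain ⟨e', he2, h4⟩ := hmem t ht
      obtain rfl : e = e' := Fin.ext (he1.trans (hst.trans he2.symm))
      constructor
      · intro h5; rw [h5] at h3; exact hc.det.out h3 h4
      · intro h5; rw [h5] at h3; exact hc.det.into h3 h4
    · exact Or.inl hst
  · intro t ht
    obtain ⟨e, he1, h3⟩ := hmem t ht
    obtain ⟨p, q, hp, hq, hr⟩ := hc.edge _ _ _ h3
    rw [hb] at hp hq
    refine ⟨wordCode p, wordCode q, hpath hp, hpath hq, ?_⟩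
    have : wordCode p ++ (t.2.1, true) :: wordCode q = wordCode (p ++ (e, true) :: q) := by
      rw [wordCode_append, ← he1]; rfl
    rw [← FreeGroup.isReduced_iff_reduce_eq, this, isReduced_wordCode]
    exact hr
  · intro i hi
    obtain ⟨p, q, hp, hq, hr⟩ := hc.vert i (by rw [hv]; exact List.mem_range.1 hi)
    rw [hb] at hp hq
    refine ⟨wordCode p, wordCode q, hpath hp, hpath hq, ?_⟩
    rw [← FreeGroup.isReduced_iff_reduce_eq, ← wordCode_append, isReduced_wordCode]
    exact hr

theorem exists_isGraphCode {V : Type v} {Γ : LabGraph (Fin n) V} (h : Γ.IsFinite) :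
    ∃ c, IsGraphCode c Γ := by
  classical
  obtain ⟨Δ, hv, hb, hiso⟩ := exists_nat_iso h.1
  have hfin : Δ.edges.Finite := by
    have h1 : Δ.verts.Finite := by rw [hv]; exact Set.finite_lt_nat _
    exact (h1.prod (Set.finite_univ.prod h1)).subset
      fun t ht => ⟨Δ.source_mem _ ht, trivial, Δ.target_mem _ ht⟩
  refine ⟨(Γ.verts.ncard, hfin.toFinset.toList.map fun t => (t.1, t.2.1.val, t.2.2)), ?_,
    Δ, hv, hb, ?_, hiso⟩
  · refine List.Nodup.map ?_ (Finset.nodup_toList _)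
    rintro ⟨a, b, c⟩ ⟨a', b', c'⟩ h
    simp only [Prod.mk.injEq] at h
    simp [h.1, h.2.2, Fin.ext h.2.1]
  · intro i l j
    simp only [List.mem_map, Finset.mem_toList, Set.Finite.mem_toFinset, Prod.mk.injEq]
    constructor
    · rintro ⟨⟨a, b, c⟩, h, rfl, rfl, rfl⟩; exact ⟨b, rfl, h⟩
    · rintro ⟨e, rfl, h⟩; exact ⟨_, h, rfl, rfl, rfl⟩

end Meaning

/-! ### The codes of the operations `∂_C` -/

section Full

variable {E : Type u} {H : Subgroup (FreeGroup E)}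

/-- A reduced closed path `p ++ q` through `x` gives two reduced paths into `x`, namely `p` and the
inverse of `q`. Their last letters, if both exist, differ, so at most one of the paths cancels with
`a`. -/
theorem exists_path_into_core_vertex {x : Cosets H} (hx : x ∈ (core H).verts) (a : E × Bool) :
    ∃ p, (schreier H).IsPath (Cosets.one H) p x ∧ FreeGroup.IsReduced (p ++ [a]) := by
  obtain ⟨p, q, hp, hq, hr⟩ := hx
  unfold FreeGroup.IsReduced at hr ⊢
  have hr' := hr
  rw [List.isChain_append] at hr
  by_cases h : ∀ b ∈ p.getLast?, b.1 = a.1 → b.2 = a.2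
  · refine ⟨p, hp, ?_⟩
    rw [List.isChain_append]
    refine ⟨hr.1, by simp, ?_⟩
    intro b hb c hc
    obtain rfl : a = c := by simpa using hc
    exact h b hb
  · push Not at h
    obtain ⟨b, hb, hba, hne⟩ := h
    refine ⟨FreeGroup.invRev q, hq.symm, ?_⟩
    rw [List.isChain_append]
    refine ⟨isReduced_invRev hr.2.1, by simp, ?_⟩
    intro c' hc c hc'
    obtain rfl : a = c := by simpa using hc'
    simp only [FreeGroup.invRev, List.getLast?_reverse, List.head?_map, Option.mem_def,
      Option.map_eq_some_iff] at hc
    obtain ⟨c, hc, rfl⟩ := hc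
    have := hr.2.2 b hb c hc
    intro hca
    have h1 := this (hba.trans hca.symm)
    rw [h1] at hne
    revert hne
    dsimp only
    cases c.2 <;> cases a.2 <;> simp

/-- The core is a full subgraph of the Schreier graph. -/
theorem core_dir {x : Cosets H} {a : E × Bool} (hx : x ∈ (core H).verts)
    (hy : x.mulRight (FreeGroup.mk [a]) ∈ (core H).verts) :
    (core H).Dir x a (x.mulRight (FreeGroup.mk [a])) := by
  obtain ⟨p, hp, hpr⟩ := exists_path_into_core_vertex hx a
  obtain ⟨q, hq, hqr⟩ := exists_path_into_core_vertex hy (letterInv a)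
  have h1 : FreeGroup.IsReduced (a :: FreeGroup.invRev q) := by
    have := isReduced_invRev hqr
    simpa [FreeGroup.invRev, letterInv] using this
  have h2 : FreeGroup.IsReduced (p ++ a :: FreeGroup.invRev q) := List.isChain_split.2 ⟨hpr, h1⟩
  have h3 : (schreier H).IsPath (Cosets.one H) (p ++ a :: FreeGroup.invRev q) (Cosets.one H) :=
    hp.append (isPath_cons.2 ⟨_, schreier_dir.2 rfl, hq.symm⟩)
  have h4 := core_isPath_of_mem h2 (Cosets.one_mulRight_eq_one_iff.1 (schreier_isPath.1 h3).symm)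
  rw [← schreier_isPath.1 hp] at h4
  obtain ⟨z, hz, _⟩ := isPath_cons.1 h4
  have h5 : z = x.mulRight (FreeGroup.mk [a]) := by
    have := core_isPath_schreier (isPath_cons.2 ⟨z, hz, .nil hz.target_mem⟩)
    exact this
  rwa [h5] at hz

end Full

/-- A map of graphs that is injective on the vertices that are involved in edges, and surjective on
the edges, preserves the fundamental group. -/
theorem LabGraph.pi_eq_of_injOn {L : Type u} {V : Type v} {V' : Type w} {Γ : LabGraph L V}
    {Γ' : LabGraph L V'} (g : V → V') (S : Set V) (hS : S ⊆ Γ.verts) (hinj : Set.InjOn g S)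
    (hv : ∀ x ∈ Γ.verts, g x ∈ Γ'.verts) (hb : g Γ.base = Γ'.base) (hbS : Γ.base ∈ S)
    (heS : ∀ t ∈ Γ.edges, t.1 ∈ S ∧ t.2.2 ∈ S)
    (he : Γ'.edges = (fun t : V × L × V => (g t.1, t.2.1, g t.2.2)) '' Γ.edges) :
    Γ.pi = Γ'.pi := by
  apply le_antisymm
  · rintro _ ⟨p, hp, rfl⟩
    have := hp.map (Γ' := Γ') g hv fun x e y h => by rw [he]; exact ⟨_, h, rfl⟩
    rw [hb] at this
    exact ⟨p, this, rfl⟩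
  · rintro _ ⟨p, hp, rfl⟩
    have hdir : ∀ x a z', x ∈ S → Γ'.Dir (g x) a z' → ∃ z ∈ S, g z = z' ∧ Γ.Dir x a z := by
      rintro x ⟨e, _ | _⟩ z' hx h
      · rw [dir_false, he] at h
        obtain ⟨⟨u, e', w⟩, ht, h⟩ := h
        simp only [Prod.mk.injEq] at h
        obtain ⟨rfl, rfl, h⟩ := h
        have := heS _ ht
        refine ⟨u, this.1, rfl, ?_⟩
        rw [← hinj this.2 hx h]
        exact dir_false.2 ht
      · rw [dir_true, he] at h
        obtain ⟨⟨u, e', w⟩, ht, h⟩ := h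
        simp only [Prod.mk.injEq] at h
        obtain ⟨h, rfl, rfl⟩ := h
        have := heS _ ht
        refine ⟨w, this.2, rfl, ?_⟩
        rw [← hinj this.1 hx h]
        exact dir_true.2 ht
    have key : ∀ p x y', x ∈ S → Γ'.IsPath (g x) p y' → ∃ y ∈ S, g y = y' ∧ Γ.IsPath x p y := by
      intro p
      induction p with
      | nil =>
        intro x y' hx h
        exact ⟨x, hx, (isPath_nil.1 h).2, .nil (hS hx)⟩
      | cons a p ih =>
        intro x y' hx h
        obtain ⟨z', h1, h2⟩ := isPath_cons.1 h
        obtain ⟨z, hz, rfl, h3⟩ := hdir x a z' hx h1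
        obtain ⟨y, hy, h4, h5⟩ := ih z y' hz h2
        exact ⟨y, hy, h4, isPath_cons.2 ⟨z, h3, h5⟩⟩
    rw [← hb] at hp
    obtain ⟨y, hy, h1, h2⟩ := key p _ _ hbS hp
    rw [hinj hy hbS h1] at h2
    exact ⟨p, h2, rfl⟩

section CutCodes

variable {n : ℕ}

theorem letterCode_mem_lettersCode {a : Fin n × Bool} {D : Finset (Fin n × Bool)} :
    letterCode a ∈ lettersCode D ↔ a ∈ D := by
  unfold lettersCode wordCode
  rw [List.mem_map_of_injective letterCode_injective]
  rcases a with ⟨i, _ | _⟩ <;> simp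

theorem invCode_letterCode (a : Fin n × Bool) : invCode (letterCode a) = letterCode (letterInv a) :=
  rfl

/-- The letter `d⋆`. -/
def Cut.dLetter (C : Cut (Fin n)) : Fin n × Bool :=
  if letterInv C.star ∈ C.D1 then C.star else letterInv C.star

theorem Cut.dStar_eq (C : Cut (Fin n)) : C.dStar = FreeGroup.mk [C.dLetter] := by
  unfold Cut.dStar Cut.eta Cut.chi Cut.dLetter
  split_ifs with h
  · simp
  · simp only [Nat.cast_zero, mul_zero, zero_sub, zpow_neg, zpow_one]
    rfl

theorem Cut.dStar_inv_eq (C : Cut (Fin n)) :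
    C.dStar⁻¹ = FreeGroup.mk [letterInv C.dLetter] := by
  rw [C.dStar_eq]; rfl

theorem dCode_cutCode (C : Cut (Fin n)) : dCode (cutCode C) = letterCode C.dLetter := by
  unfold dCode Cut.dLetter cutCode
  dsimp only
  rw [invCode_letterCode]
  simp only [letterCode_mem_lettersCode]
  split_ifs <;> rfl

theorem shifted_cutCode_iff (C : Cut (Fin n)) (a : Fin n × Bool) :
    Shifted (cutCode C) (letterCode a) ↔
      if a.1 = C.star.1 then letterInv C.star ∈ C.D1 else a ∈ C.D1 := by
  unfold Shifted cutCode
  dsimp only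
  rw [invCode_letterCode]
  simp only [letterCode_mem_lettersCode]
  by_cases h : a.1 = C.star.1
  · have h' : (letterCode a).1 = (letterCode C.star).1 := congrArg Fin.val h
    simp only [if_pos h, if_pos h']
  · have h' : ¬(letterCode a).1 = (letterCode C.star).1 := fun h' => h (Fin.ext h')
    simp only [if_neg h, if_neg h']

theorem shifted_cutCode (C : Cut (Fin n)) (a : Fin n × Bool) :
    C.shift a = if Shifted (cutCode C) (letterCode a) then 1 else 0 := by
  simp only [shifted_cutCode_iff]
  unfold Cut.shift Cut.eta Cut.chi
  by_cases h : a.1 = C.star.1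
  · simp only [if_pos h]
  · simp only [if_neg h]

theorem shiftEdges_label_lt {c : GraphCode} {C : CutCode} (h : ∀ t ∈ c.2, t.2.1 < n) :
    ∀ t ∈ shiftEdges c C, t.2.1 < n := by
  intro t ht
  obtain ⟨s, hs, rfl⟩ := List.mem_map.1 ht
  exact h s hs

/-- The map `g` sends the shifted code graph onto the edges of `X`: vertices of the code go to their
cosets, and the new vertex `c.1 + i` goes to the coset of `i` moved by `d⋆⁻¹`. It is injective on
the vertices in use because new ones lie outside the core. -/
theorem pi_shiftEdges {c : GraphCode} {H : Subgroup (FreeGroup (Fin n))}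
    (hc : IsGraphCode c (core H)) (C : Cut (Fin n)) :
    (listGraph n (shiftEdges c (cutCode C))).pi = partialCut H C := by
  have hl := hc.label_lt
  obtain ⟨Δ, hv, hb, hΔ, f, hf, hfb, hfe⟩ := hc.exists_graph
  rw [hb] at hfb
  have h0 : 0 < c.1 := by
    have := Δ.base_mem
    rwa [hb, hv] at this
  rw [hv] at hf
  let g : ℕ → Cosets H := fun i => if i < c.1 then f i else (f (i - c.1)).mulRight C.dStar⁻¹
  have hg : ∀ i, i < c.1 → g i = f i := fun i hi => if_pos hi
  have hg' : ∀ i, g (c.1 + i) = (f i).mulRight C.dStar⁻¹ := fun i => by simp [g]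
  -- The old vertices, and those new ones that `shiftVertex` can produce.
  let S : Set ℕ := {i | i < c.1} ∪
    {i | ∃ j, j < c.1 ∧ i = c.1 + j ∧ (f j).mulRight C.dStar⁻¹ ∉ (core H).verts}
  have hinj : Set.InjOn g S := by
    rintro i (hi | ⟨i, hi, rfl, hi'⟩) j (hj | ⟨j, hj, rfl, hj'⟩) h
    · rw [hg i hi, hg j hj] at h
      exact hf.injOn hi hj h
    · rw [hg i hi, hg'] at h
      exact absurd (h ▸ hf.mapsTo hi) hj'
    · rw [hg j hj, hg'] at h
      exact absurd (h ▸ hf.mapsTo hj) hi'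
    · rw [hg', hg'] at h
      rw [hf.injOn hi hj (Cosets.mulRight_injective _ h)]
  have hedge : ∀ i e j, (i, e, j) ∈ Δ.edges → i < c.1 ∧ j < c.1 := by
    intro i e j h
    have h1 := Δ.source_mem _ h
    have h2 := Δ.target_mem _ h
    rw [hv] at h1 h2
    exact ⟨h1, h2⟩
  have hdir : ∀ i a j, (listGraph n c.2).Dir i a j →
      i < c.1 ∧ j < c.1 ∧ (core H).Dir (f i) a (f j) := by
    rintro i ⟨e, _ | _⟩ j h
    · rw [dir_false, ← hΔ] at h
      have := hedge _ _ _ h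
      exact ⟨this.2, this.1,
        dir_false.2 ((hfe _ (Δ.source_mem _ h) _ (Δ.target_mem _ h) _).1 h)⟩
    · rw [dir_true, ← hΔ] at h
      have := hedge _ _ _ h
      exact ⟨this.1, this.2,
        dir_true.2 ((hfe _ (Δ.source_mem _ h) _ (Δ.target_mem _ h) _).1 h)⟩
  have hdir' : ∀ i, i < c.1 → ∀ j, j < c.1 → ∀ a, (core H).Dir (f i) a (f j) →
      (listGraph n c.2).Dir i a j := by
    intro i hi j hj a h
    have hi' : i ∈ Δ.verts := by rw [hv]; exact hi
    have hj' : j ∈ Δ.verts := by rw [hv]; exact hj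
    rcases a with ⟨e, _ | _⟩
    · rw [dir_false] at h ⊢
      rw [← hΔ]
      exact (hfe _ hj' _ hi' _).2 h
    · rw [dir_true] at h ⊢
      rw [← hΔ]
      exact (hfe _ hi' _ hj' _).2 h
  have hcoredir : ∀ x a y, (core H).Dir x a y → y = x.mulRight (FreeGroup.mk [a]) := by
    intro x a y h
    exact core_isPath_schreier (isPath_cons.2 ⟨y, h, .nil h.target_mem⟩)
  have hshift : ∀ i, i < c.1 → shiftVertex c (cutCode C) i ∈ S ∧
      g (shiftVertex c (cutCode C) i) = (f i).mulRight C.dStar⁻¹ := by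
    intro i hi
    unfold shiftVertex
    rw [dCode_cutCode, invCode_letterCode]
    have hr : ∀ j, j ∈ reach (dirs c.2) [i] [letterCode (letterInv C.dLetter)] ↔
        (listGraph n c.2).Dir i (letterInv C.dLetter) j := by
      intro j
      rw [← mem_dirs_letterCode]
      simp [mem_reach_cons, mem_reach_nil]
    rcases hR : reach (dirs c.2) [i] [letterCode (letterInv C.dLetter)] with _ | ⟨j, R⟩
    -- No edge was found. The core is a full subgraph of the Schreier graph (`core_dir`), so the
    -- moved coset is not in the core.
    · rw [List.headD_nil]
      refine ⟨Or.inr ⟨i, hi, rfl, ?_⟩, hg' i⟩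
      intro hmem
      rw [C.dStar_inv_eq] at hmem
      have h1 := core_dir (hf.mapsTo hi) hmem
      obtain ⟨j, hj, h2⟩ := hf.surjOn hmem
      rw [← h2] at h1
      have h3 := hdir' i hi j hj _ h1
      rw [← hr, hR] at h3
      simp at h3
    · rw [List.headD_cons]
      have h1 := (hr j).1 (by rw [hR]; exact List.mem_cons_self)
      obtain ⟨_, h2, h3⟩ := hdir _ _ _ h1
      exact ⟨Or.inl h2, by rw [hg j h2, hcoredir _ _ _ h3, C.dStar_inv_eq]⟩
  have hmove : ∀ i a, i < c.1 →
      (if Shifted (cutCode C) (letterCode a) then shiftVertex c (cutCode C) i else i) ∈ S ∧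
      g (if Shifted (cutCode C) (letterCode a) then shiftVertex c (cutCode C) i else i) =
        (f i).mulRight (C.dStar⁻¹ ^ C.shift a) := by
    intro i a hi
    rw [shifted_cutCode C a]
    split_ifs with h
    · rw [pow_one]; exact hshift i hi
    · rw [pow_zero, Cosets.mulRight_one]; exact ⟨Or.inl hi, hg i hi⟩
  rw [partialCut_eq]
  refine pi_eq_of_injOn g S (fun _ _ => trivial) hinj (fun _ _ => trivial) ?_ (Or.inl h0) ?_ ?_
  · exact (hg 0 h0).trans hfb
  · rintro ⟨i, e, j⟩ h
    obtain ⟨⟨i', l, j'⟩, ht, h⟩ := List.mem_map.1 h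
    simp only [Prod.mk.injEq] at h
    obtain ⟨rfl, rfl, rfl⟩ := h
    have ht' : (i', e, j') ∈ Δ.edges := by rw [hΔ]; exact ht
    have := hedge _ _ _ ht'
    exact ⟨(hmove i' (e, true) this.1).1, (hmove j' (e, false) this.2).1⟩
  · ext ⟨x, e, y⟩
    constructor
    · rintro ⟨⟨x', e', y'⟩, ht, h⟩
      simp only [Prod.mk.injEq] at h
      obtain ⟨rfl, rfl, rfl⟩ := h
      obtain ⟨i, hi, rfl⟩ := hf.surjOn ((core H).source_mem _ ht)
      obtain ⟨j, hj, rfl⟩ := hf.surjOn ((core H).target_mem _ ht)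
      have ht' : (i, e', j) ∈ Δ.edges :=
        (hfe i (by rw [hv]; exact hi) j (by rw [hv]; exact hj) _).2 ht
      rw [hΔ] at ht'
      refine ⟨(_, e', _), List.mem_map.2 ⟨(i, e'.val, j), ht', rfl⟩, ?_⟩
      exact Prod.ext (hmove i (e', true) hi).2 (Prod.ext rfl (hmove j (e', false) hj).2)
    · rintro ⟨⟨i, e', j⟩, ht, h⟩
      simp only [Prod.mk.injEq] at h
      obtain ⟨rfl, rfl, rfl⟩ := h
      obtain ⟨⟨i', l, j'⟩, ht1, h⟩ := List.mem_map.1 ht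
      simp only [Prod.mk.injEq] at h
      obtain ⟨rfl, rfl, rfl⟩ := h
      have ht' : (i', e', j') ∈ Δ.edges := by rw [hΔ]; exact ht1
      have hij := hedge _ _ _ ht'
      refine ⟨(f i', e', f j'),
        (hfe _ (Δ.source_mem _ ht') _ (Δ.target_mem _ ht') _).1 ht', ?_⟩
      exact Prod.ext (hmove i' (e', true) hij.1).2.symm
        (Prod.ext rfl (hmove j' (e', false) hij.2).2.symm)

end CutCodes

/-! ### Codes of cuts, bases and loops -/

section CutCodes

variable {n : ℕ}

theorem letters_eq (n : ℕ) : letters n =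
    wordCode ((List.finRange n).flatMap fun i => [(i, true), (i, false)]) := by
  unfold letters wordCode
  rw [List.map_flatMap, ← List.map_coe_finRange_eq_range, List.flatMap_map]
  rfl

theorem subs_eq (L : List LetterCode) : subs L = L.sublists' := by
  induction L with
  | nil => rfl
  | cons a L ih =>
    rw [List.sublists'_cons, ← ih]; rfl

/-- A sublist of a list without repetitions is determined by its set of elements; so each set of
letters has just one code among the sublists of `letters n`. -/
theorem List.Sublist.eq_filter_mem {A : Type*} [DecidableEq A] {s l : List A} (h : s.Sublist l)
    (hl : l.Nodup) : s = l.filter (· ∈ s) := by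
  have h1 : s.Sublist (l.filter (· ∈ s)) := by
    have := h.filter (· ∈ s)
    rwa [List.filter_eq_self.2 (by simp)] at this
  refine h1.eq_of_length (List.Perm.length_eq ?_)
  rw [List.perm_ext_iff_of_nodup (hl.sublist h) (hl.filter _)]
  intro a
  simp only [List.mem_filter, decide_eq_true_eq]
  exact ⟨fun ha => ⟨h.subset ha, ha⟩, fun ha => ha.2⟩

theorem nodup_flatMap_letters (n : ℕ) :
    ((List.finRange n).flatMap fun i => [(i, true), (i, false)]).Nodup := by
  rw [List.nodup_flatMap]
  refine ⟨fun i _ => by simp, (List.nodup_finRange n).imp ?_⟩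
  intro i j hij
  simp [Function.onFun, hij.symm]

theorem mem_subs_letters {w : WordCode} :
    w ∈ subs (letters n) ↔ ∃ D : Finset (Fin n × Bool), lettersCode D = w := by
  rw [subs_eq, List.mem_sublists', letters_eq]
  constructor
  · intro h
    obtain ⟨s, hs, rfl⟩ := List.sublist_map_iff.1 h
    refine ⟨s.toFinset, ?_⟩
    have := hs.eq_filter_mem (nodup_flatMap_letters n)
    unfold lettersCode
    simp only [List.mem_toFinset]
    refine congrArg wordCode (Eq.trans (List.filter_congr ?_) this.symm)
    simp
  · rintro ⟨D, rfl⟩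
    exact List.Sublist.map _ List.filter_sublist

theorem mem_letters {a : LetterCode} : a ∈ letters n ↔ ∃ b : Fin n × Bool, letterCode b = a := by
  rw [letters_eq, wordCode, List.mem_map]
  constructor
  · rintro ⟨b, _, h⟩; exact ⟨b, h⟩
  · rintro ⟨⟨i, _ | _⟩, h⟩
    · exact ⟨_, by simp, h⟩
    · exact ⟨_, by simp, h⟩

theorem mem_lettersCode {a : LetterCode} {D : Finset (Fin n × Bool)} :
    a ∈ lettersCode D ↔ ∃ b ∈ D, letterCode b = a := by
  constructor
  · intro h
    obtain ⟨b, hb, rfl⟩ := List.mem_map.1 h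
    exact ⟨b, by simpa using (List.mem_filter.1 hb).2, rfl⟩
  · rintro ⟨b, hb, rfl⟩; exact letterCode_mem_lettersCode.2 hb

theorem cutCond_iff {D0 D1 : Finset (Fin n × Bool)} {e : Fin n × Bool} :
    CutCond n (lettersCode D0, lettersCode D1, letterCode e) ↔
      D0 ∪ D1 = Finset.univ ∧ D0 ∩ D1 = {e} ∧ ∃ a ∈ D1, a ≠ e := by
  have key : CutCond n (lettersCode D0, lettersCode D1, letterCode e) ↔
      (∀ a : Fin n × Bool, (a ∈ D0 ∨ a ∈ D1) ∧ (a ∈ D0 ∧ a ∈ D1 ↔ a = e)) ∧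
        ∃ a, a ∈ lettersCode D1 ∧ ¬a = letterCode e := by
    unfold CutCond AllIn ExIn
    simp only [mem_letters, forall_exists_index, forall_apply_eq_imp_iff,
      letterCode_mem_lettersCode, letterCode_injective.eq_iff]
  rw [key]
  rw [forall_and, and_assoc]
  simp only [Finset.ext_iff, Finset.mem_union, Finset.mem_inter, Finset.mem_univ, iff_true,
    Finset.mem_singleton]
  refine and_congr_right fun _ => and_congr_right fun _ => ?_
  constructor
  · rintro ⟨_, ha, h⟩
    obtain ⟨b, hb, rfl⟩ := mem_lettersCode.1 ha
    exact ⟨b, hb, fun h' => h (by rw [h'])⟩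
  · rintro ⟨b, hb, h⟩
    exact ⟨_, letterCode_mem_lettersCode.2 hb, fun h' => h (letterCode_injective h')⟩

theorem exists_cutCode_iff {C : CutCode} :
    (∃ C' : Cut (Fin n), cutCode C' = C) ↔ C ∈ triples n ∧ CutCond n C := by
  have htriples : C ∈ triples n ↔ ∃ (D0 D1 : Finset (Fin n × Bool)) (e : Fin n × Bool),
      (lettersCode D0, lettersCode D1, letterCode e) = C := by
    simp only [triples, List.mem_flatMap, List.mem_map, mem_subs_letters, mem_letters]
    constructor
    · rintro ⟨_, ⟨D0, rfl⟩, _, ⟨D1, rfl⟩, _, ⟨e, rfl⟩, rfl⟩; exact ⟨D0, D1, e, rfl⟩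
    · rintro ⟨D0, D1, e, rfl⟩; exact ⟨_, ⟨D0, rfl⟩, _, ⟨D1, rfl⟩, _, ⟨e, rfl⟩, rfl⟩
  rw [htriples]
  constructor
  · rintro ⟨C', rfl⟩
    refine ⟨⟨_, _, _, rfl⟩, cutCond_iff.2 ⟨C'.union_eq, C'.inter_eq, ?_⟩⟩
    by_contra! h
    apply C'.D1_ne
    ext a
    rw [Finset.mem_singleton]
    refine ⟨h a, ?_⟩
    rintro rfl
    have : C'.star ∈ C'.D0 ∩ C'.D1 := by rw [C'.inter_eq]; simp
    exact (Finset.mem_inter.1 this).2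
  · rintro ⟨⟨D0, D1, e, rfl⟩, h⟩
    obtain ⟨h1, h2, a, h3, h4⟩ := cutCond_iff.1 h
    refine ⟨⟨D0, D1, e, h1, h2, ?_⟩, rfl⟩
    rintro rfl
    exact h4 (Finset.mem_singleton.1 h3)

theorem Cut.phi_mk_letter (C : Cut (Fin n)) (a : Fin n × Bool) :
    C.phi (FreeGroup.mk [a]) = if a.1 = C.star.1 then FreeGroup.mk [a] else
      C.dStar ^ C.chi a * FreeGroup.mk [a] * C.dStar⁻¹ ^ C.chi (letterInv a) := by
  have h : C.phi (FreeGroup.of a.1) = if a.1 = C.star.1 then FreeGroup.of a.1 else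
      C.dStar ^ C.chi (a.1, true) * FreeGroup.of a.1 * C.dStar⁻¹ ^ C.chi (a.1, false) := by
    change C.twist C.dStar (FreeGroup.of a.1) = _
    simp [Cut.twist]
  rcases a with ⟨e, _ | _⟩
  · have h2 : FreeGroup.mk [(e, false)] = (FreeGroup.of e)⁻¹ := rfl
    rw [h2, map_inv, h]
    split_ifs
    · rfl
    · simp only [letterInv, Bool.not_false]
      group
  · exact h

/-- Letterwise substitution computes `φ_C` before reduction; carrying `p'` along keeps the result
within the codes of words over `Fin n`. -/
theorem flatMap_phiLetter (C : Cut (Fin n)) (p : List (Fin n × Bool)) :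
    ∃ p', (wordCode p).flatMap (phiLetter (cutCode C)) = wordCode p' ∧
      FreeGroup.mk p' = C.phi (FreeGroup.mk p) := by
  induction p with
  | nil => exact ⟨[], rfl, by rw [← FreeGroup.one_eq_mk, map_one]⟩
  | cons a p ih =>
    obtain ⟨p', h1, h2⟩ := ih
    obtain ⟨q, h3, h4⟩ : ∃ q, phiLetter (cutCode C) (letterCode a) = wordCode q ∧
        FreeGroup.mk q = C.phi (FreeGroup.mk [a]) := by
      refine ⟨if a.1 = C.star.1 then [a] else
        (if a ∈ C.D1 then [C.dLetter] else []) ++ [a] ++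
          if letterInv a ∈ C.D1 then [letterInv C.dLetter] else [], ?_, ?_⟩
      · unfold phiLetter
        rw [dCode_cutCode, invCode_letterCode, invCode_letterCode]
        unfold cutCode
        dsimp only
        simp only [letterCode_mem_lettersCode]
        by_cases h : a.1 = C.star.1
        · have h' : (letterCode a).1 = (letterCode C.star).1 := congrArg Fin.val h
          rw [if_pos h, if_pos h']; rfl
        · have h' : ¬(letterCode a).1 = (letterCode C.star).1 := fun h' => h (Fin.ext h')
          rw [if_neg h, if_neg h', wordCode_append, wordCode_append]
          split_ifs <;> rfl
      · rw [C.phi_mk_letter, C.dStar_inv_eq, C.dStar_eq]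
        split_ifs with h1 h2 h3 h3 <;> simp [Cut.chi, *]
    refine ⟨q ++ p', ?_, ?_⟩
    · change (letterCode a :: wordCode p).flatMap _ = _
      rw [List.flatMap_cons, h1, h3, wordCode_append]
    · rw [← FreeGroup.mul_mk, h2, h4, mk_cons a p, map_mul]

theorem basisCode_map_cutCode (Cs : List (Cut (Fin n))) :
    basisCode n (Cs.map cutCode) =
      (List.finRange n).map fun i => wordCode (pathAut Cs (FreeGroup.of i)).toWord := by
  unfold basisCode
  rw [← List.map_coe_finRange_eq_range, List.map_map]
  refine List.map_congr_left fun i _ => ?_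
  obtain ⟨p, h1, h2⟩ : ∃ p, (Cs.map cutCode).foldr (fun C w => w.flatMap (phiLetter C))
      [(i.val, true)] = wordCode p ∧ FreeGroup.mk p = pathAut Cs (FreeGroup.of i) := by
    induction Cs with
    | nil => exact ⟨[(i, true)], rfl, by simp [pathAut]; rfl⟩
    | cons C Cs ih =>
      obtain ⟨p, h1, h2⟩ := ih
      obtain ⟨p', h3, h4⟩ := flatMap_phiLetter C p
      refine ⟨p', ?_, ?_⟩
      · rw [List.map_cons, List.foldr_cons, h1, h3]
      · rw [h4, h2]; simp [pathAut]
  change FreeGroup.reduce _ = _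
  dsimp only
  rw [h1, reduce_wordCode, ← h2, FreeGroup.toWord_mk]

theorem IsGraphCode.deterministic {c : GraphCode} {H : Subgroup (FreeGroup (Fin n))}
    (h : IsGraphCode c (core H)) : (listGraph n c.2).Deterministic := by
  obtain ⟨Δ, _, _, he, h2⟩ := h.exists_graph
  exact (h2.coreLike (core_coreLike H)).det.mono he.ge

/-- A one-letter word is reduced, so by determinism a generator lies in `H` exactly if it labels a
loop at the basepoint. Hence `loops` counts `E ∩ H`. -/
theorem IsGraphCode.of_mem_iff {c : GraphCode} {H : Subgroup (FreeGroup (Fin n))}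
    (h : IsGraphCode c (core H)) {e : Fin n} : FreeGroup.of e ∈ H ↔ (0, e.val, 0) ∈ c.2 := by
  rw [← h.pi_eq]
  constructor
  · intro hm
    have h1 := h.deterministic.isPath_of_mem_pi (p := [(e, true)]) (by simp) hm
    obtain ⟨z, h2, h3⟩ := isPath_cons.1 h1
    obtain ⟨_, rfl⟩ := isPath_nil.1 h3
    exact dir_true.1 h2
  · intro hm
    exact ⟨[(e, true)], .along hm (.nil trivial), rfl⟩

theorem IsGraphCode.encard_gens_inter {c : GraphCode} {H : Subgroup (FreeGroup (Fin n))}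
    (h : IsGraphCode c (core H)) :
    (gens (Fin n) ∩ (H : Set (FreeGroup (Fin n)))).encard = loops c := by
  have h1 : gens (Fin n) ∩ (H : Set (FreeGroup (Fin n))) =
      FreeGroup.of '' {e : Fin n | (0, e.val, 0) ∈ c.2} := by
    ext g
    constructor
    · rintro ⟨⟨e, rfl⟩, hg⟩; exact ⟨e, h.of_mem_iff.1 hg, rfl⟩
    · rintro ⟨e, he, rfl⟩; exact ⟨⟨e, rfl⟩, h.of_mem_iff.2 he⟩
  have hinj : Function.Injective fun e : Fin n => ((0, e.val, 0) : ℕ × ℕ × ℕ) := by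
    intro a b hab
    simpa [Fin.ext_iff] using hab
  rw [h1, FreeGroup.of_injective.encard_image, ← hinj.encard_image]
  have h2 : c.2.filterMap (fun t => if t.1 = 0 ∧ t.2.2 = 0 then some t else none) =
      c.2.filter fun t => t.1 = 0 ∧ t.2.2 = 0 := by
    rw [← List.filterMap_eq_filter]
    congr 1
    ext t
    simp [Option.guard]
  have h3 : (fun e : Fin n => ((0, e.val, 0) : ℕ × ℕ × ℕ)) '' {e : Fin n | (0, e.val, 0) ∈ c.2} =
      ((c.2.filter fun t => t.1 = 0 ∧ t.2.2 = 0).toFinset : Set (ℕ × ℕ × ℕ)) := by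
    ext ⟨i, l, j⟩
    simp only [Set.mem_image, List.coe_toFinset, List.mem_filter, Prod.mk.injEq]
    constructor
    · rintro ⟨e, he, rfl, rfl, rfl⟩
      exact ⟨he, by simp⟩
    · rintro ⟨h4, h5⟩
      simp only [decide_eq_true_eq] at h5
      obtain ⟨rfl, rfl⟩ := h5
      exact ⟨⟨l, h.label_lt _ h4⟩, h4, rfl, rfl, rfl⟩
  rw [h3, Set.encard_coe_eq_coe_finsetCard, List.toFinset_card_of_nodup (h.1.filter _), loops, h2]

end CutCodes

/-! ### Correct outputs -/

section Outputs

variable {n : ℕ} {G : Subgroup (FreeGroup (Fin n))} {Z : List (List (Fin n × Bool))}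

theorem cutCode_injective : Function.Injective (cutCode (n := n)) := by
  have key : Function.Injective (lettersCode (n := n)) := by
    intro D D' h
    ext a
    rw [← letterCode_mem_lettersCode, h, letterCode_mem_lettersCode]
  rintro ⟨D0, D1, e, _, _, _⟩ ⟨D0', D1', e', _, _, _⟩ h
  simp only [cutCode, Prod.mk.injEq] at h
  obtain rfl := key h.1
  obtain rfl := key h.2.1
  obtain rfl := letterCode_injective h.2.2
  rfl

theorem map_numbering_closure (hG : G = Subgroup.closure {g | ∃ p ∈ Z, g = FreeGroup.mk p}) :
    G.map (numbering n) = wordClosure (Z.map wordCode) := by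
  rw [hG, MonoidHom.map_closure, wordClosure]
  congr 1
  ext g
  constructor
  · rintro ⟨_, ⟨p, hp, rfl⟩, rfl⟩
    exact ⟨_, List.mem_map_of_mem hp, rfl⟩
  · rintro ⟨w, hw, rfl⟩
    obtain ⟨p, hp, rfl⟩ := List.mem_map.1 hw
    exact ⟨_, ⟨p, hp, rfl⟩, rfl⟩

theorem core_edges_finite_of_closure
    (hG : G = Subgroup.closure {g | ∃ p ∈ Z, g = FreeGroup.mk p}) : (core G).edges.Finite := by
  rw [hG]
  refine core_closure_edges_finite ?_
  refine ((List.finite_toSet Z).image FreeGroup.mk).subset ?_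
  rintro _ ⟨p, hp, rfl⟩
  exact ⟨p, hp, rfl⟩

/-- Determinism makes failure to read a reduced word equivalent to non-membership, so a decidable
test certifies that one subgroup is not contained in the other. -/
theorem separated_iff {c c' : GraphCode} {H H' : Subgroup (FreeGroup (Fin n))}
    (h : IsGraphCode c (core H)) (h' : IsGraphCode c' (core H')) : Separated c c' ↔ ¬H ≤ H' := by
  have hl := h.label_lt
  have hl' := h'.label_lt
  rw [← h.pi_eq, ← h'.pi_eq]
  constructor
  · rintro ⟨p, hr, hp, hp'⟩ hle
    obtain ⟨p, rfl, h1⟩ := (mem_reach_iff hl).1 hp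
    rw [← FreeGroup.isReduced_iff_reduce_eq, isReduced_wordCode] at hr
    rw [mem_reach_wordCode hl'] at hp'
    exact hp' (h'.deterministic.isPath_of_mem_pi hr (hle ⟨p, h1, rfl⟩))
  · intro hle
    obtain ⟨g, hg, hg'⟩ := SetLike.not_le_iff_exists.1 hle
    refine ⟨wordCode g.toWord, ?_, ?_, ?_⟩
    · rw [← FreeGroup.isReduced_iff_reduce_eq, isReduced_wordCode]
      exact FreeGroup.isReduced_toWord
    · rw [mem_reach_wordCode hl]
      exact h.deterministic.isPath_of_mem_pi FreeGroup.isReduced_toWord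
        (by rwa [FreeGroup.mk_toWord])
    · rw [mem_reach_wordCode hl']
      intro hp
      exact hg' ⟨_, hp, FreeGroup.mk_toWord⟩

/-- The data of a radiation code, in terms of the subgroups `ν i` at the positions `i`. -/
theorem radiationCond_iff (hG : G = Subgroup.closure {g | ∃ p ∈ Z, g = FreeGroup.mk p})
    {r : RadiationCode} {ν : ℕ → Subgroup (FreeGroup (Fin n))}
    (hν : ∀ i, i < r.1.length → IsGraphCode (graphAt r i) (core (ν i))) :
    RadiationCond n (Z.map wordCode) r ↔
      0 < r.1.length ∧ ν 0 = G ∧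
      (∀ i, i < r.1.length → ∀ j, j < r.1.length → i = j ∨ ν i ≠ ν j) ∧ r.2.Nodup ∧
      (∀ t ∈ r.2, t.1 < r.1.length ∧ t.2.2 < r.1.length ∧
        ∃ C : Cut (Fin n), cutCode C = t.2.1 ∧ partialCut (ν t.1) C = ν t.2.2) ∧
      ∀ i, i < r.1.length → ∀ C : Cut (Fin n), ∃ j, (i, cutCode C, j) ∈ r.2 := by
  have hgraphs : ∀ c ∈ r.1, ∃ i, i < r.1.length ∧ graphAt r i = c := by
    intro c hc
    obtain ⟨i, hi, rfl⟩ := List.mem_iff_getElem.1 hc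
    exact ⟨i, hi, by simp [graphAt, hi]⟩
  have h1 : AllIn r.1 fun c => ValidGraph n c := by
    intro c hc
    obtain ⟨i, hi, rfl⟩ := hgraphs c hc
    exact (hν i hi).validGraph
  unfold RadiationCond
  rw [and_iff_right h1]
  refine and_congr_right fun h0 => and_congr ?_ (and_congr ?_ (and_congr (nodupIdx_iff _)
    (and_congr ?_ ?_)))
  · rw [generates_iff (hν 0 h0).label_lt, (hν 0 h0).pi_eq, ← map_numbering_closure hG]
    exact (Subgroup.map_injective numbering_injective).eq_iff
  · simp only [AllIn, List.mem_range]
    refine forall₂_congr fun i hi => forall₂_congr fun j hj => or_congr_right ?_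
    rw [separated_iff (hν i hi) (hν j hj), separated_iff (hν j hj) (hν i hi), ← not_and_or, ne_eq,
      le_antisymm_iff]
  · refine forall₂_congr fun t _ => and_congr_right fun hi => and_congr_right fun hj => ?_
    rw [← and_assoc, ← exists_cutCode_iff]
    have key : ∀ C : Cut (Fin n), SamePi (shiftEdges (graphAt r t.1) (cutCode C))
        (graphAt r t.2.2).2 ↔ partialCut (ν t.1) C = ν t.2.2 := by
      intro C
      have e1 := pi_shiftEdges (hν _ hi) C
      have e2 := (hν _ hj).pi_eq
      have hl1 := shiftEdges_label_lt (C := cutCode C) (hν _ hi).label_lt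
      have hl2 := (hν _ hj).label_lt
      constructor
      · intro h
        rw [← e1, ← e2, h.pi_eq hl1 hl2]
      · intro h
        refine samePi_of_fg hl1 hl2 (by rw [e1, e2, h]) ?_
        rw [e1, h]
        -- A graph that has a code is finite, which gives the finite generation that `samePi_of_fg`
        -- needs.
        have hfin : (core (ν t.2.2)).edges.Finite := by
          obtain ⟨Δ, hv, _, _, hiso⟩ := (hν _ hj).exists_graph
          obtain ⟨f, hf, _⟩ := hiso
          have h1 : (core (ν t.2.2)).verts.Finite := by
            rw [← hf.image_eq, hv]
            exact (Set.finite_lt_nat _).image f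
          exact (h1.prod (Set.finite_univ.prod h1)).subset fun s hs =>
            ⟨(core _).source_mem _ hs, trivial, (core _).target_mem _ hs⟩
        exact fg_of_core_edges_finite hfin
    constructor
    · rintro ⟨⟨C, hC⟩, h⟩
      rw [← hC, key] at h
      exact ⟨C, hC, h⟩
    · rintro ⟨C, hC, h⟩
      refine ⟨⟨C, hC⟩, ?_⟩
      rwa [← hC, key]
  · simp only [AllIn, ExIn, List.mem_range]
    refine forall₂_congr fun i _ => ?_
    constructor
    · intro h C
      have hC := exists_cutCode_iff.1 ⟨C, rfl⟩
      obtain ⟨⟨i', c, j⟩, ht, rfl, rfl⟩ := (h _ hC.1).resolve_left (not_not.2 hC.2)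
      exact ⟨j, ht⟩
    · intro h C hC
      by_cases hC' : CutCond n C
      · obtain ⟨C, rfl⟩ := exists_cutCode_iff.2 ⟨hC, hC'⟩
        obtain ⟨j, hj⟩ := h C
        exact Or.inr ⟨_, hj, rfl, rfl⟩
      · exact Or.inl hC'

/-- A correct output has the required properties. -/
theorem OutputCond.spec (hG : G = Subgroup.closure {g | ∃ p ∈ Z, g = FreeGroup.mk p})
    {o : OutputCode} (h : OutputCond (n, Z.map wordCode) o) :
    ∃ ν : Fin o.1.1.length → Subgroup (FreeGroup (Fin n)), IsRadiationCode G o.1 ν ∧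
      (∀ i : Fin o.1.1.length, ∃ Cs : List (Cut (Fin n)),
        o.2.1.getD i.val [] = Cs.map cutCode ∧ IsGoodPath G (ν i) Cs) ∧
      ∃ (b : Fin o.1.1.length) (Cs : List (Cut (Fin n))),
        o.2.2.1 = b.val ∧ IsMaxVertex G (ν b) ∧ o.2.1.getD b.val [] = Cs.map cutCode ∧
        o.2.2.2 = (List.finRange n).map (fun i => wordCode (pathAut Cs (FreeGroup.of i)).toWord) ∧
        IsMaximizingBasis G (pathBasis Cs) := by
  obtain ⟨r, paths, best, basis⟩ := o
  obtain ⟨hr, hpaths, hbest, hmax, hbasis⟩ := h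
  dsimp only at *
  -- The subgroups are read off from the graphs of the output; validity makes these graphs their
  -- cores.
  let ν : ℕ → Subgroup (FreeGroup (Fin n)) := fun i => (listGraph n (graphAt r i).2).pi
  have hget : ∀ i : Fin r.1.length, graphAt r i = r.1.get i := fun i => by simp [graphAt]
  have hν : ∀ i, i < r.1.length → IsGraphCode (graphAt r i) (core (ν i)) := fun i hi =>
    isGraphCode_of_validGraph (hr.1 _ (by rw [hget ⟨i, hi⟩]; exact List.get_mem _ _))
  obtain ⟨h0, hroot, hinj, hnd, hedges, htotal⟩ := (radiationCond_iff hG hν).1 hr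
  have hinj' : ∀ {i j}, i < r.1.length → j < r.1.length → ν i = ν j → i = j :=
    fun hi hj h => (hinj _ hi _ hj).resolve_right (not_not.2 h)
  have hedge : ∀ {i C j}, (i, cutCode C, j) ∈ r.2 →
      i < r.1.length ∧ j < r.1.length ∧ partialCut (ν i) C = ν j := by
    intro i C j h
    obtain ⟨hi, hj, C', h1, h2⟩ := hedges _ h
    obtain rfl := cutCode_injective h1
    exact ⟨hi, hj, h2⟩
  have hpathEnd : ∀ (p : List CutCode) (i j : ℕ), j ∈ reach r.2 [i] p →
      ∃ Cs : List (Cut (Fin n)), p = Cs.map cutCode ∧ pathEnd (ν i) Cs = ν j := by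
    intro p
    induction p with
    | nil =>
      intro i j h
      rw [mem_reach_nil.1 h]
      exact ⟨[], rfl, rfl⟩
    | cons c p ih =>
      intro i j h
      obtain ⟨k, h1, h2⟩ := mem_reach_cons.1 h
      obtain ⟨_, _, C, rfl, hC⟩ := hedges _ h1
      obtain ⟨Cs, rfl, hCs⟩ := ih k j h2
      refine ⟨C :: Cs, rfl, ?_⟩
      change pathEnd (partialCut (ν i) C) Cs = ν j
      rw [hC, hCs]
  have hgood : ∀ i, i < r.1.length → ∃ Cs : List (Cut (Fin n)),
      paths.getD i [] = Cs.map cutCode ∧ pathEnd G Cs = ν i := by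
    intro i hi
    obtain ⟨Cs, h1, h2⟩ := hpathEnd _ _ _ (hpaths i (List.mem_range.2 hi))
    exact ⟨Cs, h1, by rw [← hroot, h2]⟩
  have hvertex : ∀ {H}, IsVertex G H → ∃ i, i < r.1.length ∧ ν i = H := by
    intro H hH
    induction hH with
    | root => exact ⟨0, h0, hroot⟩
    | step _ C ih =>
      obtain ⟨i, hi, rfl⟩ := ih
      obtain ⟨j, hj⟩ := htotal i hi C
      obtain ⟨_, hj', hC⟩ := hedge hj
      exact ⟨j, hj', hC.symm⟩
  have hisVertex : ∀ i, i < r.1.length → IsVertex G (ν i) := fun i hi =>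
    isVertex_iff_exists_path.2 ⟨_, (hgood i hi).choose_spec.2⟩
  have hmaxv : IsMaxVertex G (ν best) := by
    refine ⟨hisVertex _ hbest, fun H' hH' => ?_⟩
    obtain ⟨j, hj, rfl⟩ := hvertex hH'
    rw [(hν j hj).encard_gens_inter, (hν _ hbest).encard_gens_inter]
    exact_mod_cast hmax j (List.mem_range.2 hj)
  refine ⟨fun i => ν i, ⟨⟨h0, hroot⟩, fun i j h => Fin.ext (hinj' i.2 j.2 h), ?_, ?_, hnd, ?_⟩,
    ?_, ?_⟩
  · ext H
    constructor
    · rintro ⟨i, rfl⟩; exact hisVertex i i.2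
    · intro hH
      obtain ⟨i, hi, h⟩ := hvertex hH
      exact ⟨⟨i, hi⟩, h⟩
  · intro i
    rw [← hget]
    exact hν i i.2
  · intro i c j
    constructor
    · intro h
      obtain ⟨hi, hj, C, hC, h'⟩ := hedges _ h
      exact ⟨⟨i, hi⟩, ⟨j, hj⟩, C, rfl, rfl, hC, h'.symm⟩
    · rintro ⟨i, j, C, rfl, rfl, rfl, h⟩
      -- Some edge for `C` at `i` is listed; it ends at `j` because the positions carry distinct
      -- subgroups.
      obtain ⟨k, hk⟩ := htotal i i.2 C
      obtain ⟨_, hk', h'⟩ := hedge hk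
      rwa [hinj' j.2 hk' (h.trans h')]
  · intro i
    obtain ⟨Cs, h1, h2⟩ := hgood i i.2
    refine ⟨Cs, h1, ?_⟩
    dsimp only
    rw [← h2]
    exact isGoodPath_pathEnd Cs
  · obtain ⟨Cs, h1, h2⟩ := hgood best hbest
    refine ⟨⟨best, hbest⟩, Cs, rfl, hmaxv, h1, ?_, hmaxv.isMaximizingBasis h2⟩
    rw [hbasis, h1, basisCode_map_cutCode]

/-- There is a correct output. -/
theorem exists_outputCond (hG : G = Subgroup.closure {g | ∃ p ∈ Z, g = FreeGroup.mk p}) :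
    ∃ o, OutputCond (n, Z.map wordCode) o := by
  classical
  have hcore := core_edges_finite_of_closure hG
  have hfin := finite_isVertex hcore
  have : Fintype (Cut (Fin n)) := Fintype.ofFinite _
  -- The vertices of `(G◀)`, without repetitions and with `G` in position `0`, as the format of the
  -- code demands.
  obtain ⟨l, hl0, hnd, hl⟩ : ∃ l : List (Subgroup (FreeGroup (Fin n))), l.idxOf G = 0 ∧ l.Nodup ∧
      ∀ H, H ∈ l ↔ IsVertex G H := by
    refine ⟨G :: (hfin.toFinset.erase G).toList, by simp, ?_, fun H => ?_⟩
    · simp [Finset.nodup_toList]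
    · rw [List.mem_cons, Finset.mem_toList, Finset.mem_erase, Set.Finite.mem_toFinset]
      refine ⟨fun h => h.elim (fun h => h ▸ .root) fun h => h.2, fun h => ?_⟩
      by_cases hH : H = G
      · exact Or.inl hH
      · exact Or.inr ⟨hH, h⟩
  have hcode : ∀ H : Subgroup (FreeGroup (Fin n)), ∃ c, IsVertex G H → IsGraphCode c (core H) := by
    intro H
    by_cases hH : IsVertex G H
    · obtain ⟨c, hc⟩ := exists_isGraphCode (hH.core_isFinite hcore)
      exact ⟨c, fun _ => hc⟩
    · exact ⟨(0, []), fun h => absurd h hH⟩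
  have hpath : ∀ H : Subgroup (FreeGroup (Fin n)), ∃ Cs, IsVertex G H → pathEnd G Cs = H := by
    intro H
    by_cases hH : IsVertex G H
    · obtain ⟨Cs, hCs⟩ := isVertex_iff_exists_path.1 hH
      exact ⟨Cs, fun _ => hCs⟩
    · exact ⟨[], fun h => absurd h hH⟩
  choose F hF using hcode
  choose P hP using hpath
  let ν : ℕ → Subgroup (FreeGroup (Fin n)) := fun i => l.getD i G
  have hν : ∀ i (hi : i < l.length), ν i = l[i] := fun i hi => by simp [ν, hi]
  have hνv : ∀ i, i < l.length → IsVertex G (ν i) := fun i hi => by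
    rw [hν i hi, ← hl]; exact List.getElem_mem hi
  have hidx : ∀ H, IsVertex G H → l.idxOf H < l.length ∧ ν (l.idxOf H) = H := by
    intro H hH
    have h1 := List.idxOf_lt_length_iff.2 ((hl H).2 hH)
    exact ⟨h1, by rw [hν _ h1]; exact List.getElem_idxOf h1⟩
  have hνidx : ∀ i, i < l.length → l.idxOf (ν i) = i := fun i hi => by
    rw [hν i hi]; exact hnd.idxOf_getElem i hi
  have h0 : 0 < l.length := by
    have := (hidx G .root).1
    rwa [hl0] at this
  have hν0 : ν 0 = G := by
    have := (hidx G .root).2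
    rwa [hl0] at this
  let m : List (ℕ × CutCode × ℕ) := ((List.range l.length).flatMap fun i =>
    (Finset.univ : Finset (Cut (Fin n))).toList.map fun C =>
      (i, cutCode C, l.idxOf (partialCut (ν i) C))).dedup
  have hm : ∀ t, t ∈ m ↔ ∃ i C, i < l.length ∧
      (i, cutCode C, l.idxOf (partialCut (ν i) C)) = t := by
    intro t
    simp only [m, List.mem_dedup, List.mem_flatMap, List.mem_range, List.mem_map,
      Finset.mem_toList, Finset.mem_univ, true_and]
    exact ⟨fun ⟨i, hi, C, h⟩ => ⟨i, C, hi, h⟩, fun ⟨i, C, hi, h⟩ => ⟨i, hi, C, h⟩⟩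
  let r : RadiationCode := (l.map F, m)
  have hlen : r.1.length = l.length := List.length_map _
  have hr : ∀ i, i < r.1.length → IsGraphCode (graphAt r i) (core (ν i)) := by
    intro i hi
    rw [hlen] at hi
    have : graphAt r i = F (ν i) := by simp [graphAt, r, hν i hi, hi]
    rw [this]
    exact hF _ (hνv i hi)
  have hreach : ∀ Cs : List (Cut (Fin n)), ∀ i, i < l.length →
      l.idxOf (pathEnd (ν i) Cs) ∈ reach m [i] (Cs.map cutCode) := by
    intro Cs
    induction Cs with
    | nil => intro i hi; exact mem_reach_nil.2 (hνidx i hi)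
    | cons C Cs ih =>
      intro i hi
      obtain ⟨h1, h2⟩ := hidx _ ((hνv i hi).step C)
      refine mem_reach_cons.2 ⟨_, (hm _).2 ⟨i, C, hi, rfl⟩, ?_⟩
      have := ih _ h1
      rwa [h2] at this
  obtain ⟨b, hb, hmax⟩ := Finset.exists_max_image (Finset.range l.length)
    (fun i => loops (graphAt r i)) ⟨0, Finset.mem_range.2 h0⟩
  rw [Finset.mem_range] at hb
  let paths : List (List CutCode) := (List.range l.length).map fun i => (P (ν i)).map cutCode
  refine ⟨(r, paths, b, basisCode n (paths.getD b [])), ?_, ?_, ?_, ?_, rfl⟩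
  · refine (radiationCond_iff hG hr).2 ⟨hlen ▸ h0, hν0, ?_, List.nodup_dedup _, ?_, ?_⟩
    · intro i hi j hj
      rw [hlen] at hi hj
      by_cases h : ν i = ν j
      · left; rw [← hνidx i hi, h, hνidx j hj]
      · exact Or.inr h
    · intro t ht
      obtain ⟨i, C, hi, rfl⟩ := (hm t).1 ht
      obtain ⟨h1, h2⟩ := hidx _ ((hνv i hi).step C)
      rw [hlen]
      exact ⟨hi, h1, C, rfl, h2.symm⟩
    · intro i hi C
      rw [hlen] at hi
      exact ⟨_, (hm _).2 ⟨i, C, hi, rfl⟩⟩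
  · intro i hi
    rw [List.mem_range] at hi
    dsimp only at hi
    rw [hlen] at hi
    have h1 := hreach (P (ν i)) 0 h0
    rw [hν0, hP _ (hνv i hi), hνidx i hi] at h1
    simpa [paths, hi] using h1
  · exact hlen ▸ hb
  · intro j hj
    rw [List.mem_range] at hj
    dsimp only at hj
    rw [hlen] at hj
    exact hmax j (Finset.mem_range.2 hj)

/-- Correct outputs can be computed. -/
theorem exists_computable_output : ∃ f : InputCode → OutputCode, Computable f ∧
    ∀ (n : ℕ) (Z : List (List (Fin n × Bool))),
      OutputCond (n, Z.map wordCode) (f (n, Z.map wordCode)) := by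
  -- The search must succeed on every input for the function to be total, so inputs with a letter
  -- out of range accept any output.
  have key : ∀ input : InputCode, ∃ o, InvalidInput input ∨ OutputCond input o := by
    intro input
    rcases input with ⟨n, W⟩
    by_cases hW : InvalidInput (n, W)
    · exact ⟨default, Or.inl hW⟩
    · have hW' : ∀ w ∈ W, ∀ a ∈ w, a.1 < n := by
        intro w hw a ha
        by_contra hlt
        exact hW ⟨w, hw, a, ha, not_lt.1 hlt⟩
      obtain ⟨Z, rfl⟩ : ∃ Z : List (List (Fin n × Bool)), Z.map wordCode = W := by
        refine ⟨W.pmap (fun w hw => w.pmap (fun a ha => (⟨a.1, ha⟩, a.2)) hw) hW', ?_⟩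
        rw [List.map_pmap]
        conv_rhs => rw [← List.map_id W, ← List.pmap_eq_map (fun w _ => trivial)]
        refine List.pmap_congr_left _ fun w _ hw _ => ?_
        rw [wordCode, List.map_pmap]
        conv_rhs => rw [id, ← List.map_id w, ← List.pmap_eq_map (fun w _ => trivial)]
        exact List.pmap_congr_left _ fun a _ ha _ => rfl
      obtain ⟨o, ho⟩ := exists_outputCond (Z := Z) rfl
      exact ⟨o, Or.inr ho⟩
  obtain ⟨f, hf, h⟩ := SigmaOne.exists_computable
    (P := fun input o => InvalidInput input ∨ OutputCond input o) sigmaOne_outputCond key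
  refine ⟨f, hf, fun n Z => (h _).resolve_left ?_⟩
  rintro ⟨w, hw, a, ha, hlt⟩
  obtain ⟨p, _, rfl⟩ := List.mem_map.1 hw
  obtain ⟨b, _, rfl⟩ := List.mem_map.1 ha
  exact absurd b.1.2 (not_lt.2 hlt)

end Outputs
theorem mainTheorem5 :
    (∀ (E : Type u) [Fintype E] [DecidableEq E] (Z : Finset (FreeGroup E))
      (G : Subgroup (FreeGroup E)), G = Subgroup.closure (Z : Set (FreeGroup E)) →
      -- the graph `(G◀)` is finite, and its vertices are finitely generated subgroups that can be
      -- viewed as finite basepointed labelled graphs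
      ({H | IsVertex G H}.Finite ∧ (radiationEdges G).Finite ∧
        (∀ H, IsVertex G H → H.FG ∧ (core H).IsFinite) ∧
        (∀ H K, IsVertex G H → IsVertex G K → (core H).Iso (core K) → H = K)) ∧
      -- each vertex is reached by a path with the stated properties
      (∀ H, IsVertex G H → ∃ Cs : List (Cut E), IsGoodPath G H Cs) ∧
      -- each basis is dominated by some vertex
      (∀ B : Set (FreeGroup E), IsBasisSet B → ∃ H, IsVertex G H ∧
        (B ∩ (G : Set (FreeGroup E))).encard ≤ (gens E ∩ (H : Set (FreeGroup E))).encard) ∧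
      -- each path from `G` to a vertex with `|E ∩ H|` maximal yields a maximizing basis
      (∀ H, IsMaxVertex G H → ∀ Cs : List (Cut E), pathEnd G Cs = H →
        IsMaximizingBasis G (pathBasis Cs))) ∧
    -- the algorithms, which are uniform in the rank `n` and in the words for the elements of `Z`
    (∃ (build : InputCode → RadiationCode) (path : InputCode × ℕ → List CutCode)
      (best : InputCode → ℕ) (basis : InputCode → List WordCode),
      Computable build ∧ Computable path ∧ Computable best ∧ Computable basis ∧
      ∀ (n : ℕ) (Z : List (List (Fin n × Bool))) (G : Subgroup (FreeGroup (Fin n)))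
        (input : InputCode), G = Subgroup.closure {g | ∃ p ∈ Z, g = FreeGroup.mk p} →
        input = (n, Z.map wordCode) →
        ∃ ν : Fin (build input).1.length → Subgroup (FreeGroup (Fin n)),
          -- the graph `(G◀)` is constructed
          IsRadiationCode G (build input) ν ∧
          -- for each vertex, a path from `G` to it is constructed
          (∀ i : Fin (build input).1.length, ∃ Cs : List (Cut (Fin n)),
            path (input, i.val) = Cs.map cutCode ∧ IsGoodPath G (ν i) Cs) ∧
          -- a vertex with `|E ∩ H|` maximal is found, and the basis `E''` determined by the
          -- constructed path from `G` to it is returned, and is maximizing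
          (∃ (b : Fin (build input).1.length) (Cs : List (Cut (Fin n))),
            best input = b.val ∧ IsMaxVertex G (ν b) ∧ path (input, b.val) = Cs.map cutCode ∧
            basis input =
              (List.finRange n).map (fun i => wordCode (pathAut Cs (FreeGroup.of i)).toWord) ∧
            IsMaximizingBasis G (pathBasis Cs))) := by
  refine ⟨fun E _ _ Z G hG => ?_, ?_⟩
  · have hcore : (core G).edges.Finite := by
      rw [hG]; exact core_closure_edges_finite Z.finite_toSet
    refine ⟨⟨finite_isVertex hcore, finite_radiationEdges hcore, ?_, ?_⟩, ?_, ?_, ?_⟩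
    · intro H hH
      have := hH.core_isFinite hcore
      exact ⟨fg_of_core_edges_finite this.2, this⟩
    · intro H K _ _ h
      exact core_iso_injective h
    · intro H hH
      obtain ⟨Cs, rfl⟩ := isVertex_iff_exists_path.1 hH
      exact ⟨Cs, isGoodPath_pathEnd Cs⟩
    · intro B hB
      exact exists_isVertex_encard_le G hB
    · intro H hH Cs hCs
      exact hH.isMaximizingBasis hCs
  · obtain ⟨f, hf, h⟩ := exists_computable_output
    refine ⟨fun x => (f x).1, fun x => (f x.1).2.1.getD x.2 [], fun x => (f x).2.2.1,
      fun x => (f x).2.2.2, ?_, ?_, ?_, ?_, ?_⟩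
    · exact Primrec.fst.to_comp.comp hf
    · exact ((Primrec.list_getD []).comp (Primrec.fst.comp (Primrec.snd.comp Primrec.fst))
        Primrec.snd).to_comp.comp ((hf.comp Computable.fst).pair Computable.snd)
    · exact (Primrec.fst.comp (Primrec.snd.comp Primrec.snd)).to_comp.comp hf
    · exact (Primrec.snd.comp (Primrec.snd.comp Primrec.snd)).to_comp.comp hf
    · rintro n Z G _ hG rfl
      exact (h n Z).spec hG
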